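/- For real $a,b$ let $N(a,b)$ be the Bianchi–Cartan–Vranceanu space, i.e. the open set $\{(x,y,z)\in\mathbb R^3:\lambda_a=1+a(x^2+y^2)>0\}$ with the Riemannian metric $$h_{a,b}=\frac{dx^2+dy^2}{\lambda_a^2}+\Big(dz+\frac b2\,\frac{y\,dx-x\,dy}{\lambda_a}\Big)^2 .$$ A curve $\gamma$ parametrized by arc length, with $\mathbf t=\gamma'$, is biharmonic if $\nabla_{\mathbf t}^3\mathbf t+R(\nabla_{\mathbf t}\mathbf t,\mathbf t)\mathbf t=0$, where $R(X,Y)=\nabla_X\nabla_Y-\nabla_Y\nabla_X-\nabla_{[X,Y]}$. A smoothly immersed surface is totally biharmonic (respectively totally geodesic) if all its geodesics, for the induced metric, are biharmonic curves (respectively geodesics) of the ambient space. Write $\mathbb S^2(\rho)\subset\mathbb R^3$ for the round sphere of curvature $\rho>0$ (radius $1/\sqrt\rho$), and $\mathbb S^1(\sqrt{2\rho})$ for a circle of curvature $\sqrt{2\rho}$ (radius $1/\sqrt{2\rho}$). **Theorem.** Assume $\rho=4a\neq b^2$. (1) Let $M$ be a connected smooth surface and $\varphi:M\to N(a,b)$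 a smooth totally biharmonic immersion. Then either $M$ is totally geodesic (part of a totally geodesic surface), or $M$ is part of a cylinder $\mathbb S^1(\sqrt{2\rho})\times\mathbb R$ in $\mathbb S^2(\rho)\times\mathbb R$. The second case occurs only when $N(a,b)\cong\mathbb S^2(\rho)\times\mathbb R$. Precisely, in that case $a>0$, $b=0$, and there are an isometry $F$ of $N(a,b)$ onto $(\mathbb S^2(\rho)\setminus\{\mathrm{point}\})\times\mathbb R$ and a circle $C\subset\mathbb S^2(\rho)$ of radius $1/\sqrt{2\rho}$ such that $F(\varphi(M))\subset C\times\mathbb R$. (2) Let $a>0$ and $b=0$. For $r>0$, the rotational Hopf cylinder $x^2+y^2=r^2$ in $N(a,0)$ is totally biharmonic and not totally geodesic if and only if $r^2=\frac{3+2\sqrt2}{a}$ or $r^2=\frac{3-2\sqrt2}{a}$. Let $r_+,r_->0$ be these two radii, let $M_\pm$ be the corresponding cylinders, parametrized by $$X_\pm(s,t)=\big(r_\pm\sin(\omega_\pm s),\,-r_\pm\cos(\omega_\pm s),\,t\big),\qquad \omega_\pm=\frac{1+a r_\pm^2}{r_\pm},$$ and let $\eta_\pm$ be the unit normals pointing away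 from the axis. Then $M_+$ and $M_-$ are congruent and differ only by orientation. That is, there are an isometry $F$ of $N(a,0)$ onto $(\mathbb S^2(\rho)\setminus\{\mathrm{point}\})\times\mathbb R$ and an isometry $\Phi=A\times\mathrm{id}$ of $\mathbb S^2(\rho)\times\mathbb R$, with $A$ a linear isometry of $\mathbb R^3$, such that $\Phi\circ F\circ X_+=F\circ X_-$ and $d\Phi(dF(\eta_+))=-dF(\eta_-)$. Moreover, in the parametrizations $X_\pm$, $M_+$ and $M_-$ have the same first fundamental form, and their second fundamental forms with respect to $\eta_+$ and $\eta_-$ are opposite. -/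

import Mathlib

open scoped Manifold ContDiff

noncomputable section

/-! ### Riemannian geometry of a metric on an open part of `ℝ³` (coordinate formulas) -/

/-- Coordinate `3`-space. -/
abbrev Coord3 : Type := Fin 3 → ℝ

/-- A field of coordinate matrices `g p i j = g_p(∂ᵢ, ∂ⱼ)`. -/
abbrev MetricField : Type := Coord3 → Matrix (Fin 3) (Fin 3) ℝ

namespace MetricField

/-- `g_p(u, v)`. -/
def inner (g : MetricField) (p u v : Coord3) : ℝ :=
  ∑ i, ∑ j, g p i j * u i * v j

/-- The partial derivative `∂ᵢ f` at `p`. -/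
def partialDeriv (i : Fin 3) (f : Coord3 → ℝ) (p : Coord3) : ℝ :=
  fderiv ℝ f p (Pi.single i 1)

/-- Christoffel symbols `Γᵏᵢⱼ` of the Levi-Civita connection of `g`. -/
def christoffel (g : MetricField) (k i j : Fin 3) (p : Coord3) : ℝ :=
  (1 / 2) * ∑ l, (g p)⁻¹ k l *
    (partialDeriv i (fun q => g q j l) p + partialDeriv j (fun q => g q i l) p
      - partialDeriv l (fun q => g q i j) p)

/-- Components `Rˡᵢⱼₖ` of the curvature tensor: `R(∂ᵢ, ∂ⱼ) ∂ₖ = ∑ₗ Rˡᵢⱼₖ ∂ₗ`. -/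
def curvatureCoeff (g : MetricField) (l i j k : Fin 3) (p : Coord3) : ℝ :=
  partialDeriv i (g.christoffel l j k) p - partialDeriv j (g.christoffel l i k) p
    + ∑ m, (g.christoffel l i m p * g.christoffel m j k p
      - g.christoffel l j m p * g.christoffel m i k p)

/-- `R(X, Y) Z = ∇_X ∇_Y Z - ∇_Y ∇_X Z - ∇_[X,Y] Z` at `p`. -/
def curvature (g : MetricField) (p X Y Z : Coord3) : Coord3 := fun l =>
  ∑ i, ∑ j, ∑ k, g.curvatureCoeff l i j k p * X i * Y j * Z k

/-- Covariant derivative along the curve `γ` of the vector field `V` along `γ`. -/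
def covDeriv (g : MetricField) (γ V : ℝ → Coord3) : ℝ → Coord3 := fun t k =>
  deriv V t k + ∑ i, ∑ j, g.christoffel k i j (γ t) * deriv γ t i * V t j

/-- The acceleration `∇_𝐭 𝐭` of a curve, `𝐭 = γ'`. -/
def acceleration (g : MetricField) (γ : ℝ → Coord3) : ℝ → Coord3 :=
  g.covDeriv γ (deriv γ)

/-- The bitension field `∇_𝐭³ 𝐭 + R(∇_𝐭 𝐭, 𝐭) 𝐭` of a curve, `𝐭 = γ'`. -/
def bitension (g : MetricField) (γ : ℝ → Coord3) : ℝ → Coord3 := fun t =>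
  g.covDeriv γ (g.covDeriv γ (g.acceleration γ)) t
    + g.curvature (γ t) (g.acceleration γ t) (deriv γ t) (deriv γ t)

/-! ### Immersed surfaces, their geodesics, totally biharmonic surfaces -/

section Surface

variable {M : Type*} [TopologicalSpace M] [ChartedSpace (EuclideanSpace ℝ (Fin 2)) M]

/-- A smooth immersion of the `2`-manifold `M` into the open region `N` of `ℝ³`. -/
def IsImmersion (N : Set Coord3) (φ : M → Coord3) : Prop :=
  ContMDiff (𝓡 2) 𝓘(ℝ, Coord3) ∞ φ ∧ (∀ m, φ m ∈ N) ∧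
    ∀ m, Function.Injective (mfderiv (𝓡 2) 𝓘(ℝ, Coord3) φ m)

/-- `c : I → M` is a geodesic, parametrized by arc length on the open interval `I`, of `M` with
the metric induced by the immersion `φ`.  The Levi-Civita connection of the induced metric is the
tangential part of the ambient one, so the geodesic equation says that the ambient acceleration of
`φ ∘ c` is orthogonal to `dφ(TM)`. -/
def IsSurfaceGeodesic (g : MetricField) (φ : M → Coord3) (I : Set ℝ) (c : ℝ → M) : Prop :=
  ContMDiffOn 𝓘(ℝ, ℝ) (𝓡 2) ∞ c I ∧
    ∀ t ∈ I, g.inner (φ (c t)) (deriv (φ ∘ c) t) (deriv (φ ∘ c) t) = 1 ∧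
      ∀ v : TangentSpace (𝓡 2) (c t),
        g.inner (φ (c t)) (g.acceleration (φ ∘ c) t)
          (mfderiv (𝓡 2) 𝓘(ℝ, Coord3) φ (c t) v) = 0

/-- All geodesics of the immersed surface are biharmonic curves of the ambient space. -/
def TotallyBiharmonic (g : MetricField) (φ : M → Coord3) : Prop :=
  ∀ (I : Set ℝ) (c : ℝ → M), IsOpen I → I.OrdConnected → g.IsSurfaceGeodesic φ I c →
    ∀ t ∈ I, g.bitension (φ ∘ c) t = 0

/-- All geodesics of the immersed surface are geodesics of the ambient space. -/
def TotallyGeodesic (g : MetricField) (φ : M → Coord3) : Prop :=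
  ∀ (I : Set ℝ) (c : ℝ → M), IsOpen I → I.OrdConnected → g.IsSurfaceGeodesic φ I c →
    ∀ t ∈ I, g.acceleration (φ ∘ c) t = 0

end Surface

/-- First fundamental form `I_q(v, v)` of the parametrized surface `X`. -/
def firstForm (g : MetricField) (X : EuclideanSpace ℝ (Fin 2) → Coord3)
    (q v : EuclideanSpace ℝ (Fin 2)) : ℝ :=
  g.inner (X q) (fderiv ℝ X q v) (fderiv ℝ X q v)

/-- `ν` is a field of unit normals along the parametrized surface `X`. -/
def IsUnitNormal (g : MetricField) (X ν : EuclideanSpace ℝ (Fin 2) → Coord3) : Prop :=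
  ∀ q, g.inner (X q) (ν q) (ν q) = 1 ∧ ∀ v, g.inner (X q) (fderiv ℝ X q v) (ν q) = 0

/-- Second fundamental form `II_q(v, v) = ⟨∇_𝐭 𝐭, ν⟩` of the parametrized surface `X` with respect
to the unit normal field `ν`, where `𝐭` is the velocity of the curve `τ ↦ X (q + τ v)`. -/
def secondForm (g : MetricField) (X ν : EuclideanSpace ℝ (Fin 2) → Coord3)
    (q v : EuclideanSpace ℝ (Fin 2)) : ℝ :=
  g.inner (X q) (g.acceleration (fun τ : ℝ => X (q + τ • v)) 0) (ν q)

end MetricField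

/-! ### Bianchi-Cartan-Vranceanu spaces -/

/-- `λₐ = 1 + a (x² + y²)`. -/
def bcvLambda (a : ℝ) (p : Coord3) : ℝ := 1 + a * (p 0 ^ 2 + p 1 ^ 2)

/-- The underlying open set of `N(a,b)` (it depends on `a` only). -/
def bcvDomain (a : ℝ) : Set Coord3 := {p | 0 < bcvLambda a p}

/-- The quadratic form `h_{a,b} = (dx² + dy²) / λₐ² + (dz + (b/2) (y dx - x dy) / λₐ)²`,
polarized. -/
def bcvForm (a b : ℝ) (p u v : Coord3) : ℝ :=
  (u 0 * v 0 + u 1 * v 1) / bcvLambda a p ^ 2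
    + (u 2 + b / 2 * ((p 1 * u 0 - p 0 * u 1) / bcvLambda a p))
      * (v 2 + b / 2 * ((p 1 * v 0 - p 0 * v 1) / bcvLambda a p))

/-- The metric `h_{a,b}` as a field of coordinate matrices. -/
def bcvMetric (a b : ℝ) : MetricField := fun p =>
  Matrix.of fun i j => bcvForm a b p (Pi.single i 1) (Pi.single j 1)

/-! ### The product `𝕊²(ρ) × ℝ` -/

/-- `F` maps `N(a,b)` isometrically onto `(𝕊²(ρ) - {point}) × ℝ`, where `𝕊²(ρ) ⊆ ℝ³` is the round
sphere of curvature `ρ`, that is, of radius `1 / √ρ`. -/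
def IsIsometryOntoSphereTimesLine (a b ρ : ℝ) (F : Coord3 → EuclideanSpace ℝ (Fin 3) × ℝ) : Prop :=
  ContDiffOn ℝ ∞ F (bcvDomain a) ∧ Set.InjOn F (bcvDomain a) ∧
    (∃ pole ∈ Metric.sphere (0 : EuclideanSpace ℝ (Fin 3)) (1 / √ρ),
      F '' bcvDomain a = (Metric.sphere 0 (1 / √ρ) \ {pole}) ×ˢ Set.univ) ∧
    ∀ p ∈ bcvDomain a, ∀ u v : Coord3,
      inner ℝ (fderiv ℝ F p u).1 (fderiv ℝ F p v).1 + (fderiv ℝ F p u).2 * (fderiv ℝ F p v).2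
        = bcvForm a b p u v

/-- `C` is a circle of radius `r` in Euclidean `3`-space. -/
def IsCircle (C : Set (EuclideanSpace ℝ (Fin 3))) (r : ℝ) : Prop :=
  0 < r ∧ ∃ o v : EuclideanSpace ℝ (Fin 3), ‖v‖ = 1 ∧
    C = {q | ‖q - o‖ = r ∧ inner ℝ (q - o) v = 0}

/-! ### Rotational Hopf cylinders of `N(a,0)` -/

/-- The rotational Hopf cylinder of Euclidean radius `r` in `N(a,0)`: the vertical cylinder over the
circle `x² + y² = r²`, the latter parametrized by arc length. -/
def hopfCylinder (a r : ℝ) (q : EuclideanSpace ℝ (Fin 2)) : Coord3 :=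
  ![r * Real.sin ((1 + a * r ^ 2) / r * q 0), -(r * Real.cos ((1 + a * r ^ 2) / r * q 0)), q 1]

/-- The unit normal of the Hopf cylinder in `N(a,0)` that points away from the axis. -/
def hopfNormal (a r : ℝ) (q : EuclideanSpace ℝ (Fin 2)) : Coord3 :=
  ![(1 + a * r ^ 2) * Real.sin ((1 + a * r ^ 2) / r * q 0),
    -((1 + a * r ^ 2) * Real.cos ((1 + a * r ^ 2) / r * q 0)), 0]

end

noncomputable section

open Matrix

/-! ### The Levi-Civita connection of `N(a,b)` in coordinates -/

/-! All computations take place in the orthonormal frame `E₁, E₂, E₃ = ∂_z`. There the metric is the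
dot product of `ℝ³`, covariant differentiation is `V' + Ω × V`, and the curvature is `R(X, Y)Z =
-G(X × Y) × Z` with the constant matrix `G = diag(b²/4, b²/4, 4a - 3b²/4)` (`bcvFrame_covDeriv`,
`bcvFrame_curvature`).

Let `N` be a unit normal, `A` the shape operator, and `k = II(T, T)` the normal curvature of a unit
speed geodesic with velocity `T`. Its bitension is `k''N - 2k'AT - k(∇_T(AT) + G(N × T) × T)`. The
component along `T` is `-3kk'`, so `k` is locally constant where it is non-zero, and there `(∇_T A)T
= -G(N × T) × T`, where `∇` is the ambient connection and the normal component is kept. Both sides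
are quadratic in `T`, so at a point with `II ≠ 0` the identity holds in all tangent directions
(`dshape_self`).

Polarizing, and using the Codazzi equation and the symmetry of `∇A`, one gets `⟨GT, N⟩ = (4a - b²)
T₃ N₃ = 0` (`codazzi_algebra`): since `4a ≠ b²`, the surface is horizontal or vertical at the point.
A piece with normal `±E₃` would have `II(v, v) = 0`, hence `N₃ = 0` (`normal_two_eq_zero`). The
normal component of the identity is `|AT|² = ⟨G(N × T), N × T⟩`. On the tangent basis `E₃`, `ξ = N ×
E₃`, with `κ = II(ξ, ξ)`, it gives `bκ = 0` and `κ² = 4a - b² ≠ 0`. So `b = 0`, `a > 0`, and the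
surface is locally a vertical cylinder over a curve of geodesic curvature `±2√a` in the sphere of
curvature `4a` (`biharmonic_structure`). These relations survive in limits, where they again force
`II ≠ 0`. The totally geodesic points therefore form a clopen set (`isClopen_setOf_flatAt`), and
connectedness gives the dichotomy.

For a curve `q` on that sphere, of geodesic curvature `2√a` with respect to the normal `n` in the
sphere, the vector `n + 2√a q` of `ℝ³` is constant, and `⟨q, n + 2√a q⟩ = 1/(2√a)` is the plane of a
circle of radius `1/√(8a)`. The vector can be read off from the acceleration of any geodesic that is
not an ambient geodesic, so it depends neither on a chart nor on an orientation, and it is constant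
on a connected surface (`eventually_isAxisAt_iff`).

For the second part, a Hopf cylinder is flat in its parameters `(s, t)` with constant curvature `k`
of the base circle, and its geodesics have bitension `-k(k² - 4a) s'⁴ N` (`bitension_hopfCylinder`).
The equation `k² = 4a` is quadratic in `ar²` with roots `3 ± 2√2`. Their product is `1`, so the two
radii are exchanged by the inversion in `r² = 1/a`, which is the reflection of the sphere in its
equator (`hopfCylinder_inversion`). -/

theorem isOpen_bcvDomain (a : ℝ) : IsOpen (bcvDomain a) := by
  unfold bcvDomain bcvLambda
  exact isOpen_lt continuous_const (by fun_prop)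

theorem hasFDerivAt_bcvLambda (a : ℝ) (p : Coord3) :
    HasFDerivAt (bcvLambda a)
      ((2 * a * p 0) • (ContinuousLinearMap.proj (R := ℝ) (φ := fun _ : Fin 3 => ℝ) 0)
        + (2 * a * p 1) • (ContinuousLinearMap.proj (R := ℝ) (φ := fun _ : Fin 3 => ℝ) 1)) p := by
  have h0 : HasFDerivAt (fun q : Coord3 => q 0)
      (ContinuousLinearMap.proj (R := ℝ) (φ := fun _ : Fin 3 => ℝ) 0) p := hasFDerivAt_apply 0 p
  have h1 : HasFDerivAt (fun q : Coord3 => q 1)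
      (ContinuousLinearMap.proj (R := ℝ) (φ := fun _ : Fin 3 => ℝ) 1) p := hasFDerivAt_apply 1 p
  have h := ((((h0.pow 2).add (h1.pow 2)).const_mul a).const_add 1)
  refine h.congr_fderiv ?_
  ext v
  simp
  ring

namespace MetricField

/-- Values of the partial derivatives of a function with a given derivative. -/
theorem partialDeriv_eq {i : Fin 3} {f : Coord3 → ℝ} {f' : Coord3 →L[ℝ] ℝ} {p : Coord3}
    (h : HasFDerivAt f f' p) : partialDeriv i f p = f' (Pi.single i 1) := by
  rw [partialDeriv, h.fderiv]

/-- The partial derivatives of `λₐ`. -/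
def lambdaPartial (a : ℝ) (i : Fin 3) (p : Coord3) : ℝ := ![2 * a * p 0, 2 * a * p 1, 0] i

theorem hasFDerivAt_inv_lambda (a : ℝ) {p : Coord3} (hp : bcvLambda a p ≠ 0) :
    HasFDerivAt (fun q => (bcvLambda a q)⁻¹)
      ((-(bcvLambda a p ^ 2)⁻¹) •
        ((2 * a * p 0) • (ContinuousLinearMap.proj (R := ℝ) (φ := fun _ : Fin 3 => ℝ) 0)
        + (2 * a * p 1) • (ContinuousLinearMap.proj (R := ℝ) (φ := fun _ : Fin 3 => ℝ) 1))) p :=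
  (hasDerivAt_inv hp).comp_hasFDerivAt p (hasFDerivAt_bcvLambda a p)

theorem partialDeriv_div_lambda (a : ℝ) (i j : Fin 3) {p : Coord3} (hp : bcvLambda a p ≠ 0) :
    partialDeriv i (fun q => q j / bcvLambda a q) p
      = ((if i = j then 1 else 0) * bcvLambda a p - p j * lambdaPartial a i p)
        / bcvLambda a p ^ 2 := by
  have h1 : HasFDerivAt (fun q : Coord3 => q j)
      (ContinuousLinearMap.proj (R := ℝ) (φ := fun _ : Fin 3 => ℝ) j) p := hasFDerivAt_apply j p
  have h : HasFDerivAt (fun q => q j / bcvLambda a q) _ p := h1.mul (hasFDerivAt_inv_lambda a hp)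
  rw [partialDeriv_eq h]
  fin_cases i <;> fin_cases j <;> simp [lambdaPartial] <;> field_simp <;> ring

theorem partialDeriv_mul_div_lambda_sq (a : ℝ) (i j k : Fin 3) {p : Coord3}
    (hp : bcvLambda a p ≠ 0) :
    partialDeriv i (fun q => q j * q k / bcvLambda a q ^ 2) p
      = (((if i = j then 1 else 0) * p k + (if i = k then 1 else 0) * p j) * bcvLambda a p
          - 2 * (p j * p k) * lambdaPartial a i p) / bcvLambda a p ^ 3 := by
  have h1 : HasFDerivAt (fun q : Coord3 => q j)
      (ContinuousLinearMap.proj (R := ℝ) (φ := fun _ : Fin 3 => ℝ) j) p := hasFDerivAt_apply j p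
  have h2 : HasFDerivAt (fun q : Coord3 => q k)
      (ContinuousLinearMap.proj (R := ℝ) (φ := fun _ : Fin 3 => ℝ) k) p := hasFDerivAt_apply k p
  have h := (h1.mul h2).mul ((hasFDerivAt_inv_lambda a hp).pow 2)
  have he : (fun q : Coord3 => q j * q k / bcvLambda a q ^ 2)
      = ((fun q => q j) * fun q => q k) * fun q => (bcvLambda a q)⁻¹ ^ 2 := by
    ext q; simp [div_eq_mul_inv]
  rw [he, partialDeriv_eq h, eq_div_iff (pow_ne_zero 3 hp)]
  fin_cases i <;> fin_cases j <;> fin_cases k <;>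
    simp [lambdaPartial] <;> field_simp <;> ring

theorem partialDeriv_inv_lambda_sq (a : ℝ) (i : Fin 3) {p : Coord3} (hp : bcvLambda a p ≠ 0) :
    partialDeriv i (fun q => (bcvLambda a q ^ 2)⁻¹) p
      = -2 * lambdaPartial a i p / bcvLambda a p ^ 3 := by
  have h := (hasFDerivAt_inv_lambda a hp).pow 2
  have he : (fun q : Coord3 => (bcvLambda a q ^ 2)⁻¹)
      = fun q => (bcvLambda a q)⁻¹ ^ 2 := by
    ext q; simp
  rw [he, partialDeriv_eq h, eq_div_iff (pow_ne_zero 3 hp)]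
  fin_cases i <;> simp [lambdaPartial] <;> field_simp

end MetricField

namespace MetricField

theorem partialDeriv_const_mul (i : Fin 3) (c : ℝ) (f : Coord3 → ℝ) (p : Coord3) :
    partialDeriv i (fun q => c * f q) p = c * partialDeriv i f p := by
  have h : (fun q => c * f q) = c • f := rfl
  rw [partialDeriv, h, fderiv_const_smul_field]
  rfl

theorem partialDeriv_const (i : Fin 3) (c : ℝ) (p : Coord3) :
    partialDeriv i (fun _ => c) p = 0 := by
  simp [partialDeriv]

theorem partialDeriv_add (i : Fin 3) {f g : Coord3 → ℝ} {p : Coord3}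
    (hf : DifferentiableAt ℝ f p) (hg : DifferentiableAt ℝ g p) :
    partialDeriv i (fun q => f q + g q) p = partialDeriv i f p + partialDeriv i g p := by
  simp [partialDeriv, fderiv_fun_add hf hg]

theorem differentiableAt_bcvLambda (a : ℝ) (p : Coord3) : DifferentiableAt ℝ (bcvLambda a) p :=
  (hasFDerivAt_bcvLambda a p).differentiableAt

/-- The coordinate matrix of `h_{a,b}` in closed form. -/
theorem bcvMetric_eq (a b : ℝ) (p : Coord3) :
    bcvMetric a b p = !![(bcvLambda a p ^ 2)⁻¹ + b ^ 2 / 4 * (p 1 * p 1 / bcvLambda a p ^ 2),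
        -(b ^ 2 / 4) * (p 0 * p 1 / bcvLambda a p ^ 2), b / 2 * (p 1 / bcvLambda a p);
      -(b ^ 2 / 4) * (p 0 * p 1 / bcvLambda a p ^ 2),
        (bcvLambda a p ^ 2)⁻¹ + b ^ 2 / 4 * (p 0 * p 0 / bcvLambda a p ^ 2),
        -(b / 2) * (p 0 / bcvLambda a p);
      b / 2 * (p 1 / bcvLambda a p), -(b / 2) * (p 0 / bcvLambda a p), 1] := by
  ext i j
  fin_cases i <;> fin_cases j <;> simp [bcvMetric, bcvForm] <;> ring

theorem bcvMetric_inv (a b : ℝ) {p : Coord3} (hp : bcvLambda a p ≠ 0) :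
    (bcvMetric a b p)⁻¹ = !![bcvLambda a p ^ 2, 0, -(b / 2) * p 1 * bcvLambda a p;
      0, bcvLambda a p ^ 2, b / 2 * p 0 * bcvLambda a p;
      -(b / 2) * p 1 * bcvLambda a p, b / 2 * p 0 * bcvLambda a p,
        1 + b ^ 2 / 4 * (p 0 ^ 2 + p 1 ^ 2)] := by
  apply Matrix.inv_eq_right_inv
  rw [bcvMetric_eq]
  ext i j
  fin_cases i <;> fin_cases j <;> simp [Matrix.mul_apply, Fin.sum_univ_three] <;> field_simp <;>
    ring

/-- The partial derivatives of the coordinate matrix of `h_{a,b}`. -/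
theorem partialDeriv_bcvMetric (a b : ℝ) (i : Fin 3) {p : Coord3} (hp : bcvLambda a p ≠ 0) :
    (Matrix.of fun j l => partialDeriv i (fun q => bcvMetric a b q j l) p)
      = !![partialDeriv i (fun q => (bcvLambda a q ^ 2)⁻¹) p
            + b ^ 2 / 4 * partialDeriv i (fun q => q 1 * q 1 / bcvLambda a q ^ 2) p,
          -(b ^ 2 / 4) * partialDeriv i (fun q => q 0 * q 1 / bcvLambda a q ^ 2) p,
          b / 2 * partialDeriv i (fun q => q 1 / bcvLambda a q) p;
        -(b ^ 2 / 4) * partialDeriv i (fun q => q 0 * q 1 / bcvLambda a q ^ 2) p,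
          partialDeriv i (fun q => (bcvLambda a q ^ 2)⁻¹) p
            + b ^ 2 / 4 * partialDeriv i (fun q => q 0 * q 0 / bcvLambda a q ^ 2) p,
          -(b / 2) * partialDeriv i (fun q => q 0 / bcvLambda a q) p;
        b / 2 * partialDeriv i (fun q => q 1 / bcvLambda a q) p,
          -(b / 2) * partialDeriv i (fun q => q 0 / bcvLambda a q) p, 0] := by
  have hd := differentiableAt_bcvLambda a p
  have h2 : bcvLambda a p ^ 2 ≠ 0 := pow_ne_zero 2 hp
  have e1 : DifferentiableAt ℝ (fun q => (bcvLambda a q ^ 2)⁻¹) p := by fun_prop (disch := assumption)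
  have e2 : ∀ j : Fin 3, DifferentiableAt ℝ
      (fun q => b ^ 2 / 4 * (q j * q j / bcvLambda a q ^ 2)) p := by
    intro j; fun_prop (disch := assumption)
  ext j l
  -- Excluding `neg_mul` keeps negative coefficients in the form `c * f` that
  -- `partialDeriv_const_mul` matches.
  fin_cases j <;> fin_cases l <;>
    simp [bcvMetric_eq, partialDeriv_add _ e1 (e2 _), partialDeriv_const_mul, partialDeriv_const,
      -neg_mul]

/-- The Christoffel symbols of `h_{a,b}` in closed form. -/
def bcvChristoffel (a b : ℝ) (p : Coord3) : Fin 3 → Matrix (Fin 3) (Fin 3) ℝ :=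
  ![!![-(2 * a) * (p 0 / bcvLambda a p), (b ^ 2 / 4 - 2 * a) * (p 1 / bcvLambda a p), 0;
      (b ^ 2 / 4 - 2 * a) * (p 1 / bcvLambda a p),
        (2 * a - b ^ 2 / 2) * (p 0 / bcvLambda a p), b / 2;
      0, b / 2, 0],
    !![(2 * a - b ^ 2 / 2) * (p 1 / bcvLambda a p),
        (b ^ 2 / 4 - 2 * a) * (p 0 / bcvLambda a p), -(b / 2);
      (b ^ 2 / 4 - 2 * a) * (p 0 / bcvLambda a p), -(2 * a) * (p 1 / bcvLambda a p), 0;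
      -(b / 2), 0, 0],
    !![b / 2 * (2 * a - b ^ 2 / 2) * (p 0 * p 1 / bcvLambda a p ^ 2),
        b / 2 * (b ^ 2 / 4 - a) * (p 0 * p 0 / bcvLambda a p ^ 2)
          + (-(b / 2 * (b ^ 2 / 4 - a))) * (p 1 * p 1 / bcvLambda a p ^ 2),
        -(b ^ 2 / 4) * (p 0 / bcvLambda a p);
      b / 2 * (b ^ 2 / 4 - a) * (p 0 * p 0 / bcvLambda a p ^ 2)
          + (-(b / 2 * (b ^ 2 / 4 - a))) * (p 1 * p 1 / bcvLambda a p ^ 2),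
        -(b / 2 * (2 * a - b ^ 2 / 2)) * (p 0 * p 1 / bcvLambda a p ^ 2),
        -(b ^ 2 / 4) * (p 1 / bcvLambda a p);
      -(b ^ 2 / 4) * (p 0 / bcvLambda a p), -(b ^ 2 / 4) * (p 1 / bcvLambda a p), 0]]

/-- The closed form is chosen so that every entry is, up to constants, a combination of `qᵢ/λ` and
`qᵢqⱼ/λ²`. The derivatives needed for the curvature then come from the same lemmas as those of the
metric. -/
theorem christoffel_bcvMetric (a b : ℝ) (k i j : Fin 3) {p : Coord3} (hp : bcvLambda a p ≠ 0) :
    (bcvMetric a b).christoffel k i j p = bcvChristoffel a b p k i j := by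
  have hm : ∀ i j l, partialDeriv i (fun q => bcvMetric a b q j l) p = _ :=
    fun i j l => congrFun (congrFun (partialDeriv_bcvMetric a b i hp) j) l
  simp only [christoffel, hm, bcvMetric_inv a b hp, partialDeriv_div_lambda a _ _ hp,
    partialDeriv_mul_div_lambda_sq a _ _ _ hp, partialDeriv_inv_lambda_sq a _ hp,
    Fin.sum_univ_three]
  -- `λ` is treated as an independent symbol while denominators are cleared. Its definition is
  -- substituted only afterwards, where it still occurs.
  have hl : bcvLambda a p = 1 + a * (p 0 ^ 2 + p 1 ^ 2) := rfl
  fin_cases k <;> fin_cases i <;> fin_cases j <;>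
    simp [bcvChristoffel, lambdaPartial] <;> field_simp <;> (try rw [hl]) <;> ring

end MetricField

/-! ### Connection and curvature in the orthonormal frame. -/

/-- The components of a tangent vector with respect to the orthonormal frame
`E₁ = λ ∂ₓ - (b/2) y ∂_z`, `E₂ = λ ∂_y + (b/2) x ∂_z`, `E₃ = ∂_z`. -/
def bcvFrame (a b : ℝ) (p u : Coord3) : Coord3 :=
  ![u 0 / bcvLambda a p, u 1 / bcvLambda a p,
    u 2 + b / 2 * ((p 1 * u 0 - p 0 * u 1) / bcvLambda a p)]

/-- The tangent vector with given components with respect to the orthonormal frame. -/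
def bcvCoframe (a b : ℝ) (p f : Coord3) : Coord3 :=
  ![bcvLambda a p * f 0, bcvLambda a p * f 1, f 2 - b / 2 * (p 1 * f 0 - p 0 * f 1)]

/-- The connection form in the orthonormal frame, as an axial vector. -/
def bcvConn (a b : ℝ) (p t : Coord3) : Coord3 :=
  ![b / 2 * t 0, b / 2 * t 1, 2 * a * (p 1 * t 0 - p 0 * t 1) - b / 2 * t 2]

/-- The curvature operator in the orthonormal frame: `R(X, Y)Z = -G(X × Y) × Z`. -/
def bcvCurv (a b : ℝ) (w : Coord3) : Coord3 :=
  ![b ^ 2 / 4 * w 0, b ^ 2 / 4 * w 1, (4 * a - 3 * b ^ 2 / 4) * w 2]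

theorem bcvFrame_bcvCoframe {a b : ℝ} {p : Coord3} (hp : bcvLambda a p ≠ 0) (f : Coord3) :
    bcvFrame a b p (bcvCoframe a b p f) = f := by
  ext i; fin_cases i <;> simp [bcvFrame, bcvCoframe] <;> field_simp <;> ring

theorem bcvCoframe_bcvFrame {a b : ℝ} {p : Coord3} (hp : bcvLambda a p ≠ 0) (u : Coord3) :
    bcvCoframe a b p (bcvFrame a b p u) = u := by
  ext i; fin_cases i <;> simp [bcvFrame, bcvCoframe] <;> field_simp <;> ring

theorem bcvFrame_eq_zero {a b : ℝ} {p u : Coord3} (hp : bcvLambda a p ≠ 0) :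
    bcvFrame a b p u = 0 ↔ u = 0 := by
  constructor
  · intro h
    rw [← bcvCoframe_bcvFrame (b := b) hp u, h]
    ext i; fin_cases i <;> simp [bcvCoframe]
  · rintro rfl
    ext i; fin_cases i <;> simp [bcvFrame]

theorem bcvForm_eq_dotProduct (a b : ℝ) (p u v : Coord3) :
    bcvForm a b p u v = bcvFrame a b p u ⬝ᵥ bcvFrame a b p v := by
  simp [bcvForm, bcvFrame, dotProduct, Fin.sum_univ_three]; ring

theorem bcvMetric_inner (a b : ℝ) (p u v : Coord3) :
    (bcvMetric a b).inner p u v = bcvFrame a b p u ⬝ᵥ bcvFrame a b p v := by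
  simp only [MetricField.inner, MetricField.bcvMetric_eq, dotProduct, Fin.sum_univ_three, bcvFrame]
  simp
  ring

namespace MetricField

/-- `DV = V' + Ω(t) × V`, in the orthonormal frame, for a vector field `V` along a curve `γ` whose
velocity is `τ` in the orthonormal frame. -/
def frameDeriv (a b : ℝ) (γ τ V : ℝ → Coord3) (t : ℝ) : Coord3 :=
  deriv V t + bcvConn a b (γ t) (τ t) ⨯₃ V t

/-- The correction vector is the derivative of the coefficients `1/λ` and `(b/2)(y, -x)/λ` of the
dual frame along the curve. Together with the Christoffel terms it adds up to `Ω × V`. -/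
theorem hasDerivAt_bcvFrame (a b : ℝ) {γ V : ℝ → Coord3} {γ' V' : Coord3} {t : ℝ}
    (hγ : HasDerivAt γ γ' t) (hV : HasDerivAt V V' t) (hp : bcvLambda a (γ t) ≠ 0) :
    HasDerivAt (fun s => bcvFrame a b (γ s) (V s))
      (bcvFrame a b (γ t) V' + ![-(V t 0 * (2 * a * (γ t 0 * γ' 0 + γ t 1 * γ' 1))
          / bcvLambda a (γ t) ^ 2), -(V t 1 * (2 * a * (γ t 0 * γ' 0 + γ t 1 * γ' 1))
          / bcvLambda a (γ t) ^ 2), b / 2 * ((γ' 1 * V t 0 - γ' 0 * V t 1) / bcvLambda a (γ t)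
          - (γ t 1 * V t 0 - γ t 0 * V t 1) * (2 * a * (γ t 0 * γ' 0 + γ t 1 * γ' 1))
            / bcvLambda a (γ t) ^ 2)]) t := by
  have g := hasDerivAt_pi.1 hγ
  have w := hasDerivAt_pi.1 hV
  have l : HasDerivAt (fun s => bcvLambda a (γ s))
      (2 * a * (γ t 0 * γ' 0 + γ t 1 * γ' 1)) t := by
    refine (((((g 0).fun_pow 2).add ((g 1).fun_pow 2)).const_mul a).const_add 1).congr_deriv ?_
    simp; ring
  rw [hasDerivAt_pi]
  intro i
  fin_cases i
  · refine ((w 0).fun_div l hp).congr_deriv ?_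
    simp [bcvFrame]; field_simp; ring
  · refine ((w 1).fun_div l hp).congr_deriv ?_
    simp [bcvFrame]; field_simp; ring
  · refine ((w 2).fun_add (((((g 1).fun_mul (w 0)).fun_sub ((g 0).fun_mul (w 1))).fun_div l hp).const_mul
      (b / 2))).congr_deriv ?_
    simp [bcvFrame]; field_simp; ring

/-- The covariant derivative along a curve of `N(a,b)` in the orthonormal frame. -/
theorem bcvFrame_covDeriv (a b : ℝ) {γ V : ℝ → Coord3} {t : ℝ}
    (hγ : DifferentiableAt ℝ γ t) (hV : DifferentiableAt ℝ V t) (hp : bcvLambda a (γ t) ≠ 0) :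
    bcvFrame a b (γ t) ((bcvMetric a b).covDeriv γ V t)
      = frameDeriv a b γ (fun s => bcvFrame a b (γ s) (deriv γ s))
          (fun s => bcvFrame a b (γ s) (V s)) t := by
  rw [frameDeriv, (hasDerivAt_bcvFrame a b hγ.hasDerivAt hV.hasDerivAt hp).deriv]
  have hl : bcvLambda a (γ t) = 1 + a * (γ t 0 ^ 2 + γ t 1 ^ 2) := rfl
  have hc : (bcvMetric a b).covDeriv γ V t = deriv V t + ![
      ∑ i, ∑ j, bcvChristoffel a b (γ t) 0 i j * deriv γ t i * V t j,
      ∑ i, ∑ j, bcvChristoffel a b (γ t) 1 i j * deriv γ t i * V t j,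
      ∑ i, ∑ j, bcvChristoffel a b (γ t) 2 i j * deriv γ t i * V t j] := by
    ext k
    simp only [covDeriv, christoffel_bcvMetric a b _ _ _ hp]
    fin_cases k <;> simp
  rw [hc]
  simp only [bcvChristoffel, Fin.sum_univ_three, cross_apply]
  ext k
  fin_cases k <;> simp [bcvFrame, bcvConn] <;> field_simp <;> (try rw [hl]) <;> ring

/-- The partial derivatives of the Christoffel symbols of `h_{a,b}`. -/
theorem partialDeriv_bcvChristoffel (a b : ℝ) (m : Fin 3) {p : Coord3} (hp : bcvLambda a p ≠ 0) :
    (fun k => Matrix.of fun i j => partialDeriv m (fun q => bcvChristoffel a b q k i j) p) =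
  ![!![-(2 * a) * partialDeriv m (fun q => q 0 / bcvLambda a q) p,
        (b ^ 2 / 4 - 2 * a) * partialDeriv m (fun q => q 1 / bcvLambda a q) p, 0;
      (b ^ 2 / 4 - 2 * a) * partialDeriv m (fun q => q 1 / bcvLambda a q) p,
        (2 * a - b ^ 2 / 2) * partialDeriv m (fun q => q 0 / bcvLambda a q) p, 0;
      0, 0, 0],
    !![(2 * a - b ^ 2 / 2) * partialDeriv m (fun q => q 1 / bcvLambda a q) p,
        (b ^ 2 / 4 - 2 * a) * partialDeriv m (fun q => q 0 / bcvLambda a q) p, 0;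
      (b ^ 2 / 4 - 2 * a) * partialDeriv m (fun q => q 0 / bcvLambda a q) p,
        -(2 * a) * partialDeriv m (fun q => q 1 / bcvLambda a q) p, 0;
      0, 0, 0],
    !![b / 2 * (2 * a - b ^ 2 / 2) * partialDeriv m (fun q => q 0 * q 1 / bcvLambda a q ^ 2) p,
        b / 2 * (b ^ 2 / 4 - a) * partialDeriv m (fun q => q 0 * q 0 / bcvLambda a q ^ 2) p
          + (-(b / 2 * (b ^ 2 / 4 - a)))
            * partialDeriv m (fun q => q 1 * q 1 / bcvLambda a q ^ 2) p,
        -(b ^ 2 / 4) * partialDeriv m (fun q => q 0 / bcvLambda a q) p;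
      b / 2 * (b ^ 2 / 4 - a) * partialDeriv m (fun q => q 0 * q 0 / bcvLambda a q ^ 2) p
          + (-(b / 2 * (b ^ 2 / 4 - a)))
            * partialDeriv m (fun q => q 1 * q 1 / bcvLambda a q ^ 2) p,
        -(b / 2 * (2 * a - b ^ 2 / 2))
          * partialDeriv m (fun q => q 0 * q 1 / bcvLambda a q ^ 2) p,
        -(b ^ 2 / 4) * partialDeriv m (fun q => q 1 / bcvLambda a q) p;
      -(b ^ 2 / 4) * partialDeriv m (fun q => q 0 / bcvLambda a q) p,
        -(b ^ 2 / 4) * partialDeriv m (fun q => q 1 / bcvLambda a q) p, 0]] := by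
  have h2 : bcvLambda a p ^ 2 ≠ 0 := pow_ne_zero 2 hp
  have hd := differentiableAt_bcvLambda a p
  have e1 : ∀ (c : ℝ) (j : Fin 3), DifferentiableAt ℝ
      (fun q => c * (q j * q j / bcvLambda a q ^ 2)) p := by
    intro c j; fun_prop (disch := assumption)
  ext k i j
  fin_cases k <;> fin_cases i <;> fin_cases j <;>
    simp [bcvChristoffel, partialDeriv_add _ (e1 _ _) (e1 _ _), partialDeriv_const_mul,
      partialDeriv_const, -neg_mul]

set_option maxHeartbeats 4000000 in
/-- The curvature coefficients of `h_{a,b}` through the orthonormal frame. -/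
theorem curvatureCoeff_bcvMetric (a b : ℝ) {p : Coord3} (hp : 0 < bcvLambda a p)
    (l i j k : Fin 3) :
    (bcvMetric a b).curvatureCoeff l i j k p
      = bcvCoframe a b p (-(bcvCurv a b (bcvFrame a b p (Pi.single i 1)
          ⨯₃ bcvFrame a b p (Pi.single j 1)) ⨯₃ bcvFrame a b p (Pi.single k 1))) l := by
  have hp' := hp.ne'
  have hpd : ∀ m k i j, partialDeriv m ((bcvMetric a b).christoffel k i j) p
      = partialDeriv m (fun q => bcvChristoffel a b q k i j) p := by
    intro m k i j
    -- The closed form of the Christoffel symbols is known only where `λ ≠ 0`, so differentiating it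
    -- requires equality on a whole neighbourhood.
    have hev : (bcvMetric a b).christoffel k i j
        =ᶠ[nhds p] fun q => bcvChristoffel a b q k i j := by
      filter_upwards [(isOpen_bcvDomain a).mem_nhds hp] with q hq
      exact christoffel_bcvMetric a b k i j (ne_of_gt hq)
    rw [partialDeriv, hev.fderiv_eq, partialDeriv]
  have hm : ∀ m k i j, partialDeriv m (fun q => bcvChristoffel a b q k i j) p = _ :=
    fun m k i j => congrFun (congrFun (congrFun (partialDeriv_bcvChristoffel a b m hp') k) i) j
  have hl : bcvLambda a p = 1 + a * (p 0 ^ 2 + p 1 ^ 2) := rfl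
  simp only [curvatureCoeff, hpd, hm, christoffel_bcvMetric a b _ _ _ hp',
    partialDeriv_div_lambda a _ _ hp', partialDeriv_mul_div_lambda_sq a _ _ _ hp',
    Fin.sum_univ_three]
  fin_cases l <;> fin_cases i <;> fin_cases j <;> fin_cases k <;>
    simp [bcvChristoffel, lambdaPartial, bcvCoframe, bcvCurv, bcvFrame, cross_apply] <;>
    field_simp <;> (try rw [hl]) <;> ring

/-- The curvature tensor of `N(a,b)` in the orthonormal frame. -/
theorem bcvFrame_curvature (a b : ℝ) {p : Coord3} (hp : 0 < bcvLambda a p) (X Y Z : Coord3) :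
    bcvFrame a b p ((bcvMetric a b).curvature p X Y Z)
      = -(bcvCurv a b (bcvFrame a b p X ⨯₃ bcvFrame a b p Y) ⨯₃ bcvFrame a b p Z) := by
  have hp' := hp.ne'
  suffices h : (bcvMetric a b).curvature p X Y Z = bcvCoframe a b p
      (-(bcvCurv a b (bcvFrame a b p X ⨯₃ bcvFrame a b p Y) ⨯₃ bcvFrame a b p Z)) by
    rw [h, bcvFrame_bcvCoframe hp']
  ext l
  simp only [curvature, curvatureCoeff_bcvMetric a b hp, Fin.sum_univ_three]
  fin_cases l <;>
    simp [bcvCoframe, bcvCurv, bcvFrame, cross_apply] <;> field_simp <;> ring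

end MetricField

/-! ### Surface patches of `N(a,b)` in the orthonormal frame -/

section VectorCalculus

variable {E : Type*} [NormedAddCommGroup E] [NormedSpace ℝ E]

theorem fderiv_pi_apply {f : E → Coord3} {u : E} (hf : DifferentiableAt ℝ f u) (v : E) (i : Fin 3) :
    fderiv ℝ f u v i = fderiv ℝ (fun x => f x i) u v := by
  rw [(hasFDerivAt_pi'.1 hf.hasFDerivAt i).fderiv]
  rfl

theorem fderiv_dotProduct {f g : E → Coord3} {u : E} (hf : DifferentiableAt ℝ f u)
    (hg : DifferentiableAt ℝ g u) (v : E) :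
    fderiv ℝ (fun x => f x ⬝ᵥ g x) u v = fderiv ℝ f u v ⬝ᵥ g u + f u ⬝ᵥ fderiv ℝ g u v := by
  have hf' := differentiableAt_pi.1 hf
  have hg' := differentiableAt_pi.1 hg
  simp only [dotProduct, Fin.sum_univ_three, fderiv_pi_apply hf, fderiv_pi_apply hg]
  have h := fun i => ((hf' i).hasFDerivAt.mul (hg' i).hasFDerivAt)
  have h' : HasFDerivAt (fun x => f x 0 * g x 0 + f x 1 * g x 1 + f x 2 * g x 2) _ u :=
    ((h 0).add (h 1)).add (h 2)
  rw [h'.fderiv]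
  simp
  ring

theorem differentiableAt_cross {f g : E → Coord3} {u : E} (hf : DifferentiableAt ℝ f u)
    (hg : DifferentiableAt ℝ g u) : DifferentiableAt ℝ (fun x => f x ⨯₃ g x) u := by
  have hf' := differentiableAt_pi.1 hf
  have hg' := differentiableAt_pi.1 hg
  rw [differentiableAt_pi]
  intro i
  fin_cases i <;> simp [cross_apply] <;> fun_prop

theorem fderiv_cross {f g : E → Coord3} {u : E} (hf : DifferentiableAt ℝ f u)
    (hg : DifferentiableAt ℝ g u) (v : E) :
    fderiv ℝ (fun x => f x ⨯₃ g x) u v = fderiv ℝ f u v ⨯₃ g u + f u ⨯₃ fderiv ℝ g u v := by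
  have hf' := differentiableAt_pi.1 hf
  have hg' := differentiableAt_pi.1 hg
  have h := fun i j => ((hf' i).hasFDerivAt.fun_mul (hg' j).hasFDerivAt)
  ext i
  rw [fderiv_pi_apply (differentiableAt_cross hf hg)]
  fin_cases i <;>
    simp [cross_apply, fderiv_pi_apply hf, fderiv_pi_apply hg,
      ((h 0 1).fun_sub (h 1 0)).fderiv, ((h 1 2).fun_sub (h 2 1)).fderiv,
      ((h 2 0).fun_sub (h 0 2)).fderiv] <;>
    ring

theorem ContDiffOn.cross {f g : E → Coord3} {s : Set E} (hf : ContDiffOn ℝ ∞ f s)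
    (hg : ContDiffOn ℝ ∞ g s) : ContDiffOn ℝ ∞ (fun x => f x ⨯₃ g x) s := by
  have hf' := contDiffOn_pi.1 hf
  have hg' := contDiffOn_pi.1 hg
  rw [contDiffOn_pi]
  intro i
  fin_cases i
  · simpa [cross_apply] using ((hf' 1).mul (hg' 2)).sub ((hf' 2).mul (hg' 1))
  · simpa [cross_apply] using ((hf' 2).mul (hg' 0)).sub ((hf' 0).mul (hg' 2))
  · simpa [cross_apply] using ((hf' 0).mul (hg' 1)).sub ((hf' 1).mul (hg' 0))

theorem ContDiffOn.dotProduct {f g : E → Coord3} {s : Set E} (hf : ContDiffOn ℝ ∞ f s)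
    (hg : ContDiffOn ℝ ∞ g s) : ContDiffOn ℝ ∞ (fun x => f x ⬝ᵥ g x) s := by
  have hf' := contDiffOn_pi.1 hf
  have hg' := contDiffOn_pi.1 hg
  simp only [_root_.dotProduct, Fin.sum_univ_three]
  exact (((hf' 0).mul (hg' 0)).add ((hf' 1).mul (hg' 1))).add ((hf' 2).mul (hg' 2))

theorem ContDiffOn.fderiv_apply_const {F : Type*} [NormedAddCommGroup F] [NormedSpace ℝ F]
    {f : E → F} {s : Set E} (hf : ContDiffOn ℝ ∞ f s)
    (hs : IsOpen s) (v : E) : ContDiffOn ℝ ∞ (fun x => fderiv ℝ f x v) s :=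
  (hf.fderiv_of_isOpen hs (m := ∞) (by simp)).clm_apply contDiffOn_const

theorem ContDiffOn.differentiableAt_of_isOpen {F : Type*} [NormedAddCommGroup F] [NormedSpace ℝ F]
    {f : E → F} {s : Set E} (hf : ContDiffOn ℝ ∞ f s)
    (hs : IsOpen s) {u : E} (hu : u ∈ s) : DifferentiableAt ℝ f u :=
  (hf.contDiffAt (hs.mem_nhds hu)).differentiableAt (by simp)

end VectorCalculus

theorem bcvFrame_add (a b : ℝ) (p u v : Coord3) :
    bcvFrame a b p (u + v) = bcvFrame a b p u + bcvFrame a b p v := by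
  ext i; fin_cases i <;> simp [bcvFrame] <;> ring

theorem bcvFrame_smul (a b : ℝ) (p : Coord3) (c : ℝ) (u : Coord3) :
    bcvFrame a b p (c • u) = c • bcvFrame a b p u := by
  ext i; fin_cases i <;> simp [bcvFrame] <;> ring

theorem bcvConn_add (a b : ℝ) (p u v : Coord3) :
    bcvConn a b p (u + v) = bcvConn a b p u + bcvConn a b p v := by
  ext i; fin_cases i <;> simp [bcvConn] <;> ring

theorem bcvConn_smul (a b : ℝ) (p : Coord3) (c : ℝ) (u : Coord3) :
    bcvConn a b p (c • u) = c • bcvConn a b p u := by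
  ext i; fin_cases i <;> simp [bcvConn] <;> ring

/-- `X` is a smooth immersion of the open set `O` of the plane into `N(a,b)`. -/
structure IsPatch (a : ℝ) (X : EuclideanSpace ℝ (Fin 2) → Coord3)
    (O : Set (EuclideanSpace ℝ (Fin 2))) : Prop where
  isOpen : IsOpen O
  contDiffOn : ContDiffOn ℝ ∞ X O
  mem : ∀ u ∈ O, X u ∈ bcvDomain a
  inj : ∀ u ∈ O, Function.Injective (fderiv ℝ X u)

namespace Patch

variable {a b : ℝ} {X : EuclideanSpace ℝ (Fin 2) → Coord3} {O : Set (EuclideanSpace ℝ (Fin 2))}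

/-- The image of the constant vector `v` under `dX`, in the orthonormal frame. -/
def tang (a b : ℝ) (X : EuclideanSpace ℝ (Fin 2) → Coord3) (v u : EuclideanSpace ℝ (Fin 2)) :
    Coord3 :=
  bcvFrame a b (X u) (fderiv ℝ X u v)

/-- The covariant derivative in direction `v` of a vector field along `X`. -/
def cov (a b : ℝ) (X : EuclideanSpace ℝ (Fin 2) → Coord3) (v : EuclideanSpace ℝ (Fin 2))
    (f : EuclideanSpace ℝ (Fin 2) → Coord3) (u : EuclideanSpace ℝ (Fin 2)) : Coord3 :=
  fderiv ℝ f u v + bcvConn a b (X u) (tang a b X v u) ⨯₃ f u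

theorem tang_add (v w u : EuclideanSpace ℝ (Fin 2)) :
    tang a b X (v + w) u = tang a b X v u + tang a b X w u := by
  simp [tang, bcvFrame_add]

theorem tang_smul (c : ℝ) (v u : EuclideanSpace ℝ (Fin 2)) :
    tang a b X (c • v) u = c • tang a b X v u := by
  simp [tang, bcvFrame_smul]

theorem cov_add_dir (v w : EuclideanSpace ℝ (Fin 2)) (f : EuclideanSpace ℝ (Fin 2) → Coord3)
    (u : EuclideanSpace ℝ (Fin 2)) :
    cov a b X (v + w) f u = cov a b X v f u + cov a b X w f u := by
  simp [cov, tang_add, bcvConn_add]; abel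

theorem cov_smul_dir (c : ℝ) (v : EuclideanSpace ℝ (Fin 2)) (f : EuclideanSpace ℝ (Fin 2) → Coord3)
    (u : EuclideanSpace ℝ (Fin 2)) :
    cov a b X (c • v) f u = c • cov a b X v f u := by
  simp [cov, tang_smul, bcvConn_smul]

theorem cov_add (v : EuclideanSpace ℝ (Fin 2)) {f g : EuclideanSpace ℝ (Fin 2) → Coord3}
    {u : EuclideanSpace ℝ (Fin 2)} (hf : DifferentiableAt ℝ f u) (hg : DifferentiableAt ℝ g u) :
    cov a b X v (fun x => f x + g x) u = cov a b X v f u + cov a b X v g u := by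
  simp [cov, fderiv_fun_add hf hg]; abel

theorem cov_smul (v : EuclideanSpace ℝ (Fin 2)) (c : ℝ) {f : EuclideanSpace ℝ (Fin 2) → Coord3}
    {u : EuclideanSpace ℝ (Fin 2)} (hf : DifferentiableAt ℝ f u) :
    cov a b X v (fun x => c • f x) u = c • cov a b X v f u := by
  simp [cov, fderiv_fun_const_smul hf]

/-- Metric compatibility: `Ω × ·` is skew-symmetric, so its two contributions cancel. -/
theorem fderiv_dot_eq_cov (v : EuclideanSpace ℝ (Fin 2)) {f g : EuclideanSpace ℝ (Fin 2) → Coord3}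
    {u : EuclideanSpace ℝ (Fin 2)} (hf : DifferentiableAt ℝ f u) (hg : DifferentiableAt ℝ g u) :
    fderiv ℝ (fun x => f x ⬝ᵥ g x) u v = cov a b X v f u ⬝ᵥ g u + f u ⬝ᵥ cov a b X v g u := by
  rw [fderiv_dotProduct hf hg]
  simp [cov, dotProduct, Fin.sum_univ_three, cross_apply]
  ring

theorem contDiffOn_tang (h : IsPatch a X O) (v : EuclideanSpace ℝ (Fin 2)) :
    ContDiffOn ℝ ∞ (tang a b X v) O := by
  have h1 := contDiffOn_pi.1 h.contDiffOn
  have h2 := contDiffOn_pi.1 (h.contDiffOn.fderiv_apply_const h.isOpen v)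
  have h3 : ContDiffOn ℝ ∞ (fun u => bcvLambda a (X u)) O := by
    unfold bcvLambda
    exact contDiffOn_const.add (contDiffOn_const.mul (((h1 0).pow 2).add ((h1 1).pow 2)))
  have h4 : ∀ u ∈ O, bcvLambda a (X u) ≠ 0 := fun u hu => ne_of_gt (h.mem u hu)
  rw [contDiffOn_pi]
  intro i
  fin_cases i
  · exact (h2 0).div h3 h4
  · exact (h2 1).div h3 h4
  · exact (h2 2).add (contDiffOn_const.mul
      ((((h1 1).mul (h2 0)).sub ((h1 0).mul (h2 1))).div h3 h4))

theorem contDiffOn_conn (h : IsPatch a X O) (v : EuclideanSpace ℝ (Fin 2)) :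
    ContDiffOn ℝ ∞ (fun u => bcvConn a b (X u) (tang a b X v u)) O := by
  have h1 := contDiffOn_pi.1 h.contDiffOn
  have h2 := contDiffOn_pi.1 (contDiffOn_tang (b := b) h v)
  rw [contDiffOn_pi]
  intro i
  fin_cases i
  · exact contDiffOn_const.mul (h2 0)
  · exact contDiffOn_const.mul (h2 1)
  · exact (contDiffOn_const.mul (((h1 1).mul (h2 0)).sub ((h1 0).mul (h2 1)))).sub
      (contDiffOn_const.mul (h2 2))

theorem contDiffOn_cov (h : IsPatch a X O) (v : EuclideanSpace ℝ (Fin 2))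
    {f : EuclideanSpace ℝ (Fin 2) → Coord3} (hf : ContDiffOn ℝ ∞ f O) :
    ContDiffOn ℝ ∞ (cov a b X v f) O :=
  (hf.fderiv_apply_const h.isOpen v).add ((contDiffOn_conn h v).cross hf)

theorem tang_eq_zero (h : IsPatch a X O) {u v : EuclideanSpace ℝ (Fin 2)} (hu : u ∈ O)
    (hv : tang a b X v u = 0) : v = 0 := by
  rw [tang, bcvFrame_eq_zero (ne_of_gt (h.mem u hu))] at hv
  exact h.inj u hu (by simpa using hv)

theorem fderiv_comm (h : IsPatch a X O) {u : EuclideanSpace ℝ (Fin 2)} (hu : u ∈ O)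
    {f : EuclideanSpace ℝ (Fin 2) → Coord3} (hf : ContDiffOn ℝ ∞ f O)
    (v w : EuclideanSpace ℝ (Fin 2)) :
    fderiv ℝ (fun x => fderiv ℝ f x w) u v = fderiv ℝ (fun x => fderiv ℝ f x v) u w := by
  have hf' := hf.contDiffAt (h.isOpen.mem_nhds hu)
  have hd : DifferentiableAt ℝ (fderiv ℝ f) u :=
    (hf.fderiv_of_isOpen h.isOpen (m := ∞) (by simp)).differentiableAt_of_isOpen h.isOpen hu
  have hs := hf'.isSymmSndFDerivAt
    (by rw [minSmoothness_of_isRCLikeNormedField]; exact WithTop.coe_le_coe.2 (le_top : (2 : ℕ∞) ≤ ⊤))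
  have e : ∀ w, fderiv ℝ (fun x => fderiv ℝ f x w) u = (fderiv ℝ (fderiv ℝ f) u).flip w := by
    intro w
    rw [fderiv_clm_apply hd (differentiableAt_const w)]
    ext z
    simp
  rw [e, e]
  exact hs.eq v w

/-- The derivative of `dX(w)` written in the orthonormal frame. -/
theorem fderiv_tang (h : IsPatch a X O) {u : EuclideanSpace ℝ (Fin 2)} (hu : u ∈ O)
    (v w : EuclideanSpace ℝ (Fin 2)) :
    fderiv ℝ (tang a b X w) u v
      = bcvFrame a b (X u) (fderiv ℝ (fun x => fderiv ℝ X x w) u v)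
        + ![-(fderiv ℝ X u w 0 * (2 * a * (X u 0 * fderiv ℝ X u v 0 + X u 1 * fderiv ℝ X u v 1))
            / bcvLambda a (X u) ^ 2),
          -(fderiv ℝ X u w 1 * (2 * a * (X u 0 * fderiv ℝ X u v 0 + X u 1 * fderiv ℝ X u v 1))
            / bcvLambda a (X u) ^ 2),
          b / 2 * ((fderiv ℝ X u v 1 * fderiv ℝ X u w 0 - fderiv ℝ X u v 0 * fderiv ℝ X u w 1)
            / bcvLambda a (X u)
            - (X u 1 * fderiv ℝ X u w 0 - X u 0 * fderiv ℝ X u w 1)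
              * (2 * a * (X u 0 * fderiv ℝ X u v 0 + X u 1 * fderiv ℝ X u v 1))
              / bcvLambda a (X u) ^ 2)] := by
  -- Restricting to the line `s ↦ u + s v` turns the claim into the formula for the derivative of
  -- frame components along a curve. Uniqueness of derivatives then identifies the two sides.
  have key : ∀ f : EuclideanSpace ℝ (Fin 2) → Coord3, DifferentiableAt ℝ f u →
      HasDerivAt (fun s : ℝ => f (u + s • v)) (fderiv ℝ f u v) 0 := by
    intro f hf
    have h1 : HasDerivAt (fun s : ℝ => u + s • v) v 0 := by
      simpa using ((hasDerivAt_id (0 : ℝ)).smul_const v).const_add u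
    have h2 : HasFDerivAt f (fderiv ℝ f u) (u + (0 : ℝ) • v) := by simpa using hf.hasFDerivAt
    exact h2.comp_hasDerivAt 0 h1
  have hX := key X (h.contDiffOn.differentiableAt_of_isOpen h.isOpen hu)
  have hw := key _ ((h.contDiffOn.fderiv_apply_const h.isOpen w).differentiableAt_of_isOpen
    h.isOpen hu)
  have ht := key _ ((contDiffOn_tang (b := b) h w).differentiableAt_of_isOpen h.isOpen hu)
  have h3 := MetricField.hasDerivAt_bcvFrame a b hX hw (by simpa using ne_of_gt (h.mem u hu))
  have := ht.unique h3
  simpa using this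

/-- The connection is torsion-free. -/
theorem cov_tang_comm (h : IsPatch a X O) {u : EuclideanSpace ℝ (Fin 2)} (hu : u ∈ O)
    (v w : EuclideanSpace ℝ (Fin 2)) :
    cov a b X v (tang a b X w) u = cov a b X w (tang a b X v) u := by
  have hl : bcvLambda a (X u) = 1 + a * (X u 0 ^ 2 + X u 1 ^ 2) := rfl
  have hp : bcvLambda a (X u) ≠ 0 := ne_of_gt (h.mem u hu)
  rw [cov, cov, fderiv_tang h hu, fderiv_tang h hu, fderiv_comm h hu h.contDiffOn v w]
  ext i
  fin_cases i <;> simp [tang, bcvFrame, bcvConn, cross_apply] <;> field_simp <;> (try rw [hl]) <;>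
    ring

/-- The form `Ω` depends on the base point only through `2a(y t₀ - x t₁)` in its third component;
differentiating `x` and `y` there produces the additional term. -/
theorem fderiv_conn (h : IsPatch a X O) {u : EuclideanSpace ℝ (Fin 2)} (hu : u ∈ O)
    (v w : EuclideanSpace ℝ (Fin 2)) :
    fderiv ℝ (fun x => bcvConn a b (X x) (tang a b X w x)) u v
      = bcvConn a b (X u) (fderiv ℝ (tang a b X w) u v)
        + ![0, 0, 2 * a * (fderiv ℝ X u v 1 * tang a b X w u 0
          - fderiv ℝ X u v 0 * tang a b X w u 1)] := by
  have dX := h.contDiffOn.differentiableAt_of_isOpen h.isOpen hu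
  have dT := (contDiffOn_tang (b := b) h w).differentiableAt_of_isOpen h.isOpen hu
  have dC := (contDiffOn_conn (b := b) h w).differentiableAt_of_isOpen h.isOpen hu
  have hX := fun i => (differentiableAt_pi.1 dX i).hasFDerivAt
  have hT := fun i => (differentiableAt_pi.1 dT i).hasFDerivAt
  ext i
  rw [fderiv_pi_apply dC]
  fin_cases i
  · simp [bcvConn, fderiv_pi_apply dT, ((hT 0).const_mul (b / 2)).fderiv]
  · simp [bcvConn, fderiv_pi_apply dT, ((hT 1).const_mul (b / 2)).fderiv]
  · simp [bcvConn, fderiv_pi_apply dT, fderiv_pi_apply dX,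
      (((((hX 1).fun_mul (hT 0)).fun_sub ((hX 0).fun_mul (hT 1))).const_mul (2 * a)).fun_sub
        ((hT 2).const_mul (b / 2))).fderiv]
    ring

/-- The curvature of the connection along a patch. -/
theorem cov_cov_comm (h : IsPatch a X O) {u : EuclideanSpace ℝ (Fin 2)} (hu : u ∈ O)
    {f : EuclideanSpace ℝ (Fin 2) → Coord3} (hf : ContDiffOn ℝ ∞ f O)
    (v w : EuclideanSpace ℝ (Fin 2)) :
    cov a b X v (cov a b X w f) u - cov a b X w (cov a b X v f) u
      = -(bcvCurv a b (tang a b X v u ⨯₃ tang a b X w u) ⨯₃ f u) := by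
  have hl : bcvLambda a (X u) = 1 + a * (X u 0 ^ 2 + X u 1 ^ 2) := rfl
  have hp : bcvLambda a (X u) ≠ 0 := ne_of_gt (h.mem u hu)
  have dC := fun w => (contDiffOn_conn (b := b) h w).differentiableAt_of_isOpen h.isOpen hu
  have df := hf.differentiableAt_of_isOpen h.isOpen hu
  have e : ∀ v w, fderiv ℝ (cov a b X w f) u v = fderiv ℝ (fun x => fderiv ℝ f x w) u v
      + (fderiv ℝ (fun x => bcvConn a b (X x) (tang a b X w x)) u v ⨯₃ f u
        + bcvConn a b (X u) (tang a b X w u) ⨯₃ fderiv ℝ f u v) := by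
    intro v w
    unfold cov
    rw [fderiv_fun_add ((hf.fderiv_apply_const h.isOpen w).differentiableAt_of_isOpen h.isOpen hu)
      (differentiableAt_cross (dC w) df), _root_.add_apply, fderiv_cross (dC w) df]
  have ht := cov_tang_comm (b := b) h hu v w
  -- Torsion-freeness eliminates one of the two mixed derivatives of the tangent fields, and
  -- symmetry of second derivatives removes those of `f`. What remains is a polynomial identity in
  -- the two tangent vectors, the base point and the values of `f` and of the remaining derivatives.
  have ht' : fderiv ℝ (tang a b X w) u v = fderiv ℝ (tang a b X v) u w
      + bcvConn a b (X u) (tang a b X w u) ⨯₃ tang a b X v u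
      - bcvConn a b (X u) (tang a b X v u) ⨯₃ tang a b X w u := by
    simp only [cov] at ht
    rw [← ht]; abel
  have hd : ∀ v, fderiv ℝ X u v 0 = bcvLambda a (X u) * tang a b X v u 0 ∧
      fderiv ℝ X u v 1 = bcvLambda a (X u) * tang a b X v u 1 := by
    intro v; constructor <;> simp [tang, bcvFrame] <;> field_simp
  have hc : ∀ v g, cov a b X v g u
      = fderiv ℝ g u v + bcvConn a b (X u) (tang a b X v u) ⨯₃ g u := fun _ _ => rfl
  rw [hc v (cov a b X w f), hc w (cov a b X v f), e, e, fderiv_conn h hu, fderiv_conn h hu, fderiv_comm h hu hf v w, ht']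
  simp only [cov, (hd v).1, (hd v).2, (hd w).1, (hd w).2, hl]
  generalize tang a b X v u = T
  generalize tang a b X w u = S
  ext i
  fin_cases i <;> simp [bcvConn, bcvCurv, cross_apply, vecHead, vecTail] <;> ring

end Patch

/-! ### Normal, shape operator, second fundamental form and Christoffel term of a patch. -/

namespace Patch

variable {a b : ℝ} {X : EuclideanSpace ℝ (Fin 2) → Coord3} {O : Set (EuclideanSpace ℝ (Fin 2))}

/-- The standard basis of the plane. -/
abbrev e (i : Fin 2) : EuclideanSpace ℝ (Fin 2) := EuclideanSpace.single i 1

theorem eq_smul_e (v : EuclideanSpace ℝ (Fin 2)) : v = v 0 • e 0 + v 1 • e 1 := by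
  ext i; fin_cases i <;> simp [e]

theorem tang_eq (v u : EuclideanSpace ℝ (Fin 2)) :
    tang a b X v u = v 0 • tang a b X (e 0) u + v 1 • tang a b X (e 1) u := by
  conv_lhs => rw [eq_smul_e v]
  rw [tang_add, tang_smul, tang_smul]

theorem cov_dir_eq (v : EuclideanSpace ℝ (Fin 2)) (f : EuclideanSpace ℝ (Fin 2) → Coord3)
    (u : EuclideanSpace ℝ (Fin 2)) :
    cov a b X v f u = v 0 • cov a b X (e 0) f u + v 1 • cov a b X (e 1) f u := by
  conv_lhs => rw [eq_smul_e v]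
  rw [cov_add_dir, cov_smul_dir, cov_smul_dir]

/-- A normal field, not normalized. -/
def rawNormal (a b : ℝ) (X : EuclideanSpace ℝ (Fin 2) → Coord3) (u : EuclideanSpace ℝ (Fin 2)) :
    Coord3 :=
  tang a b X (e 0) u ⨯₃ tang a b X (e 1) u

/-- The unit normal of a patch, in the orthonormal frame. -/
def normal (a b : ℝ) (X : EuclideanSpace ℝ (Fin 2) → Coord3) (u : EuclideanSpace ℝ (Fin 2)) :
    Coord3 :=
  (√(rawNormal a b X u ⬝ᵥ rawNormal a b X u))⁻¹ • rawNormal a b X u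

/-- The shape operator of a patch, in the orthonormal frame. -/
def shape (a b : ℝ) (X : EuclideanSpace ℝ (Fin 2) → Coord3) (v u : EuclideanSpace ℝ (Fin 2)) :
    Coord3 :=
  -cov a b X v (normal a b X) u

/-- The second fundamental form of a patch. -/
def sff (a b : ℝ) (X : EuclideanSpace ℝ (Fin 2) → Coord3) (v w u : EuclideanSpace ℝ (Fin 2)) : ℝ :=
  shape a b X v u ⬝ᵥ tang a b X w u

theorem rawNormal_sq_pos (h : IsPatch a X O) {u : EuclideanSpace ℝ (Fin 2)} (hu : u ∈ O) :
    0 < rawNormal a b X u ⬝ᵥ rawNormal a b X u := by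
  have h0 : rawNormal a b X u ≠ 0 := by
    rw [rawNormal, crossProduct_ne_zero_iff_linearIndependent, LinearIndependent.pair_iff]
    intro s t hst
    have : tang a b X (s • e 0 + t • e 1) u = 0 := by rw [tang_add, tang_smul, tang_smul, hst]
    have := tang_eq_zero h hu this
    have h0 := congrArg (fun v => v 0) this
    have h1 := congrArg (fun v => v 1) this
    constructor
    · simpa [e] using h0
    · simpa [e] using h1
  have h1 : 0 ≤ rawNormal a b X u ⬝ᵥ rawNormal a b X u :=
    Finset.sum_nonneg fun i _ => mul_self_nonneg _
  exact lt_of_le_of_ne h1 fun hh => h0 (dotProduct_self_eq_zero.1 hh.symm)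

theorem contDiffOn_normal (h : IsPatch a X O) : ContDiffOn ℝ ∞ (normal a b X) O := by
  have h0 : ContDiffOn ℝ ∞ (rawNormal a b X) O := (contDiffOn_tang h _).cross (contDiffOn_tang h _)
  have h1 := h0.dotProduct h0
  have h2 : ContDiffOn ℝ ∞ (fun u => √(rawNormal a b X u ⬝ᵥ rawNormal a b X u)) O :=
    h1.sqrt fun u hu => (rawNormal_sq_pos h hu).ne'
  exact (h2.inv fun u hu => (Real.sqrt_pos.2 (rawNormal_sq_pos h hu)).ne').smul h0

theorem normal_dot_self (h : IsPatch a X O) {u : EuclideanSpace ℝ (Fin 2)} (hu : u ∈ O) :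
    normal a b X u ⬝ᵥ normal a b X u = 1 := by
  have h0 := rawNormal_sq_pos (b := b) h hu
  have h1 := Real.sq_sqrt h0.le
  have h2 := Real.sqrt_pos.2 h0
  simp only [normal, smul_dotProduct, dotProduct_smul, smul_eq_mul]
  field_simp
  linarith

theorem normal_dot_tang (v u : EuclideanSpace ℝ (Fin 2)) :
    normal a b X u ⬝ᵥ tang a b X v u = 0 := by
  rw [tang_eq, normal, rawNormal]
  simp [dotProduct, Fin.sum_univ_three, cross_apply]
  ring

theorem differentiableAt_normal (h : IsPatch a X O) {u : EuclideanSpace ℝ (Fin 2)} (hu : u ∈ O) :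
    DifferentiableAt ℝ (normal a b X) u :=
  (contDiffOn_normal h).differentiableAt_of_isOpen h.isOpen hu

theorem differentiableAt_tang (h : IsPatch a X O) {u : EuclideanSpace ℝ (Fin 2)} (hu : u ∈ O)
    (v : EuclideanSpace ℝ (Fin 2)) : DifferentiableAt ℝ (tang a b X v) u :=
  (contDiffOn_tang h v).differentiableAt_of_isOpen h.isOpen hu

theorem contDiffOn_shape (h : IsPatch a X O) (v : EuclideanSpace ℝ (Fin 2)) :
    ContDiffOn ℝ ∞ (shape a b X v) O :=
  (contDiffOn_cov h v (contDiffOn_normal h)).neg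

theorem differentiableAt_shape (h : IsPatch a X O) {u : EuclideanSpace ℝ (Fin 2)} (hu : u ∈ O)
    (v : EuclideanSpace ℝ (Fin 2)) : DifferentiableAt ℝ (shape a b X v) u :=
  (contDiffOn_shape h v).differentiableAt_of_isOpen h.isOpen hu

theorem shape_eq (v u : EuclideanSpace ℝ (Fin 2)) :
    shape a b X v u = v 0 • shape a b X (e 0) u + v 1 • shape a b X (e 1) u := by
  simp only [shape]
  rw [cov_dir_eq]
  simp [smul_neg, add_comm]

/-- Functions that are equal on a neighbourhood have the same covariant derivative. -/
theorem fderiv_eq_zero_of_const (h : IsPatch a X O) {u : EuclideanSpace ℝ (Fin 2)} (hu : u ∈ O)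
    {f : EuclideanSpace ℝ (Fin 2) → ℝ} {c : ℝ} (hf : ∀ x ∈ O, f x = c) : fderiv ℝ f u = 0 := by
  have : f =ᶠ[nhds u] fun _ => c := by
    filter_upwards [h.isOpen.mem_nhds hu] with x hx using hf x hx
  rw [this.fderiv_eq]
  simp

/-- Differentiate `⟨N, N⟩ = 1`. -/
theorem shape_dot_normal (h : IsPatch a X O) {u : EuclideanSpace ℝ (Fin 2)} (hu : u ∈ O)
    (v : EuclideanSpace ℝ (Fin 2)) : shape a b X v u ⬝ᵥ normal a b X u = 0 := by
  have hN := differentiableAt_normal (b := b) h hu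
  have h1 := fderiv_dot_eq_cov (a := a) (b := b) (X := X) v hN hN
  rw [fderiv_eq_zero_of_const h hu (fun x hx => normal_dot_self h hx)] at h1
  rw [dotProduct_comm (normal a b X u)] at h1
  simp only [shape, neg_dotProduct]
  simp at h1
  linarith

/-- Differentiate `⟨N, dX(w)⟩ = 0`. In this form the symmetry of `II` is just torsion-freeness. -/
theorem sff_eq (h : IsPatch a X O) {u : EuclideanSpace ℝ (Fin 2)} (hu : u ∈ O)
    (v w : EuclideanSpace ℝ (Fin 2)) :
    sff a b X v w u = cov a b X v (tang a b X w) u ⬝ᵥ normal a b X u := by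
  have h1 := fderiv_dot_eq_cov (a := a) (b := b) (X := X) v (differentiableAt_normal (b := b) h hu)
    (differentiableAt_tang (b := b) h hu w)
  rw [fderiv_eq_zero_of_const h hu (fun x _ => normal_dot_tang w x)] at h1
  rw [dotProduct_comm (normal a b X u)] at h1
  simp only [sff, shape, neg_dotProduct]
  simp at h1
  linarith

theorem sff_comm (h : IsPatch a X O) {u : EuclideanSpace ℝ (Fin 2)} (hu : u ∈ O)
    (v w : EuclideanSpace ℝ (Fin 2)) : sff a b X v w u = sff a b X w v u := by
  rw [sff_eq h hu, sff_eq h hu, cov_tang_comm h hu]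

/-- The vector of the plane whose image is the tangential part of `H`. -/
def proj (a b : ℝ) (X : EuclideanSpace ℝ (Fin 2) → Coord3) (H : Coord3)
    (u : EuclideanSpace ℝ (Fin 2)) : EuclideanSpace ℝ (Fin 2) :=
  (((tang a b X (e 1) u ⬝ᵥ tang a b X (e 1) u) * (H ⬝ᵥ tang a b X (e 0) u)
    - (tang a b X (e 0) u ⬝ᵥ tang a b X (e 1) u) * (H ⬝ᵥ tang a b X (e 1) u))
    / (rawNormal a b X u ⬝ᵥ rawNormal a b X u)) • e 0
  + (((tang a b X (e 0) u ⬝ᵥ tang a b X (e 0) u) * (H ⬝ᵥ tang a b X (e 1) u)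
    - (tang a b X (e 0) u ⬝ᵥ tang a b X (e 1) u) * (H ⬝ᵥ tang a b X (e 0) u))
    / (rawNormal a b X u ⬝ᵥ rawNormal a b X u)) • e 1

theorem proj_add (H K : Coord3) (u : EuclideanSpace ℝ (Fin 2)) :
    proj a b X (H + K) u = proj a b X H u + proj a b X K u := by
  simp only [proj, add_dotProduct]
  module

theorem proj_smul (c : ℝ) (H : Coord3) (u : EuclideanSpace ℝ (Fin 2)) :
    proj a b X (c • H) u = c • proj a b X H u := by
  simp only [proj, smul_dotProduct, smul_eq_mul]
  module

/-- The coefficients in `proj` are Cramer's rule for the Gram matrix of `dX(e₀)`, `dX(e₁)`, whose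
determinant is the squared length of their cross product. -/
theorem tang_proj (h : IsPatch a X O) {u : EuclideanSpace ℝ (Fin 2)} (hu : u ∈ O) (H : Coord3) :
    H = tang a b X (proj a b X H u) u + (H ⬝ᵥ normal a b X u) • normal a b X u := by
  have h0 := rawNormal_sq_pos (b := b) h hu
  have h1 := Real.sq_sqrt h0.le
  have h2 := Real.sqrt_pos.2 h0
  have hn : (H ⬝ᵥ normal a b X u) • normal a b X u
      = ((H ⬝ᵥ rawNormal a b X u)
        / (rawNormal a b X u ⬝ᵥ rawNormal a b X u)) • rawNormal a b X u := by
    rw [normal, dotProduct_smul, smul_smul, smul_eq_mul]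
    congr 1
    field_simp
    rw [h1]
    ring
  rw [hn, proj, tang_add, tang_smul, tang_smul]
  have h3 := h0.ne'
  simp only [rawNormal] at h3 ⊢
  generalize tang a b X (e 0) u = T at *
  generalize tang a b X (e 1) u = S at *
  obtain ⟨D, hD⟩ : ∃ D, D = (T ⨯₃ S) ⬝ᵥ (T ⨯₃ S) := ⟨_, rfl⟩
  rw [← hD] at h3 ⊢
  simp only [cross_apply, dotProduct, Fin.sum_univ_three] at hD ⊢
  ext i
  fin_cases i <;> simp at hD ⊢ <;> field_simp <;> rw [hD] <;> ring

/-- The Christoffel term `Γ(v, w)` of a patch. -/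
def gam (a b : ℝ) (X : EuclideanSpace ℝ (Fin 2) → Coord3) (v w u : EuclideanSpace ℝ (Fin 2)) :
    EuclideanSpace ℝ (Fin 2) :=
  proj a b X (cov a b X v (tang a b X w) u) u

/-- The Gauss formula. -/
theorem cov_tang (h : IsPatch a X O) {u : EuclideanSpace ℝ (Fin 2)} (hu : u ∈ O)
    (v w : EuclideanSpace ℝ (Fin 2)) :
    cov a b X v (tang a b X w) u
      = tang a b X (gam a b X v w u) u + sff a b X v w u • normal a b X u := by
  rw [sff_eq h hu]
  exact tang_proj h hu _

theorem cov_tang_eq (h : IsPatch a X O) {u : EuclideanSpace ℝ (Fin 2)} (hu : u ∈ O)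
    (v w : EuclideanSpace ℝ (Fin 2)) :
    cov a b X v (tang a b X w) u
      = w 0 • cov a b X v (tang a b X (e 0)) u + w 1 • cov a b X v (tang a b X (e 1)) u := by
  have h0 := differentiableAt_tang (b := b) h hu (e 0)
  have h1 := differentiableAt_tang (b := b) h hu (e 1)
  have : tang a b X w = fun x => w 0 • tang a b X (e 0) x + w 1 • tang a b X (e 1) x := by
    ext1 x; exact tang_eq w x
  have h0' : DifferentiableAt ℝ (fun x => w 0 • tang a b X (e 0) x) u := h0.fun_const_smul _
  have h1' : DifferentiableAt ℝ (fun x => w 1 • tang a b X (e 1) x) u := h1.fun_const_smul _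
  rw [this, cov_add v h0' h1', cov_smul v _ h0, cov_smul v _ h1]

/-- Expanding in the fixed basis exhibits `Γ(v, v)` at `u` as a smooth function of the pair `(u,
v)`, which is what the existence theorem for the geodesic equation needs. -/
theorem gam_eq (h : IsPatch a X O) {u : EuclideanSpace ℝ (Fin 2)} (hu : u ∈ O)
    (v w : EuclideanSpace ℝ (Fin 2)) :
    gam a b X v w u = (v 0 * w 0) • gam a b X (e 0) (e 0) u + (v 0 * w 1) • gam a b X (e 0) (e 1) u
      + (v 1 * w 0) • gam a b X (e 1) (e 0) u + (v 1 * w 1) • gam a b X (e 1) (e 1) u := by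
  unfold gam
  rw [cov_tang_eq h hu v w, cov_dir_eq v, cov_dir_eq v (tang a b X (e 1))]
  simp only [proj_add, proj_smul]
  module

theorem contDiffOn_gam (h : IsPatch a X O) (v w : EuclideanSpace ℝ (Fin 2)) :
    ContDiffOn ℝ ∞ (gam a b X v w) O := by
  have h0 := contDiffOn_tang (b := b) h (e 0)
  have h1 := contDiffOn_tang (b := b) h (e 1)
  have h2 := contDiffOn_cov (b := b) h v (contDiffOn_tang (b := b) h w)
  have hn : ContDiffOn ℝ ∞ (rawNormal a b X) O := h0.cross h1
  have hn2 := hn.dotProduct hn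
  have hn0 : ∀ u ∈ O, rawNormal a b X u ⬝ᵥ rawNormal a b X u ≠ 0 :=
    fun u hu => (rawNormal_sq_pos h hu).ne'
  exact (((((h1.dotProduct h1).mul (h2.dotProduct h0)).sub
    ((h0.dotProduct h1).mul (h2.dotProduct h1))).div hn2 hn0).smul contDiffOn_const).add
    (((((h0.dotProduct h0).mul (h2.dotProduct h1)).sub
    ((h0.dotProduct h1).mul (h2.dotProduct h0))).div hn2 hn0).smul contDiffOn_const)

end Patch

/-! ### Curves in the orthonormal frame -/

namespace MetricField

theorem frameDeriv_congr {a b : ℝ} {γ τ V W : ℝ → Coord3} {t : ℝ} (h : V =ᶠ[nhds t] W) :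
    frameDeriv a b γ τ V t = frameDeriv a b γ τ W t := by
  rw [frameDeriv, frameDeriv, h.deriv_eq, h.eq_of_nhds]

theorem frameDeriv_add {a b : ℝ} {γ τ V W : ℝ → Coord3} {t : ℝ} (hV : DifferentiableAt ℝ V t)
    (hW : DifferentiableAt ℝ W t) :
    frameDeriv a b γ τ (fun s => V s + W s) t
      = frameDeriv a b γ τ V t + frameDeriv a b γ τ W t := by
  simp only [frameDeriv, deriv_fun_add hV hW, map_add]
  abel

theorem frameDeriv_smul {a b : ℝ} {γ τ V : ℝ → Coord3} {k : ℝ → ℝ} {t : ℝ}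
    (hk : DifferentiableAt ℝ k t) (hV : DifferentiableAt ℝ V t) :
    frameDeriv a b γ τ (fun s => k s • V s) t
      = deriv k t • V t + k t • frameDeriv a b γ τ V t := by
  simp only [frameDeriv, deriv_fun_smul hk hV, map_smul, smul_add]
  abel

theorem deriv_dot_eq_frameDeriv {a b : ℝ} (γ τ : ℝ → Coord3) {V W : ℝ → Coord3} {t : ℝ}
    (hV : DifferentiableAt ℝ V t) (hW : DifferentiableAt ℝ W t) :
    deriv (fun s => V s ⬝ᵥ W s) t
      = frameDeriv a b γ τ V t ⬝ᵥ W t + V t ⬝ᵥ frameDeriv a b γ τ W t := by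
  have h := fderiv_dotProduct hV hW (1 : ℝ)
  simp only [fderiv_apply_one_eq_deriv] at h
  rw [h]
  simp [frameDeriv, dotProduct, Fin.sum_univ_three, cross_apply]
  ring

theorem contDiffOn_bcvFrame {E : Type*} [NormedAddCommGroup E] [NormedSpace ℝ E] {a b : ℝ}
    {s : Set E} {f V : E → Coord3} (hf : ContDiffOn ℝ ∞ f s) (hV : ContDiffOn ℝ ∞ V s)
    (hm : ∀ x ∈ s, f x ∈ bcvDomain a) : ContDiffOn ℝ ∞ (fun x => bcvFrame a b (f x) (V x)) s := by
  have h1 := contDiffOn_pi.1 hf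
  have h2 := contDiffOn_pi.1 hV
  have h3 : ContDiffOn ℝ ∞ (fun u => bcvLambda a (f u)) s := by
    unfold bcvLambda
    exact contDiffOn_const.add (contDiffOn_const.mul (((h1 0).pow 2).add ((h1 1).pow 2)))
  have h4 : ∀ u ∈ s, bcvLambda a (f u) ≠ 0 := fun u hu => ne_of_gt (hm u hu)
  rw [contDiffOn_pi]
  intro i
  fin_cases i
  · exact (h2 0).div h3 h4
  · exact (h2 1).div h3 h4
  · exact (h2 2).add (contDiffOn_const.mul
      ((((h1 1).mul (h2 0)).sub ((h1 0).mul (h2 1))).div h3 h4))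

theorem contDiffOn_bcvCoframe {E : Type*} [NormedAddCommGroup E] [NormedSpace ℝ E] {a b : ℝ}
    {s : Set E} {f V : E → Coord3} (hf : ContDiffOn ℝ ∞ f s) (hV : ContDiffOn ℝ ∞ V s) :
    ContDiffOn ℝ ∞ (fun x => bcvCoframe a b (f x) (V x)) s := by
  have h1 := contDiffOn_pi.1 hf
  have h2 := contDiffOn_pi.1 hV
  have h3 : ContDiffOn ℝ ∞ (fun u => bcvLambda a (f u)) s := by
    unfold bcvLambda
    exact contDiffOn_const.add (contDiffOn_const.mul (((h1 0).pow 2).add ((h1 1).pow 2)))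
  rw [contDiffOn_pi]
  intro i
  fin_cases i
  · exact h3.mul (h2 0)
  · exact h3.mul (h2 1)
  · exact (h2 2).sub (contDiffOn_const.mul (((h1 1).mul (h2 0)).sub ((h1 0).mul (h2 1))))

theorem contDiffOn_bcvConn {E : Type*} [NormedAddCommGroup E] [NormedSpace ℝ E] {a b : ℝ}
    {s : Set E} {f V : E → Coord3} (hf : ContDiffOn ℝ ∞ f s) (hV : ContDiffOn ℝ ∞ V s) :
    ContDiffOn ℝ ∞ (fun x => bcvConn a b (f x) (V x)) s := by
  have h1 := contDiffOn_pi.1 hf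
  have h2 := contDiffOn_pi.1 hV
  rw [contDiffOn_pi]
  intro i
  fin_cases i
  · exact contDiffOn_const.mul (h2 0)
  · exact contDiffOn_const.mul (h2 1)
  · exact (contDiffOn_const.mul (((h1 1).mul (h2 0)).sub ((h1 0).mul (h2 1)))).sub
      (contDiffOn_const.mul (h2 2))

theorem contDiffOn_deriv {F : Type*} [NormedAddCommGroup F] [NormedSpace ℝ F] {f : ℝ → F}
    {I : Set ℝ} (hI : IsOpen I) (hf : ContDiffOn ℝ ∞ f I) : ContDiffOn ℝ ∞ (deriv f) I :=
  hf.fderiv_apply_const hI 1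

theorem contDiffOn_frameDeriv {a b : ℝ} {γ τ V : ℝ → Coord3} {I : Set ℝ} (hI : IsOpen I)
    (hγ : ContDiffOn ℝ ∞ γ I) (hτ : ContDiffOn ℝ ∞ τ I) (hV : ContDiffOn ℝ ∞ V I) :
    ContDiffOn ℝ ∞ (frameDeriv a b γ τ V) I :=
  (contDiffOn_deriv hI hV).add ((contDiffOn_bcvConn hγ hτ).cross hV)

/-- The velocity of a curve in the orthonormal frame. -/
def frameVel (a b : ℝ) (γ : ℝ → Coord3) (t : ℝ) : Coord3 := bcvFrame a b (γ t) (deriv γ t)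

theorem contDiffOn_frameVel {a b : ℝ} {γ : ℝ → Coord3} {I : Set ℝ} (hI : IsOpen I)
    (hγ : ContDiffOn ℝ ∞ γ I) (hm : ∀ t ∈ I, γ t ∈ bcvDomain a) :
    ContDiffOn ℝ ∞ (frameVel a b γ) I :=
  contDiffOn_bcvFrame hγ (contDiffOn_deriv hI hγ) hm

theorem bcvFrame_covDeriv_of_contDiffOn {a b : ℝ} {γ V : ℝ → Coord3} {I : Set ℝ} (hI : IsOpen I)
    (hγ : ContDiffOn ℝ ∞ γ I) (hm : ∀ t ∈ I, γ t ∈ bcvDomain a) (hV : ContDiffOn ℝ ∞ V I) {t : ℝ}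
    (ht : t ∈ I) :
    bcvFrame a b (γ t) ((bcvMetric a b).covDeriv γ V t)
      = frameDeriv a b γ (frameVel a b γ) (fun s => bcvFrame a b (γ s) (V s)) t :=
  bcvFrame_covDeriv a b (hγ.differentiableAt_of_isOpen hI ht) (hV.differentiableAt_of_isOpen hI ht)
    (ne_of_gt (hm t ht))

theorem contDiffOn_covDeriv {a b : ℝ} {γ V : ℝ → Coord3} {I : Set ℝ} (hI : IsOpen I)
    (hγ : ContDiffOn ℝ ∞ γ I) (hm : ∀ t ∈ I, γ t ∈ bcvDomain a) (hV : ContDiffOn ℝ ∞ V I) :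
    ContDiffOn ℝ ∞ ((bcvMetric a b).covDeriv γ V) I := by
  have h := contDiffOn_bcvCoframe (a := a) (b := b) hγ
    (contDiffOn_frameDeriv (a := a) (b := b) hI hγ (contDiffOn_frameVel (b := b) hI hγ hm)
      (contDiffOn_bcvFrame (b := b) hγ hV hm))
  refine h.congr fun t ht => ?_
  rw [← bcvFrame_covDeriv_of_contDiffOn hI hγ hm hV ht, bcvCoframe_bcvFrame (ne_of_gt (hm t ht))]

theorem bcvFrame_acceleration {a b : ℝ} {γ : ℝ → Coord3} {I : Set ℝ} (hI : IsOpen I)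
    (hγ : ContDiffOn ℝ ∞ γ I) (hm : ∀ t ∈ I, γ t ∈ bcvDomain a) {t : ℝ} (ht : t ∈ I) :
    bcvFrame a b (γ t) ((bcvMetric a b).acceleration γ t)
      = frameDeriv a b γ (frameVel a b γ) (frameVel a b γ) t :=
  bcvFrame_covDeriv_of_contDiffOn hI hγ hm (contDiffOn_deriv hI hγ) ht

/-- The bitension field in the orthonormal frame. -/
theorem bcvFrame_bitension {a b : ℝ} {γ A : ℝ → Coord3} {I : Set ℝ} (hI : IsOpen I)
    (hγ : ContDiffOn ℝ ∞ γ I) (hm : ∀ t ∈ I, γ t ∈ bcvDomain a)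
    (hA : ∀ t ∈ I, frameDeriv a b γ (frameVel a b γ) (frameVel a b γ) t = A t) {t : ℝ}
    (ht : t ∈ I) :
    bcvFrame a b (γ t) ((bcvMetric a b).bitension γ t)
      = frameDeriv a b γ (frameVel a b γ) (frameDeriv a b γ (frameVel a b γ) A) t
        - bcvCurv a b (A t ⨯₃ frameVel a b γ t) ⨯₃ frameVel a b γ t := by
  have h1 : ContDiffOn ℝ ∞ ((bcvMetric a b).acceleration γ) I :=
    contDiffOn_covDeriv (b := b) hI hγ hm (contDiffOn_deriv hI hγ)
  have h2 := contDiffOn_covDeriv (b := b) hI hγ hm h1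
  have hA1 : ∀ s ∈ I, bcvFrame a b (γ s) ((bcvMetric a b).acceleration γ s) = A s := fun s hs => by
    rw [bcvFrame_acceleration hI hγ hm hs, hA s hs]
  have hA2 : ∀ s ∈ I, bcvFrame a b (γ s) ((bcvMetric a b).covDeriv γ
      ((bcvMetric a b).acceleration γ) s) = frameDeriv a b γ (frameVel a b γ) A s := fun s hs => by
    rw [bcvFrame_covDeriv_of_contDiffOn hI hγ hm h1 hs]
    apply frameDeriv_congr
    filter_upwards [hI.mem_nhds hs] with r hr using hA1 r hr
  rw [bitension, bcvFrame_add, bcvFrame_curvature a b (hm t ht), hA1 t ht,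
    bcvFrame_covDeriv_of_contDiffOn hI hγ hm h2 ht, ← sub_eq_add_neg]
  congr 1
  apply frameDeriv_congr
  filter_upwards [hI.mem_nhds ht] with r hr using hA2 r hr

end MetricField

/-! ### Curves and geodesics on a patch. -/

namespace Patch

open MetricField

variable {a b : ℝ} {X : EuclideanSpace ℝ (Fin 2) → Coord3} {O : Set (EuclideanSpace ℝ (Fin 2))}

theorem tang_zero (u : EuclideanSpace ℝ (Fin 2)) : tang a b X 0 u = 0 := by
  simpa using tang_smul (a := a) (b := b) (X := X) 0 0 u

theorem frameVel_comp (h : IsPatch a X O) {c : ℝ → EuclideanSpace ℝ (Fin 2)} {t : ℝ}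
    (hc : DifferentiableAt ℝ c t) (ht : c t ∈ O) :
    frameVel a b (X ∘ c) t = tang a b X (deriv c t) (c t) := by
  have hX := (h.contDiffOn.differentiableAt_of_isOpen h.isOpen ht).hasFDerivAt
  rw [frameVel, (hX.comp_hasDerivAt t hc.hasDerivAt).deriv]
  rfl

theorem frameDeriv_comp (h : IsPatch a X O) {c : ℝ → EuclideanSpace ℝ (Fin 2)} {t : ℝ}
    (hc : DifferentiableAt ℝ c t) (ht : c t ∈ O) {f : EuclideanSpace ℝ (Fin 2) → Coord3}
    (hf : DifferentiableAt ℝ f (c t)) :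
    frameDeriv a b (X ∘ c) (frameVel a b (X ∘ c)) (fun s => f (c s)) t
      = cov a b X (deriv c t) f (c t) := by
  have hfc : HasDerivAt (fun s => f (c s)) (fderiv ℝ f (c t) (deriv c t)) t :=
    hf.hasFDerivAt.comp_hasDerivAt t hc.hasDerivAt
  rw [frameDeriv, frameVel_comp h hc ht, hfc.deriv]
  rfl

/-- The derivative along a curve of `F(c')`, for a tensor field `F`. -/
theorem frameDeriv_comp_linear (h : IsPatch a X O) {c : ℝ → EuclideanSpace ℝ (Fin 2)} {t : ℝ}
    (hc : DifferentiableAt ℝ c t) (hc' : DifferentiableAt ℝ (deriv c) t) (ht : c t ∈ O)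
    {F : EuclideanSpace ℝ (Fin 2) → EuclideanSpace ℝ (Fin 2) → Coord3}
    (hF : ∀ v u, F v u = v 0 • F (e 0) u + v 1 • F (e 1) u)
    (hd : ∀ v, DifferentiableAt ℝ (F v) (c t)) :
    frameDeriv a b (X ∘ c) (frameVel a b (X ∘ c)) (fun s => F (deriv c s) (c s)) t
      = F (deriv (deriv c) t) (c t) + cov a b X (deriv c t) (F (deriv c t)) (c t) := by
  have hk : ∀ i, HasDerivAt (fun s => deriv c s i) (deriv (deriv c) t i) t := fun i =>
    (EuclideanSpace.proj (𝕜 := ℝ) i).hasFDerivAt.comp_hasDerivAt t hc'.hasDerivAt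
  have hFc : ∀ v, DifferentiableAt ℝ (fun s => F v (c s)) t := fun v =>
    ((hd v).hasFDerivAt.comp_hasDerivAt t hc.hasDerivAt).differentiableAt
  have e1 : (fun s => F (deriv c s) (c s))
      = fun s => deriv c s 0 • F (e 0) (c s) + deriv c s 1 • F (e 1) (c s) := by
    ext1 s; exact hF _ _
  have h0 : DifferentiableAt ℝ (fun x => deriv c t 0 • F (e 0) x) (c t) := (hd _).fun_const_smul _
  have h1 : DifferentiableAt ℝ (fun x => deriv c t 1 • F (e 1) x) (c t) := (hd _).fun_const_smul _
  have e2 : F (deriv c t) = fun x => deriv c t 0 • F (e 0) x + deriv c t 1 • F (e 1) x := by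
    ext1 x; exact hF _ _
  rw [e1, frameDeriv_add ((hk 0).differentiableAt.fun_smul (hFc _))
    ((hk 1).differentiableAt.fun_smul (hFc _)), frameDeriv_smul (hk 0).differentiableAt (hFc _),
    frameDeriv_smul (hk 1).differentiableAt (hFc _), frameDeriv_comp h hc ht (hd _),
    frameDeriv_comp h hc ht (hd _), e2, cov_add _ h0 h1, cov_smul _ _ (hd _), cov_smul _ _ (hd _),
    hF (deriv (deriv c) t), (hk 0).deriv, (hk 1).deriv]
  abel

/-- The acceleration of a curve on a patch. -/
theorem frameDeriv_frameVel (h : IsPatch a X O) {c : ℝ → EuclideanSpace ℝ (Fin 2)} {I : Set ℝ}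
    (hI : IsOpen I) (hc : ContDiffOn ℝ ∞ c I) (hm : ∀ t ∈ I, c t ∈ O) {t : ℝ} (ht : t ∈ I) :
    frameDeriv a b (X ∘ c) (frameVel a b (X ∘ c)) (frameVel a b (X ∘ c)) t
      = tang a b X (deriv (deriv c) t + gam a b X (deriv c t) (deriv c t) (c t)) (c t)
        + sff a b X (deriv c t) (deriv c t) (c t) • normal a b X (c t) := by
  have hd : ∀ s ∈ I, DifferentiableAt ℝ c s := fun s hs => hc.differentiableAt_of_isOpen hI hs
  have e1 : frameVel a b (X ∘ c) =ᶠ[nhds t] fun s => tang a b X (deriv c s) (c s) := by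
    filter_upwards [hI.mem_nhds ht] with s hs using frameVel_comp h (hd s hs) (hm s hs)
  rw [frameDeriv_congr e1, frameDeriv_comp_linear h (hd t ht)
    ((contDiffOn_deriv hI hc).differentiableAt_of_isOpen hI ht) (hm t ht) tang_eq
    (differentiableAt_tang h (hm t ht)), cov_tang h (hm t ht), tang_add, add_assoc]

/-- Unit speed geodesics of a patch. -/
structure IsGeodesic (a b : ℝ) (X : EuclideanSpace ℝ (Fin 2) → Coord3)
    (O : Set (EuclideanSpace ℝ (Fin 2))) (I : Set ℝ) (c : ℝ → EuclideanSpace ℝ (Fin 2)) :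
    Prop where
  isOpen : IsOpen I
  contDiffOn : ContDiffOn ℝ ∞ c I
  mem : ∀ t ∈ I, c t ∈ O
  unit : ∀ t ∈ I, tang a b X (deriv c t) (c t) ⬝ᵥ tang a b X (deriv c t) (c t) = 1
  eqn : ∀ t ∈ I, deriv (deriv c) t = -gam a b X (deriv c t) (deriv c t) (c t)

theorem IsGeodesic.acceleration (h : IsPatch a X O) {c : ℝ → EuclideanSpace ℝ (Fin 2)}
    {I : Set ℝ} (hc : IsGeodesic a b X O I c) {t : ℝ} (ht : t ∈ I) :
    frameDeriv a b (X ∘ c) (frameVel a b (X ∘ c)) (frameVel a b (X ∘ c)) t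
      = sff a b X (deriv c t) (deriv c t) (c t) • normal a b X (c t) := by
  rw [frameDeriv_frameVel h hc.isOpen hc.contDiffOn hc.mem ht, hc.eqn t ht]
  simp [tang_zero]

end Patch

/-! ### The bitension of geodesics and the existence of geodesics. -/

namespace Patch

open MetricField

variable {a b : ℝ} {X : EuclideanSpace ℝ (Fin 2) → Coord3} {O : Set (EuclideanSpace ℝ (Fin 2))}

theorem IsPatch.contDiffOn_comp (h : IsPatch a X O) {c : ℝ → EuclideanSpace ℝ (Fin 2)}
    {I : Set ℝ} (hc : ContDiffOn ℝ ∞ c I) (hm : ∀ t ∈ I, c t ∈ O) :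
    ContDiffOn ℝ ∞ (X ∘ c) I :=
  h.contDiffOn.comp hc hm

theorem contDiffOn_comp_linear {c : ℝ → EuclideanSpace ℝ (Fin 2)} {I : Set ℝ} (hI : IsOpen I)
    (hc : ContDiffOn ℝ ∞ c I) (hm : ∀ t ∈ I, c t ∈ O)
    {F : EuclideanSpace ℝ (Fin 2) → EuclideanSpace ℝ (Fin 2) → Coord3}
    (hF : ∀ v u, F v u = v 0 • F (e 0) u + v 1 • F (e 1) u)
    (hd : ∀ v, ContDiffOn ℝ ∞ (F v) O) :
    ContDiffOn ℝ ∞ (fun s => F (deriv c s) (c s)) I := by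
  have hk : ∀ i, ContDiffOn ℝ ∞ (fun s => deriv c s i) I := fun i =>
    (EuclideanSpace.proj (𝕜 := ℝ) i).contDiff.comp_contDiffOn (contDiffOn_deriv hI hc)
  have e1 : (fun s => F (deriv c s) (c s))
      = fun s => deriv c s 0 • F (e 0) (c s) + deriv c s 1 • F (e 1) (c s) := by
    ext1 s; exact hF _ _
  rw [e1]
  exact ((hk 0).smul ((hd _).comp hc hm)).add ((hk 1).smul ((hd _).comp hc hm))

namespace IsGeodesic

variable {c : ℝ → EuclideanSpace ℝ (Fin 2)} {I : Set ℝ}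

/-- The normal curvature along a geodesic. -/
def curv (a b : ℝ) (X : EuclideanSpace ℝ (Fin 2) → Coord3) (c : ℝ → EuclideanSpace ℝ (Fin 2))
    (t : ℝ) : ℝ :=
  sff a b X (deriv c t) (deriv c t) (c t)

theorem contDiffOn_shape_comp (h : IsPatch a X O) (hc : IsGeodesic a b X O I c) :
    ContDiffOn ℝ ∞ (fun s => shape a b X (deriv c s) (c s)) I :=
  contDiffOn_comp_linear hc.isOpen hc.contDiffOn hc.mem shape_eq (contDiffOn_shape h)

theorem contDiffOn_tang_comp (h : IsPatch a X O) (hc : IsGeodesic a b X O I c) :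
    ContDiffOn ℝ ∞ (fun s => tang a b X (deriv c s) (c s)) I :=
  contDiffOn_comp_linear hc.isOpen hc.contDiffOn hc.mem tang_eq (contDiffOn_tang h)

theorem contDiffOn_curv (h : IsPatch a X O) (hc : IsGeodesic a b X O I c) :
    ContDiffOn ℝ ∞ (curv a b X c) I :=
  (contDiffOn_shape_comp h hc).dotProduct (contDiffOn_tang_comp h hc)

theorem differentiableAt (hc : IsGeodesic a b X O I c) {t : ℝ} (ht : t ∈ I) :
    DifferentiableAt ℝ c t :=
  hc.contDiffOn.differentiableAt_of_isOpen hc.isOpen ht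

theorem frameDeriv_normal (h : IsPatch a X O) (hc : IsGeodesic a b X O I c) {t : ℝ} (ht : t ∈ I) :
    frameDeriv a b (X ∘ c) (frameVel a b (X ∘ c)) (fun s => normal a b X (c s)) t
      = -shape a b X (deriv c t) (c t) := by
  rw [frameDeriv_comp h (hc.differentiableAt ht) (hc.mem t ht)
    (differentiableAt_normal h (hc.mem t ht)), shape, neg_neg]

theorem frameVel_eq (h : IsPatch a X O) (hc : IsGeodesic a b X O I c) {t : ℝ} (ht : t ∈ I) :
    frameVel a b (X ∘ c) t = tang a b X (deriv c t) (c t) :=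
  frameVel_comp h (hc.differentiableAt ht) (hc.mem t ht)

theorem frameDeriv_tang (h : IsPatch a X O) (hc : IsGeodesic a b X O I c) {t : ℝ} (ht : t ∈ I) :
    frameDeriv a b (X ∘ c) (frameVel a b (X ∘ c)) (fun s => tang a b X (deriv c s) (c s)) t
      = curv a b X c t • normal a b X (c t) := by
  rw [curv, ← IsGeodesic.acceleration h hc ht]
  apply frameDeriv_congr
  filter_upwards [hc.isOpen.mem_nhds ht] with s hs using (hc.frameVel_eq h hs).symm

theorem frameDeriv_shape (h : IsPatch a X O) (hc : IsGeodesic a b X O I c) {t : ℝ} (ht : t ∈ I) :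
    frameDeriv a b (X ∘ c) (frameVel a b (X ∘ c)) (fun s => shape a b X (deriv c s) (c s)) t
      = cov a b X (deriv c t) (shape a b X (deriv c t)) (c t)
        - shape a b X (gam a b X (deriv c t) (deriv c t) (c t)) (c t) := by
  rw [frameDeriv_comp_linear h (hc.differentiableAt ht)
    ((contDiffOn_deriv hc.isOpen hc.contDiffOn).differentiableAt_of_isOpen hc.isOpen ht)
    (hc.mem t ht) shape_eq (differentiableAt_shape h (hc.mem t ht)), hc.eqn t ht]
  have hn : ∀ v u, shape a b X (-v) u = -shape a b X v u := by
    intro v u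
    rw [shape, shape, ← neg_one_smul ℝ v, cov_smul_dir]
    simp
  rw [hn]
  abel

/-- The bitension field of a geodesic of a patch. -/
theorem bitension_eq (h : IsPatch a X O) (hc : IsGeodesic a b X O I c) {t : ℝ} (ht : t ∈ I) :
    bcvFrame a b (X (c t)) ((bcvMetric a b).bitension (X ∘ c) t)
      = deriv (deriv (curv a b X c)) t • normal a b X (c t)
        - (2 * deriv (curv a b X c) t) • shape a b X (deriv c t) (c t)
        - curv a b X c t •
          (frameDeriv a b (X ∘ c) (frameVel a b (X ∘ c))
              (fun s => shape a b X (deriv c s) (c s)) t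
            + bcvCurv a b (normal a b X (c t) ⨯₃ tang a b X (deriv c t) (c t))
              ⨯₃ tang a b X (deriv c t) (c t)) := by
  have hI := hc.isOpen
  have hk := contDiffOn_curv h hc
  have hk' := contDiffOn_deriv hI hk
  have hN : ContDiffOn ℝ ∞ (fun s => normal a b X (c s)) I :=
    (contDiffOn_normal h).comp hc.contDiffOn hc.mem
  have hs := contDiffOn_shape_comp h hc
  have h1 : ∀ s ∈ I, frameDeriv a b (X ∘ c) (frameVel a b (X ∘ c))
      (fun s => curv a b X c s • normal a b X (c s)) s
      = deriv (curv a b X c) s • normal a b X (c s)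
        + (-curv a b X c s) • shape a b X (deriv c s) (c s) := by
    intro s hs'
    rw [frameDeriv_smul (hk.differentiableAt_of_isOpen hI hs')
      (hN.differentiableAt_of_isOpen hI hs'), frameDeriv_normal h hc hs']
    simp
  have h2 : frameDeriv a b (X ∘ c) (frameVel a b (X ∘ c))
      (fun s => curv a b X c s • normal a b X (c s)) =ᶠ[nhds t] fun s =>
        deriv (curv a b X c) s • normal a b X (c s)
          + (-curv a b X c s) • shape a b X (deriv c s) (c s) := by
    filter_upwards [hI.mem_nhds ht] with s hs' using h1 s hs'
  have hkt := hk.differentiableAt_of_isOpen hI ht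
  have hkt' := hk'.differentiableAt_of_isOpen hI ht
  have hNt := hN.differentiableAt_of_isOpen hI ht
  have hst := hs.differentiableAt_of_isOpen hI ht
  have hneg : deriv (fun s => -curv a b X c s) t = -deriv (curv a b X c) t := deriv.fun_neg
  have e1 : (X ∘ c) t = X (c t) := rfl
  rw [← e1, bcvFrame_bitension (A := fun s => curv a b X c s • normal a b X (c s)) hI (IsPatch.contDiffOn_comp h hc.contDiffOn hc.mem)
    (fun s hs => h.mem _ (hc.mem s hs)) (fun s hs => IsGeodesic.acceleration h hc hs) ht,
    hc.frameVel_eq h ht]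
  rw [frameDeriv_congr h2]
  rw [frameDeriv_add (hkt'.fun_smul hNt) (hkt.fun_neg.fun_smul hst), frameDeriv_smul hkt' hNt,
    frameDeriv_smul hkt.fun_neg hst, frameDeriv_normal h hc ht, hneg]
  have hG : ∀ (k : ℝ) (n w : Coord3), bcvCurv a b ((k • n) ⨯₃ w) ⨯₃ w
      = k • (bcvCurv a b (n ⨯₃ w) ⨯₃ w) := by
    intro k n w
    ext i
    fin_cases i <;> simp [bcvCurv, cross_apply] <;> ring
  rw [hG]
  module

/-- The component of the bitension along `T` is `-3kk'`. Indeed `⟨AT, T⟩ = k`, the curvature term is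
a cross product with `T`, and `⟨∇_T(AT), T⟩ = k'` because `∇_T T = kN` is orthogonal to `AT`. -/
theorem curv_mul_deriv_curv (h : IsPatch a X O) (hc : IsGeodesic a b X O I c)
    (hb : ∀ t ∈ I, (bcvMetric a b).bitension (X ∘ c) t = 0) {t : ℝ} (ht : t ∈ I) :
    curv a b X c t * deriv (curv a b X c) t = 0 := by
  have h1 := congrArg (fun w => w ⬝ᵥ tang a b X (deriv c t) (c t)) (bitension_eq h hc ht)
  have hz : bcvFrame a b (X (c t)) 0 = 0 := (bcvFrame_eq_zero (ne_of_gt (h.mem _ (hc.mem t ht)))).2 rfl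
  have h2 := deriv_dot_eq_frameDeriv (a := a) (b := b) (X ∘ c) (frameVel a b (X ∘ c))
    ((contDiffOn_shape_comp h hc).differentiableAt_of_isOpen hc.isOpen ht)
    ((contDiffOn_tang_comp h hc).differentiableAt_of_isOpen hc.isOpen ht)
  rw [frameDeriv_tang h hc ht, dotProduct_smul, shape_dot_normal h (hc.mem t ht)] at h2
  have h3 : deriv (fun s => shape a b X (deriv c s) (c s) ⬝ᵥ tang a b X (deriv c s) (c s)) t
      = deriv (curv a b X c) t := rfl
  have h4 : shape a b X (deriv c t) (c t) ⬝ᵥ tang a b X (deriv c t) (c t) = curv a b X c t := rfl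
  have h5 : ∀ u w : Coord3, (u ⨯₃ w) ⬝ᵥ w = 0 := fun u w => by
    rw [dotProduct_comm, dot_cross_self]
  rw [h3] at h2
  rw [hb t ht, hz] at h1
  simp only [zero_dotProduct, sub_dotProduct, add_dotProduct, smul_dotProduct, normal_dot_tang,
    h4, h5, smul_eq_mul] at h1
  simp only [smul_zero, add_zero] at h2
  rw [← h2] at h1
  linarith

/-- Where the normal curvature of a biharmonic geodesic is non-zero, the derivative of the shape
operator along it is a curvature term. -/
theorem cov_shape_eq (h : IsPatch a X O) (hc : IsGeodesic a b X O I c)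
    (hb : ∀ t ∈ I, (bcvMetric a b).bitension (X ∘ c) t = 0) {t : ℝ} (ht : t ∈ I)
    (hk : sff a b X (deriv c t) (deriv c t) (c t) ≠ 0) :
    cov a b X (deriv c t) (shape a b X (deriv c t)) (c t)
        - shape a b X (gam a b X (deriv c t) (deriv c t) (c t)) (c t)
      = -(bcvCurv a b (normal a b X (c t) ⨯₃ tang a b X (deriv c t) (c t))
              ⨯₃ tang a b X (deriv c t) (c t)) := by
  have h1 := bitension_eq h hc ht
  have hz : bcvFrame a b (X (c t)) 0 = 0 := (bcvFrame_eq_zero (ne_of_gt (h.mem _ (hc.mem t ht)))).2 rfl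
  have hcont : ContinuousAt (curv a b X c) t :=
    ((contDiffOn_curv h hc).differentiableAt_of_isOpen hc.isOpen ht).continuousAt
  -- Since `k ≠ 0` persists near `t`, `k'` vanishes on a neighbourhood, and this also kills `k''` at
  -- `t`.
  have hev : ∀ᶠ s in nhds t, deriv (curv a b X c) s = 0 := by
    filter_upwards [hc.isOpen.mem_nhds ht, hcont.eventually_ne hk] with s hs hs'
    exact (mul_eq_zero.1 (curv_mul_deriv_curv h hc hb hs)).resolve_left hs'
  have hd2 : deriv (deriv (curv a b X c)) t = 0 := by
    have : deriv (curv a b X c) =ᶠ[nhds t] fun _ => 0 := hev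
    rw [this.deriv_eq]; simp
  rw [hb t ht, hz, hev.self_of_nhds, hd2] at h1
  simp only [zero_smul, mul_zero, zero_sub, sub_zero] at h1
  have h2 := (smul_eq_zero.1 (neg_eq_zero.1 h1.symm)).resolve_left hk
  rw [frameDeriv_shape h hc ht] at h2
  exact eq_neg_of_add_eq_zero_left h2

end IsGeodesic

/-- Geodesics of a patch exist. -/
theorem exists_isGeodesic (h : IsPatch a X O) {u v : EuclideanSpace ℝ (Fin 2)} (hu : u ∈ O)
    (hv : tang a b X v u ⬝ᵥ tang a b X v u = 1) :
    ∃ c, ∃ ε > (0 : ℝ), IsGeodesic a b X O (Set.Ioo (-ε) ε) c ∧ c 0 = u ∧ deriv c 0 = v := by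
  set Q : EuclideanSpace ℝ (Fin 2) × EuclideanSpace ℝ (Fin 2) → EuclideanSpace ℝ (Fin 2) :=
    fun y => (y.2 0 * y.2 0) • gam a b X (e 0) (e 0) y.1 + (y.2 0 * y.2 1) • gam a b X (e 0) (e 1) y.1
      + (y.2 1 * y.2 0) • gam a b X (e 1) (e 0) y.1
      + (y.2 1 * y.2 1) • gam a b X (e 1) (e 1) y.1 with hQ
  have hOO : IsOpen (O ×ˢ (Set.univ : Set (EuclideanSpace ℝ (Fin 2)))) := h.isOpen.prod isOpen_univ
  have hp : ∀ i, ContDiffOn ℝ ∞ (fun y : EuclideanSpace ℝ (Fin 2) × EuclideanSpace ℝ (Fin 2) =>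
      y.2 i) (O ×ˢ Set.univ) := fun i =>
    ((EuclideanSpace.proj (𝕜 := ℝ) i).contDiff.comp contDiff_snd).contDiffOn
  have hg : ∀ i j, ContDiffOn ℝ ∞ (fun y : EuclideanSpace ℝ (Fin 2) × EuclideanSpace ℝ (Fin 2) =>
      gam a b X (e i) (e j) y.1) (O ×ˢ Set.univ) := fun i j =>
    (contDiffOn_gam h (e i) (e j)).comp contDiff_fst.contDiffOn fun y hy => hy.1
  have hQs : ContDiffOn ℝ ∞ Q (O ×ˢ Set.univ) :=
    (((((hp 0).mul (hp 0)).smul (hg 0 0)).add (((hp 0).mul (hp 1)).smul (hg 0 1))).add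
      (((hp 1).mul (hp 0)).smul (hg 1 0))).add (((hp 1).mul (hp 1)).smul (hg 1 1))
  set f : EuclideanSpace ℝ (Fin 2) × EuclideanSpace ℝ (Fin 2) → _ := fun y => (y.2, -Q y) with hf
  have hfs : ContDiffOn ℝ ∞ f (O ×ˢ Set.univ) := contDiff_snd.contDiffOn.prodMk hQs.neg
  have hu' : (u, v) ∈ O ×ˢ (Set.univ : Set (EuclideanSpace ℝ (Fin 2))) := ⟨hu, trivial⟩
  obtain ⟨α, hα0, ε, hε, hα⟩ :=
    ((hfs.contDiffAt (hOO.mem_nhds hu')).of_le (by simp) :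
      ContDiffAt ℝ 1 f (u, v)).exists_forall_mem_closedBall_exists_eq_forall_mem_Ioo_hasDerivAt₀ 0
  simp only [zero_sub, zero_add] at hα
  have hcont : ContinuousAt α 0 := (hα 0 ⟨by linarith, hε⟩).continuousAt
  have hev : ∀ᶠ t in nhds 0, α t ∈ O ×ˢ (Set.univ : Set (EuclideanSpace ℝ (Fin 2))) :=
    hcont.eventually_mem (by rw [hα0]; exact hOO.mem_nhds hu')
  obtain ⟨δ, hδ, hδm⟩ := Metric.eventually_nhds_iff.1 hev
  set r := min ε δ with hr
  have hr0 : 0 < r := lt_min hε hδ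
  have hmem : ∀ t ∈ Set.Ioo (-r) r, α t ∈ O ×ˢ (Set.univ : Set (EuclideanSpace ℝ (Fin 2))) := by
    intro t ht
    apply hδm
    rw [Real.dist_eq, sub_zero, abs_lt]
    exact ⟨by linarith [ht.1, min_le_right ε δ], by linarith [ht.2, min_le_right ε δ]⟩
  have hder : ∀ t ∈ Set.Ioo (-r) r, HasDerivAt α (f (α t)) t := by
    intro t ht
    exact hα t ⟨by linarith [ht.1, min_le_left ε δ], by linarith [ht.2, min_le_left ε δ]⟩
  -- Bootstrapping: `α' = f ∘ α` with `f` smooth, so a `Cⁿ` solution is `Cⁿ⁺¹`.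
  have hsmooth : ∀ n : ℕ, ContDiffOn ℝ n α (Set.Ioo (-r) r) := by
    intro n
    induction n with
    | zero =>
      rw [Nat.cast_zero, contDiffOn_zero]
      exact fun t ht => (hder t ht).continuousAt.continuousWithinAt
    | succ n ih =>
      rw [Nat.cast_add, Nat.cast_one, contDiffOn_succ_iff_deriv_of_isOpen isOpen_Ioo]
      refine ⟨fun t ht => (hder t ht).differentiableAt.differentiableWithinAt, by simp, ?_⟩
      have hfn : ContDiffOn ℝ n f (O ×ˢ Set.univ) := contDiffOn_infty.1 hfs n
      exact (hfn.comp ih hmem).congr fun t ht => (hder t ht).deriv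
  have hαs : ContDiffOn ℝ ∞ α (Set.Ioo (-r) r) := contDiffOn_infty.2 hsmooth
  set c : ℝ → EuclideanSpace ℝ (Fin 2) := fun t => (α t).1 with hc
  have hcs : ContDiffOn ℝ ∞ c (Set.Ioo (-r) r) := contDiff_fst.comp_contDiffOn hαs
  have hcd : ∀ t ∈ Set.Ioo (-r) r, deriv c t = (α t).2 := fun t ht =>
    ((ContinuousLinearMap.fst ℝ (EuclideanSpace ℝ (Fin 2)) (EuclideanSpace ℝ (Fin 2))).hasFDerivAt.comp_hasDerivAt
      t (hder t ht)).deriv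
  have hcd2 : ∀ t ∈ Set.Ioo (-r) r, deriv (deriv c) t = -Q (α t) := by
    intro t ht
    have h1 : deriv c =ᶠ[nhds t] fun s => (α s).2 := by
      filter_upwards [isOpen_Ioo.mem_nhds ht] with s hs using hcd s hs
    rw [h1.deriv_eq]
    exact ((ContinuousLinearMap.snd ℝ (EuclideanSpace ℝ (Fin 2))
      (EuclideanSpace ℝ (Fin 2))).hasFDerivAt.comp_hasDerivAt t (hder t ht)).deriv
  have hmO : ∀ t ∈ Set.Ioo (-r) r, c t ∈ O := fun t ht => (hmem t ht).1
  have heqn : ∀ t ∈ Set.Ioo (-r) r,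
      deriv (deriv c) t = -gam a b X (deriv c t) (deriv c t) (c t) := by
    intro t ht
    rw [hcd2 t ht, gam_eq h (hmO t ht), hcd t ht]
  have h0 : (0 : ℝ) ∈ Set.Ioo (-r) r := ⟨by linarith, hr0⟩
  have hts : ContDiffOn ℝ ∞ (fun s => tang a b X (deriv c s) (c s)) (Set.Ioo (-r) r) :=
    contDiffOn_comp_linear isOpen_Ioo hcs hmO tang_eq (contDiffOn_tang h)
  -- The geodesic equation makes the acceleration normal, so the speed is constant, and it is `1` at
  -- time `0`.
  have hconst : ∀ t ∈ Set.Ioo (-r) r,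
      deriv (fun s => tang a b X (deriv c s) (c s) ⬝ᵥ tang a b X (deriv c s) (c s)) t = 0 := by
    intro t ht
    have hd := hts.differentiableAt_of_isOpen isOpen_Ioo ht
    have e1 : (fun s => tang a b X (deriv c s) (c s)) =ᶠ[nhds t] frameVel a b (X ∘ c) := by
      filter_upwards [isOpen_Ioo.mem_nhds ht] with s hs using
        (frameVel_comp h (hcs.differentiableAt_of_isOpen isOpen_Ioo hs) (hmO s hs)).symm
    rw [deriv_dot_eq_frameDeriv (a := a) (b := b) (X ∘ c) (frameVel a b (X ∘ c)) hd hd,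
      frameDeriv_congr e1, frameDeriv_frameVel h isOpen_Ioo hcs hmO ht, heqn t ht, neg_add_cancel,
      tang_zero, zero_add, smul_dotProduct, dotProduct_smul, dotProduct_comm _ (normal a b X _),
      normal_dot_tang]
    simp
  refine ⟨c, r, hr0, ⟨isOpen_Ioo, hcs, hmO, fun t ht => ?_, heqn⟩, by simp [hc, hα0],
    by rw [hcd 0 h0, hα0]⟩
  have := isOpen_Ioo.is_const_of_deriv_eq_zero isPreconnected_Ioo
    ((hts.dotProduct hts).differentiableOn (by simp)) hconst ht h0
  rw [this, hcd 0 h0, hα0]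
  simpa [hc, hα0] using hv

end Patch

/-- The product of the two quadratics vanishes for every `s`. Its values at `0, ±1, ±2` determine
all five coefficients, and since `γ ≠ 0` these force `r`, then `q`, then `p` to vanish. -/
theorem eq_zero_of_mul_quadratic_eq_zero {p q r α β γ : ℝ} (hγ : γ ≠ 0)
    (h : ∀ s : ℝ, α + β * s + γ * s ^ 2 ≠ 0 → p + q * s + r * s ^ 2 = 0) : p = 0 := by
  have h' : ∀ s : ℝ, (α + β * s + γ * s ^ 2) * (p + q * s + r * s ^ 2) = 0 := by
    intro s
    by_cases hs : α + β * s + γ * s ^ 2 = 0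
    · rw [hs, zero_mul]
    · rw [h s hs, mul_zero]
  have h0 := h' 0
  have h1 := h' 1
  have h2 := h' (-1)
  have h3 := h' 2
  have h4 := h' (-2)
  have e4 : γ * r = 0 := by linarith
  have hr : r = 0 := (mul_eq_zero.1 e4).resolve_left hγ
  subst hr
  have e3 : γ * q = 0 := by linarith
  have hq : q = 0 := (mul_eq_zero.1 e3).resolve_left hγ
  subst hq
  have e2 : γ * p = 0 := by linarith
  exact (mul_eq_zero.1 e2).resolve_left hγ

theorem bcvCurv_dot_comm (a b : ℝ) (u w : Coord3) : bcvCurv a b u ⬝ᵥ w = u ⬝ᵥ bcvCurv a b w := by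
  simp [bcvCurv, dotProduct, Fin.sum_univ_three]; ring

/-! ### The derivative of the shape operator: Codazzi and biharmonic equations. -/

namespace Patch

open MetricField

variable {a b : ℝ} {X : EuclideanSpace ℝ (Fin 2) → Coord3} {O : Set (EuclideanSpace ℝ (Fin 2))}

/-- The covariant derivative of the shape operator. -/
def dshape (a b : ℝ) (X : EuclideanSpace ℝ (Fin 2) → Coord3) (v w u : EuclideanSpace ℝ (Fin 2)) :
    Coord3 :=
  cov a b X v (shape a b X w) u - shape a b X (gam a b X v w u) u

theorem shape_add (v w u : EuclideanSpace ℝ (Fin 2)) :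
    shape a b X (v + w) u = shape a b X v u + shape a b X w u := by
  simp only [shape, cov_add_dir, neg_add]

theorem shape_smul (c : ℝ) (v u : EuclideanSpace ℝ (Fin 2)) :
    shape a b X (c • v) u = c • shape a b X v u := by
  simp only [shape, cov_smul_dir, smul_neg]

theorem gam_comm (h : IsPatch a X O) {u : EuclideanSpace ℝ (Fin 2)} (hu : u ∈ O)
    (v w : EuclideanSpace ℝ (Fin 2)) : gam a b X v w u = gam a b X w v u := by
  rw [gam, gam, cov_tang_comm h hu]

theorem gam_add_left (v v' w u : EuclideanSpace ℝ (Fin 2)) :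
    gam a b X (v + v') w u = gam a b X v w u + gam a b X v' w u := by
  rw [gam, cov_add_dir, proj_add]; rfl

theorem gam_smul_left (c : ℝ) (v w u : EuclideanSpace ℝ (Fin 2)) :
    gam a b X (c • v) w u = c • gam a b X v w u := by
  rw [gam, cov_smul_dir, proj_smul]; rfl

theorem dshape_add_left (v v' w u : EuclideanSpace ℝ (Fin 2)) :
    dshape a b X (v + v') w u = dshape a b X v w u + dshape a b X v' w u := by
  rw [dshape, cov_add_dir, gam_add_left, shape_add]
  simp only [dshape]
  abel

theorem dshape_smul_left (c : ℝ) (v w u : EuclideanSpace ℝ (Fin 2)) :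
    dshape a b X (c • v) w u = c • dshape a b X v w u := by
  rw [dshape, cov_smul_dir, gam_smul_left, shape_smul, dshape, smul_sub]

theorem dshape_add_right (h : IsPatch a X O) {u : EuclideanSpace ℝ (Fin 2)} (hu : u ∈ O)
    (v w w' : EuclideanSpace ℝ (Fin 2)) :
    dshape a b X v (w + w') u = dshape a b X v w u + dshape a b X v w' u := by
  have e1 : shape a b X (w + w') = fun x => shape a b X w x + shape a b X w' x := by
    ext1 x; exact shape_add w w' x
  rw [dshape, gam_comm h hu, gam_add_left, shape_add, e1, cov_add v (differentiableAt_shape h hu w)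
    (differentiableAt_shape h hu w'), gam_comm h hu, gam_comm h hu w']
  simp only [dshape]
  abel

theorem dshape_smul_right (h : IsPatch a X O) {u : EuclideanSpace ℝ (Fin 2)} (hu : u ∈ O)
    (c : ℝ) (v w : EuclideanSpace ℝ (Fin 2)) :
    dshape a b X v (c • w) u = c • dshape a b X v w u := by
  have e1 : shape a b X (c • w) = fun x => c • shape a b X w x := by
    ext1 x; exact shape_smul c w x
  rw [dshape, gam_comm h hu, gam_smul_left, shape_smul, e1,
    cov_smul v c (differentiableAt_shape h hu w), gam_comm h hu, dshape, smul_sub]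

/-- The Codazzi equation. -/
theorem dshape_sub (h : IsPatch a X O) {u : EuclideanSpace ℝ (Fin 2)} (hu : u ∈ O)
    (v w : EuclideanSpace ℝ (Fin 2)) :
    dshape a b X v w u - dshape a b X w v u
      = bcvCurv a b (tang a b X v u ⨯₃ tang a b X w u) ⨯₃ normal a b X u := by
  have hN := contDiffOn_normal (b := b) h
  have hd : ∀ z, DifferentiableAt ℝ (cov a b X z (normal a b X)) u := fun z =>
    (contDiffOn_cov h z hN).differentiableAt_of_isOpen h.isOpen hu
  have hs : ∀ z, shape a b X z = fun x => (-1 : ℝ) • cov a b X z (normal a b X) x := by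
    intro z; ext1 x; rw [shape, neg_one_smul]
  have h1 := cov_cov_comm (b := b) h hu hN v w
  rw [dshape, dshape, gam_comm h hu, sub_sub_sub_cancel_right, hs v, hs w,
    cov_smul _ _ (hd w), cov_smul _ _ (hd v), ← smul_sub, h1, neg_one_smul, neg_neg]

/-- Differentiate `⟨A w, N⟩ = 0`. The normal component survives because `dshape` uses the ambient
connection. -/
theorem dshape_dot_normal (h : IsPatch a X O) {u : EuclideanSpace ℝ (Fin 2)} (hu : u ∈ O)
    (v w : EuclideanSpace ℝ (Fin 2)) :
    dshape a b X v w u ⬝ᵥ normal a b X u = shape a b X v u ⬝ᵥ shape a b X w u := by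
  have h1 := fderiv_dot_eq_cov (a := a) (b := b) (X := X) v (differentiableAt_shape (b := b) h hu w)
    (differentiableAt_normal (b := b) h hu)
  rw [fderiv_eq_zero_of_const h hu (fun x hx => shape_dot_normal h hx w)] at h1
  rw [dshape, sub_dotProduct, shape_dot_normal h hu, shape, neg_dotProduct,
    dotProduct_comm (cov a b X v (normal a b X) u)]
  simp at h1
  linarith

/-- Differentiate the symmetry of `II`. The normal terms of the Gauss formula pair to zero with the
shape operator, and the `Γ` terms match by the symmetry itself. -/
theorem dshape_dot_tang (h : IsPatch a X O) {u : EuclideanSpace ℝ (Fin 2)} (hu : u ∈ O)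
    (v w z : EuclideanSpace ℝ (Fin 2)) :
    dshape a b X v w u ⬝ᵥ tang a b X z u = dshape a b X v z u ⬝ᵥ tang a b X w u := by
  have h1 := fun w z => fderiv_dot_eq_cov (a := a) (b := b) (X := X) v
    (differentiableAt_shape (b := b) h hu w) (differentiableAt_tang (b := b) h hu z)
  have h2 : (fun x => shape a b X w x ⬝ᵥ tang a b X z x)
      =ᶠ[nhds u] fun x => shape a b X z x ⬝ᵥ tang a b X w x := by
    filter_upwards [h.isOpen.mem_nhds hu] with x hx using sff_comm h hx w z
  have h3 := h1 w z
  rw [h2.fderiv_eq, h1 z w, cov_tang h hu, cov_tang h hu] at h3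
  have h4 : ∀ w z, shape a b X w u ⬝ᵥ tang a b X (gam a b X v z u) u
      = shape a b X (gam a b X v z u) u ⬝ᵥ tang a b X w u := fun w z => sff_comm h hu _ _
  simp only [dotProduct_add, dotProduct_smul, shape_dot_normal h hu, h4] at h3
  simp only [dshape, sub_dotProduct]
  simp at h3
  linarith

theorem sff_add_smul (h : IsPatch a X O) {u : EuclideanSpace ℝ (Fin 2)} (hu : u ∈ O)
    (v w : EuclideanSpace ℝ (Fin 2)) (s : ℝ) :
    sff a b X (v + s • w) (v + s • w) u
      = sff a b X v v u + (2 * sff a b X v w u) * s + sff a b X w w u * s ^ 2 := by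
  have h1 := sff_comm (b := b) h hu v w
  simp only [sff, shape_add, shape_smul, tang_add, tang_smul, add_dotProduct, dotProduct_add,
    smul_dotProduct, dotProduct_smul, smul_eq_mul] at h1 ⊢
  linear_combination (-s) * h1

theorem sff_smul (c : ℝ) (v u : EuclideanSpace ℝ (Fin 2)) :
    sff a b X (c • v) (c • v) u = c ^ 2 * sff a b X v v u := by
  simp only [sff, shape_smul, tang_smul, smul_dotProduct, dotProduct_smul, smul_eq_mul]
  ring

/-- All geodesics of the patch are biharmonic curves. -/
def Biharmonic (a b : ℝ) (X : EuclideanSpace ℝ (Fin 2) → Coord3)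
    (O : Set (EuclideanSpace ℝ (Fin 2))) : Prop :=
  ∀ (ε : ℝ) (c : ℝ → EuclideanSpace ℝ (Fin 2)), IsGeodesic a b X O (Set.Ioo (-ε) ε) c →
    ∀ t ∈ Set.Ioo (-ε) ε, (bcvMetric a b).bitension (X ∘ c) t = 0

theorem tang_sq_pos (h : IsPatch a X O) {u v : EuclideanSpace ℝ (Fin 2)} (hu : u ∈ O)
    (hv : v ≠ 0) : 0 < tang a b X v u ⬝ᵥ tang a b X v u := by
  have h1 : 0 ≤ tang a b X v u ⬝ᵥ tang a b X v u :=
    Finset.sum_nonneg fun i _ => mul_self_nonneg _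
  refine lt_of_le_of_ne h1 fun hh => hv (tang_eq_zero (b := b) h hu ?_)
  exact dotProduct_self_eq_zero.1 hh.symm

/-- Every direction is positively proportional to a unit direction. -/
theorem exists_unit (h : IsPatch a X O) {u v : EuclideanSpace ℝ (Fin 2)} (hu : u ∈ O)
    (hv : v ≠ 0) : ∃ r : ℝ, 0 < r ∧ ∃ w, tang a b X w u ⬝ᵥ tang a b X w u = 1 ∧ v = r • w := by
  have h0 := tang_sq_pos (b := b) h hu hv
  have h1 := Real.sqrt_pos.2 h0
  refine ⟨√(tang a b X v u ⬝ᵥ tang a b X v u), h1, (√(tang a b X v u ⬝ᵥ tang a b X v u))⁻¹ • v,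
    ?_, ?_⟩
  · have h2 := Real.sq_sqrt h0.le
    simp only [tang_smul, smul_dotProduct, dotProduct_smul, smul_eq_mul]
    field_simp
    linarith
  · rw [smul_smul, mul_inv_cancel₀ h1.ne', one_smul]

/-- Apply `IsGeodesic.cov_shape_eq` at time `0` to the geodesic starting in the normalized
direction. Both sides are quadratic in `v`, so the normalization can be undone. -/
theorem dshape_self_of_sff_ne_zero (h : IsPatch a X O) (hB : Biharmonic a b X O)
    {u v : EuclideanSpace ℝ (Fin 2)} (hu : u ∈ O) (hv : sff a b X v v u ≠ 0) :
    dshape a b X v v u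
      = -(bcvCurv a b (normal a b X u ⨯₃ tang a b X v u) ⨯₃ tang a b X v u) := by
  have hv0 : v ≠ 0 := by
    rintro rfl
    apply hv
    simp [sff, tang_zero]
  obtain ⟨r, hr, w, hw, rfl⟩ := exists_unit (b := b) h hu hv0
  obtain ⟨c, ε, hε, hc, hc0, hc1⟩ := exists_isGeodesic h hu hw
  rw [sff_smul] at hv
  have hk : sff a b X (deriv c 0) (deriv c 0) (c 0) ≠ 0 := by
    rw [hc0, hc1]; exact right_ne_zero_of_mul hv
  have := hc.cov_shape_eq h (hB ε c hc) ⟨by linarith, hε⟩ hk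
  rw [hc0, hc1] at this
  rw [dshape_smul_left, dshape_smul_right h hu, dshape, this]
  ext i
  fin_cases i <;> simp [tang_smul, bcvCurv, cross_apply] <;> ring

/-- On the line `v + s v₀` the difference of the two sides is quadratic in `s` and vanishes wherever
the quadratic `II(v + s v₀, v + s v₀)` does not. The leading coefficient of the latter is `II(v₀,
v₀) ≠ 0`, so the difference vanishes also at `s = 0`. -/
theorem dshape_self (h : IsPatch a X O) (hB : Biharmonic a b X O)
    {u v₀ : EuclideanSpace ℝ (Fin 2)} (hu : u ∈ O) (hv₀ : sff a b X v₀ v₀ u ≠ 0)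
    (v : EuclideanSpace ℝ (Fin 2)) :
    dshape a b X v v u
      = -(bcvCurv a b (normal a b X u ⨯₃ tang a b X v u) ⨯₃ tang a b X v u) := by
  rw [← sub_eq_zero]
  ext i
  refine eq_zero_of_mul_quadratic_eq_zero (α := sff a b X v v u) (β := 2 * sff a b X v v₀ u)
    (q := (dshape a b X v v₀ u + dshape a b X v₀ v u
      + (bcvCurv a b (normal a b X u ⨯₃ tang a b X v u) ⨯₃ tang a b X v₀ u
        + bcvCurv a b (normal a b X u ⨯₃ tang a b X v₀ u) ⨯₃ tang a b X v u)) i)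
    (r := (dshape a b X v₀ v₀ u + bcvCurv a b (normal a b X u ⨯₃ tang a b X v₀ u)
      ⨯₃ tang a b X v₀ u) i) hv₀ fun s hs => ?_
  rw [← sff_add_smul h hu] at hs
  have h1 := congrFun (dshape_self_of_sff_ne_zero h hB hu hs) i
  simp only [dshape_add_left, dshape_add_right h hu, dshape_smul_left, dshape_smul_right h hu,
    tang_add, tang_smul] at h1
  revert h1
  generalize tang a b X v u = T
  generalize tang a b X v₀ u = S
  generalize normal a b X u = N
  fin_cases i <;> simp [bcvCurv, cross_apply] <;> intro h1 <;> linear_combination h1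

theorem exists_tang_eq (h : IsPatch a X O) {u : EuclideanSpace ℝ (Fin 2)} (hu : u ∈ O)
    {H : Coord3} (hH : H ⬝ᵥ normal a b X u = 0) : ∃ v, tang a b X v u = H := by
  refine ⟨proj a b X H u, ?_⟩
  conv_rhs => rw [tang_proj (b := b) h hu H, hH, zero_smul, add_zero]

/-- Algebraic consequence of the polarized biharmonic and Codazzi equations. -/
theorem codazzi_algebra {a b : ℝ} {t n η B11 B12 B21 B22 : Coord3} (htn : t ⨯₃ n = η)
    (hnη : n ⨯₃ η = t) (hηt : η ⨯₃ t = n)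
    (hC : B12 - B21 = bcvCurv a b η ⨯₃ η) (h1 : B11 ⬝ᵥ n = B12 ⬝ᵥ t) (h2 : B21 ⬝ᵥ n = B22 ⬝ᵥ t)
    (h11 : B11 = -(bcvCurv a b n ⨯₃ t)) (h22 : B22 = bcvCurv a b t ⨯₃ n)
    (h12 : B12 + B21 = bcvCurv a b t ⨯₃ t - bcvCurv a b n ⨯₃ n) :
    bcvCurv a b n ⬝ᵥ η = 0 ∧ bcvCurv a b t ⬝ᵥ η = 0 := by
  have key : ∀ x y z : Coord3, (x ⨯₃ y) ⬝ᵥ z = x ⬝ᵥ (y ⨯₃ z) := by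
    intro x y z
    simp [cross_apply, dotProduct, Fin.sum_univ_three]; ring
  have hnt : n ⨯₃ t = -η := by rw [← htn, cross_anticomm]
  have hηn : η ⨯₃ n = -t := by rw [← hnη, cross_anticomm]
  have c1 := congrArg (fun w => w ⬝ᵥ t) hC
  have c2 := congrArg (fun w => w ⬝ᵥ n) hC
  have c3 := congrArg (fun w => w ⬝ᵥ t) h12
  have c4 := congrArg (fun w => w ⬝ᵥ n) h12
  rw [h11] at h1
  rw [h22] at h2
  -- From the Codazzi and polarized equations, `2⟨B12, t⟩ = ⟨Gη, n⟩ + ⟨Gn, η⟩ = 2⟨Gn, η⟩`, while the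
  -- symmetry of the derivative gives `⟨B12, t⟩ = ⟨B11, n⟩ = -⟨Gn, η⟩`. Hence this number is `0`;
  -- exchanging the roles of `t` and `n` gives the other one.
  have s1 := bcvCurv_dot_comm a b n η
  have s2 := bcvCurv_dot_comm a b t η
  simp only [add_dotProduct, sub_dotProduct, neg_dotProduct, key, htn, hηt, hnt, hηn,
    cross_self, dotProduct_zero, dotProduct_neg] at c1 c2 c3 c4 h1 h2
  rw [dotProduct_comm (bcvCurv a b η)] at c1 c2
  constructor <;> linarith

/-- An orthonormal tangent basis adapted to a unit tangent vector. -/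
theorem exists_orthonormal (h : IsPatch a X O) {u v : EuclideanSpace ℝ (Fin 2)} (hu : u ∈ O)
    (hv : tang a b X v u ⬝ᵥ tang a b X v u = 1) :
    ∃ w, tang a b X w u = normal a b X u ⨯₃ tang a b X v u ∧
      tang a b X v u ⨯₃ tang a b X w u = normal a b X u ∧
      tang a b X w u ⨯₃ normal a b X u = tang a b X v u := by
  obtain ⟨w, hw⟩ := exists_tang_eq (b := b) h hu (H := normal a b X u ⨯₃ tang a b X v u)
    (by rw [dotProduct_comm, dot_self_cross])
  have h1 := normal_dot_self (b := b) h hu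
  have h2 : tang a b X v u ⬝ᵥ normal a b X u = 0 := by rw [dotProduct_comm, normal_dot_tang]
  refine ⟨w, hw, ?_, ?_⟩
  · rw [hw, cross_cross_eq_smul_sub_smul', hv, normal_dot_tang]
    simp
  · rw [hw, cross_cross_eq_smul_sub_smul, h1, h2]
    simp

/-- A biharmonic patch is vertical or horizontal where it is not totally geodesic. -/
theorem normal_two_eq_zero_or (h : IsPatch a X O) (hB : Biharmonic a b X O) (hab : 4 * a ≠ b ^ 2)
    {u v₀ : EuclideanSpace ℝ (Fin 2)} (hu : u ∈ O) (hv₀ : sff a b X v₀ v₀ u ≠ 0)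
    (v : EuclideanSpace ℝ (Fin 2)) : normal a b X u 2 = 0 ∨ tang a b X v u 2 = 0 := by
  by_cases hv0 : v = 0
  · right; rw [hv0, tang_zero]; rfl
  obtain ⟨r, hr, v, hv, rfl⟩ := exists_unit (b := b) h hu hv0
  obtain ⟨w, hw, hw1, hw2⟩ := exists_orthonormal h hu hv
  have hd := dshape_self h hB hu hv₀
  have hηn : normal a b X u ⨯₃ tang a b X w u = -tang a b X v u := by
    rw [← cross_anticomm, hw2]
  have hGneg : bcvCurv a b (-tang a b X v u) = -bcvCurv a b (tang a b X v u) := by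
    ext i; fin_cases i <;> simp [bcvCurv]
  have hGadd : ∀ x y, bcvCurv a b (x + y) = bcvCurv a b x + bcvCurv a b y := by
    intro x y; ext i; fin_cases i <;> simp [bcvCurv] <;> ring
  have hsum : normal a b X u ⨯₃ (tang a b X v u + tang a b X w u)
      = tang a b X w u + -tang a b X v u := by
    rw [map_add, hηn, ← hw]
  -- Polarization: the equation for `v + w` minus those for `v` and `w` gives the sum of the mixed
  -- derivatives.
  have h12 := hd (v + w)
  rw [dshape_add_left, dshape_add_right h hu, dshape_add_right h hu, hd v, hd w, tang_add,
    hsum, hηn, ← hw, hGadd, hGneg] at h12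
  have := codazzi_algebra (a := a) (b := b) (B11 := dshape a b X v v u)
    (B12 := dshape a b X v w u) (B21 := dshape a b X w v u) (B22 := dshape a b X w w u)
    hw1 hw2 hw.symm (by rw [dshape_sub h hu, hw1]) (dshape_dot_tang h hu v v w)
    (dshape_dot_tang h hu w v w) (by rw [hd v, hw]) (by rw [hd w, hηn, hGneg]; simp) (by
      simp only [map_add, LinearMap.add_apply, map_neg, LinearMap.neg_apply] at h12
      rw [← sub_eq_zero] at h12 ⊢
      rw [← h12]
      abel)
  have h3 := this.2
  have h4 := normal_dot_tang (a := a) (b := b) (X := X) v u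
  simp only [bcvCurv, dotProduct, Fin.sum_univ_three] at h3 h4
  simp at h3
  -- `G` is `b²/4` times the identity plus `4a - b²` on the third axis. The scalar part contributes
  -- nothing because `T` is orthogonal to `N`.
  have h5 : (4 * a - b ^ 2) * (normal a b X u 2 * tang a b X v u 2) = 0 := by
    linear_combination h3 - b ^ 2 / 4 * h4
  rcases mul_eq_zero.1 ((mul_eq_zero.1 h5).resolve_left (sub_ne_zero.2 hab)) with h6 | h6
  · exact Or.inl h6
  · right; rw [tang_smul]; simp [h6]

/-- The square of the shape operator of a biharmonic patch is a curvature term. -/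
theorem shape_dot_shape (h : IsPatch a X O) (hB : Biharmonic a b X O)
    {u v₀ : EuclideanSpace ℝ (Fin 2)} (hu : u ∈ O) (hv₀ : sff a b X v₀ v₀ u ≠ 0)
    (v : EuclideanSpace ℝ (Fin 2)) :
    shape a b X v u ⬝ᵥ shape a b X v u
      = bcvCurv a b (normal a b X u ⨯₃ tang a b X v u)
        ⬝ᵥ (normal a b X u ⨯₃ tang a b X v u) := by
  rw [← dshape_dot_normal h hu, dshape_self h hB hu hv₀]
  generalize bcvCurv a b (normal a b X u ⨯₃ tang a b X v u) = G
  simp [cross_apply, dotProduct, Fin.sum_univ_three]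
  ring

end Patch

/-! ### Biharmonic patches are vertical cylinders off the totally geodesic points. -/

namespace Patch

open MetricField

variable {a b : ℝ} {X : EuclideanSpace ℝ (Fin 2) → Coord3} {O : Set (EuclideanSpace ℝ (Fin 2))}

theorem contDiffOn_sff (h : IsPatch a X O) (v w : EuclideanSpace ℝ (Fin 2)) :
    ContDiffOn ℝ ∞ (sff a b X v w) O :=
  (contDiffOn_shape h v).dotProduct (contDiffOn_tang h w)

theorem eventually_sff_ne_zero (h : IsPatch a X O) {u v : EuclideanSpace ℝ (Fin 2)} (hu : u ∈ O)
    (hv : sff a b X v v u ≠ 0) : ∀ᶠ x in nhds u, x ∈ O ∧ sff a b X v v x ≠ 0 :=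
  Filter.Eventually.and (h.isOpen.mem_nhds hu)
    (((contDiffOn_sff h v v).differentiableAt_of_isOpen h.isOpen hu).continuousAt.eventually_ne hv)

/-- A biharmonic patch is vertical where it is not totally geodesic. -/
theorem normal_two_eq_zero (h : IsPatch a X O) (hB : Biharmonic a b X O) (hab : 4 * a ≠ b ^ 2)
    {u v₀ : EuclideanSpace ℝ (Fin 2)} (hu : u ∈ O) (hv₀ : sff a b X v₀ v₀ u ≠ 0) :
    normal a b X u 2 = 0 := by
  by_contra hne
  have dN := differentiableAt_normal (b := b) h hu
  have hev : ∀ᶠ x in nhds u, normal a b X x 0 = 0 ∧ normal a b X x 1 = 0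
      ∧ normal a b X x 2 = normal a b X u 2 := by
    have h2 : ContinuousAt (fun x => normal a b X x 2) u :=
      (differentiableAt_pi.1 dN 2).continuousAt
    -- Near `u` the normal is `±E₃`; this inequality excludes a change of sign, so the normal is
    -- constant in the frame.
    have h3 : ∀ᶠ x in nhds u, 0 < normal a b X x 2 * normal a b X u 2 :=
      Filter.Tendsto.eventually_const_lt (mul_self_pos.2 hne) (h2.mul_const (normal a b X u 2))
    have key : ∀ x ∈ O, sff a b X v₀ v₀ x ≠ 0 → normal a b X x 2 ≠ 0 →
        normal a b X x 0 = 0 ∧ normal a b X x 1 = 0 ∧ normal a b X x 2 ^ 2 = 1 := by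
      intro x hx hx' hn
      have hT : ∀ v, tang a b X v x 2 = 0 := fun v =>
        (normal_two_eq_zero_or h hB hab hx hx' v).resolve_left hn
      have e0 : normal a b X x 0 = 0 := by
        rw [normal, rawNormal]; simp [cross_apply, hT]
      have e1 : normal a b X x 1 = 0 := by
        rw [normal, rawNormal]; simp [cross_apply, hT]
      have := normal_dot_self (b := b) h hx
      simp only [dotProduct, Fin.sum_univ_three, e0, e1] at this
      exact ⟨e0, e1, by linarith⟩
    have hu2 := (key u hu hv₀ hne).2.2
    filter_upwards [eventually_sff_ne_zero h hu hv₀, h3] with x hx hx3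
    obtain ⟨e0, e1, e2⟩ := key x hx.1 hx.2 (left_ne_zero_of_mul hx3.ne')
    refine ⟨e0, e1, ?_⟩
    rcases sq_eq_sq_iff_eq_or_eq_neg.1 (e2.trans hu2.symm) with h4 | h4
    · exact h4
    · rw [h4] at hx3
      nlinarith
  have hconst : normal a b X =ᶠ[nhds u] fun _ => ![0, 0, normal a b X u 2] := by
    filter_upwards [hev] with x hx
    ext i
    fin_cases i
    · exact hx.1
    · exact hx.2.1
    · exact hx.2.2
  -- For a constant normal only the connection term is left in the shape operator. With `N` along
  -- `E₃` it is, up to the factor `b/2`, a quarter turn of the horizontal vector `T`, so `II(v₀, v₀)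
  -- = 0`.
  have hs : shape a b X v₀ u
      = -(bcvConn a b (X u) (tang a b X v₀ u) ⨯₃ normal a b X u) := by
    rw [shape, cov, hconst.fderiv_eq]
    simp
  apply hv₀
  rw [sff, hs, hconst.eq_of_nhds]
  have h0 := normal_dot_tang (a := a) (b := b) (X := X) v₀ u
  rw [hconst.eq_of_nhds] at h0
  simp [dotProduct, Fin.sum_univ_three] at h0
  have h0' : tang a b X v₀ u 2 = 0 := h0.resolve_left hne
  simp [bcvConn, cross_apply, dotProduct, Fin.sum_univ_three]
  ring

/-- The second fundamental form of a biharmonic patch where it is not totally geodesic. -/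
theorem biharmonic_structure (h : IsPatch a X O) (hB : Biharmonic a b X O) (hab : 4 * a ≠ b ^ 2)
    {u v₀ : EuclideanSpace ℝ (Fin 2)} (hu : u ∈ O) (hv₀ : sff a b X v₀ v₀ u ≠ 0) :
    b = 0 ∧ 0 < a ∧ normal a b X u 2 = 0 ∧ ∃ κ : ℝ, κ ^ 2 = 4 * a ∧ ∀ v,
      shape a b X v u
        = (κ * (tang a b X v u ⬝ᵥ ![normal a b X u 1, -normal a b X u 0, 0]))
          • ![normal a b X u 1, -normal a b X u 0, 0] := by
  have hN2 := normal_two_eq_zero h hB hab hu hv₀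
  have dN := differentiableAt_normal (b := b) h hu
  -- Verticality holds on a neighbourhood, so `N₃` may be differentiated. This determines the third
  -- component of the shape operator from the connection alone.
  have hev : (fun x => normal a b X x 2) =ᶠ[nhds u] fun _ => 0 := by
    filter_upwards [eventually_sff_ne_zero h hu hv₀] with x hx using
      normal_two_eq_zero h hB hab hx.1 hx.2
  have hNN := normal_dot_self (b := b) h hu
  have hs2 : ∀ v, shape a b X v u 2 = -(b / 2) * (tang a b X v u 0 * normal a b X u 1
      - tang a b X v u 1 * normal a b X u 0) := by
    intro v
    have h1 : fderiv ℝ (normal a b X) u v 2 = 0 := by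
      rw [fderiv_pi_apply dN, hev.fderiv_eq]; simp
    have h2 : shape a b X v u 2 = -(fderiv ℝ (normal a b X) u v 2
        + (bcvConn a b (X u) (tang a b X v u) ⨯₃ normal a b X u) 2) := rfl
    rw [h2, h1]
    simp [bcvConn, cross_apply]
    ring
  have hT : ∀ v, normal a b X u 0 * tang a b X v u 0 + normal a b X u 1 * tang a b X v u 1 = 0 := by
    intro v
    have := normal_dot_tang (a := a) (b := b) (X := X) v u
    simpa [dotProduct, Fin.sum_univ_three, hN2] using this
  have hSN : ∀ v, shape a b X v u 0 * normal a b X u 0 + shape a b X v u 1 * normal a b X u 1 = 0 := by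
    intro v
    have := shape_dot_normal (b := b) h hu v
    simpa [dotProduct, Fin.sum_univ_three, hN2] using this
  have hNN' : normal a b X u 0 ^ 2 + normal a b X u 1 ^ 2 = 1 := by
    simp only [dotProduct, Fin.sum_univ_three, hN2] at hNN
    linarith
  -- Since `N₃ = 0`, the vectors `E₃` and `ξ = N × E₃` form an orthonormal basis of the tangent
  -- plane.
  obtain ⟨v1, hv1⟩ := exists_tang_eq (b := b) h hu (H := ![0, 0, 1])
    (by simp [dotProduct, Fin.sum_univ_three, hN2])
  obtain ⟨v2, hv2⟩ := exists_tang_eq (b := b) h hu (H := ![normal a b X u 1, -normal a b X u 0, 0])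
    (by simp [dotProduct, Fin.sum_univ_three]; ring)
  have hq := shape_dot_shape h hB hu hv₀
  have q1 := hq v1
  have q2 := hq v2
  -- Polarizing with `q1` and `q2` gives the product `⟨A E₃, A ξ⟩`.
  have q12 := hq (v1 + v2)
  have hsym := sff_comm (b := b) h hu v1 v2
  have s1 := hs2 v1
  have s2 := hs2 v2
  have n1 := hSN v1
  have n2 := hSN v2
  have hTv : ∀ v, v = (tang a b X v u 2) • v1
      + (tang a b X v u ⬝ᵥ ![normal a b X u 1, -normal a b X u 0, 0]) • v2 := by
    intro v
    rw [← sub_eq_zero, sub_eq_add_neg, ← neg_one_smul ℝ]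
    apply tang_eq_zero (b := b) h hu
    rw [tang_add, tang_smul, tang_add, tang_smul, tang_smul, hv1, hv2]
    have := hT v
    ext i
    fin_cases i
    · simp [dotProduct, Fin.sum_univ_three]
      linear_combination (-tang a b X v u 0) * hNN' + normal a b X u 0 * this
    · simp [dotProduct, Fin.sum_univ_three]
      linear_combination (-tang a b X v u 1) * hNN' + normal a b X u 1 * this
    · simp [dotProduct, Fin.sum_univ_three]
  simp only [sff, hv1, hv2, shape_add, tang_add, bcvCurv, cross_apply, dotProduct,
    Fin.sum_univ_three] at q1 q2 q12 hsym s1 s2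
  simp [hN2] at q1 q2 q12 hsym s1 s2
  have hshape : ∀ v, shape a b X v u = (tang a b X v u 2) • shape a b X v1 u
      + (tang a b X v u ⬝ᵥ ![normal a b X u 1, -normal a b X u 0, 0]) • shape a b X v2 u := by
    intro v
    conv_lhs => rw [hTv v]
    rw [shape_add, shape_smul, shape_smul]
  have e0 : shape a b X v2 u 0 = (shape a b X v2 u 0 * normal a b X u 1 - shape a b X v2 u 1 * normal a b X u 0) * normal a b X u 1 := by
    linear_combination (-shape a b X v2 u 0) * hNN' + normal a b X u 0 * n2
  have e1 : shape a b X v2 u 1 = -(shape a b X v2 u 0 * normal a b X u 1 - shape a b X v2 u 1 * normal a b X u 0) * normal a b X u 0 := by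
    linear_combination (-shape a b X v2 u 1) * hNN' + normal a b X u 1 * n2
  have f0 : shape a b X v1 u 0 = (shape a b X v1 u 0 * normal a b X u 1 - shape a b X v1 u 1 * normal a b X u 0) * normal a b X u 1 := by
    linear_combination (-shape a b X v1 u 0) * hNN' + normal a b X u 0 * n1
  have f1 : shape a b X v1 u 1 = -(shape a b X v1 u 0 * normal a b X u 1 - shape a b X v1 u 1 * normal a b X u 0) * normal a b X u 0 := by
    linear_combination (-shape a b X v1 u 1) * hNN' + normal a b X u 1 * n1
  generalize hκ : shape a b X v2 u 0 * normal a b X u 1 - shape a b X v2 u 1 * normal a b X u 0 = κ at *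
  have hμ : shape a b X v1 u 0 * normal a b X u 1 - shape a b X v1 u 1 * normal a b X u 0 = shape a b X v2 u 2 := by
    linear_combination hsym
  rw [hμ] at f0 f1
  have s2' : shape a b X v2 u 2 = -(b / 2) := by
    rw [s2]; linear_combination (-(b / 2)) * hNN'
  rw [s2'] at f0 f1
  -- By now `A E₃ = -(b/2) ξ` and `A ξ = κ ξ - (b/2) E₃`. Since `N × E₃ = ξ` and `N × ξ = -E₃` are
  -- orthogonal eigenvectors of `G`, the mixed equation says `⟨A E₃, A ξ⟩ = -bκ/2 = 0`.
  have hbκ : b * κ = 0 := by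
    rw [e0, e1, f0, f1, s1, s2'] at q12
    rw [f0, f1, s1] at q1
    rw [e0, e1, s2'] at q2
    linear_combination (-1 : ℝ) * q12 + q1 + q2 - b * κ * hNN'
  -- The equation for `ξ` reads `κ² + b²/4 = 4a - 3b²/4`.
  have hκ2 : κ ^ 2 = 4 * a - b ^ 2 := by
    rw [e0, e1, s2'] at q2
    linear_combination q2 + ((4 * a - 3 * b ^ 2 / 4) * (normal a b X u 0 ^ 2
      + normal a b X u 1 ^ 2 + 1) - κ ^ 2) * hNN'
  have hκ0 : κ ≠ 0 := by
    rintro rfl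
    apply hab
    linarith
  have hb : b = 0 := (mul_eq_zero.1 hbκ).resolve_right hκ0
  refine ⟨hb, ?_, hN2, κ, ?_, fun v => ?_⟩
  · rw [hb] at hκ2
    have := pow_pos (abs_pos.2 hκ0) 2
    rw [sq_abs] at this
    linarith
  · rw [hκ2, hb]; ring
  · have z1 : shape a b X v1 u = 0 := by
      have g0 : shape a b X v1 u 0 = 0 := by rw [f0, hb]; simp
      have g1 : shape a b X v1 u 1 = 0 := by rw [f1, hb]; simp
      ext i
      fin_cases i
      · exact g0
      · exact g1
      · exact s1
    have z2 : shape a b X v2 u = κ • ![normal a b X u 1, -normal a b X u 0, 0] := by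
      ext i
      fin_cases i
      · simpa using e0
      · simpa using e1
      · simp only [Fin.reduceFinMk, s2']
        simp [hb]
    rw [hshape v, z1, z2, smul_zero, zero_add, smul_smul, mul_comm]

/-- If the quadratic form vanished, polarization would make `A v` orthogonal to all tangent vectors.
It is itself tangent, hence would be zero. -/
theorem exists_sff_ne_zero_of_shape_ne_zero (h : IsPatch a X O)
    {u v : EuclideanSpace ℝ (Fin 2)} (hu : u ∈ O) (hv : shape a b X v u ≠ 0) :
    ∃ v₀, sff a b X v₀ v₀ u ≠ 0 := by
  by_contra! hc
  have hs : ∀ w, sff a b X v w u = 0 := by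
    intro w
    have := sff_add_smul (b := b) h hu v w 1
    rw [hc, hc, hc] at this
    linarith
  apply hv
  apply dotProduct_self_eq_zero.1
  have := hs (proj a b X (shape a b X v u) u)
  rw [sff] at this
  have h2 := tang_proj (b := b) h hu (shape a b X v u)
  rw [shape_dot_normal h hu, zero_smul] at h2
  rw [add_zero] at h2
  rwa [← h2] at this

/-- The set of points where a biharmonic patch is totally geodesic is open and closed. -/
theorem eventually_sff_eq_zero_or (h : IsPatch a X O) (hB : Biharmonic a b X O)
    (hab : 4 * a ≠ b ^ 2) {u : EuclideanSpace ℝ (Fin 2)} (hu : u ∈ O) :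
    (∀ᶠ x in nhds u, x ∈ O ∧ ∀ v, sff a b X v v x = 0)
      ∨ ∀ᶠ x in nhds u, x ∈ O ∧ ∃ v, sff a b X v v x ≠ 0 := by
  by_cases hf : ∃ v, sff a b X v v u ≠ 0
  · obtain ⟨v, hv⟩ := hf
    right
    filter_upwards [eventually_sff_ne_zero h hu hv] with x hx using ⟨hx.1, v, hx.2⟩
  · left
    by_contra hcon
    -- Otherwise `u` is a limit of points that are not totally geodesic. The equations `N₃ = 0` and
    -- `|AT|² = ⟨G(N × T), N × T⟩` hold at those points and pass to `u` by continuity.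
    have hfr : ∃ᶠ x in nhds u, x ∈ O ∧ ∃ v, sff a b X v v x ≠ 0 := by
      intro hev
      apply hcon
      filter_upwards [hev, h.isOpen.mem_nhds hu] with x hx hxO
      push Not at hx
      exact ⟨hxO, hx hxO⟩
    obtain ⟨x₀, hx₀, v₀, hv₀⟩ := hfr.exists
    obtain ⟨hb, ha, -, -⟩ := biharmonic_structure h hB hab hx₀ hv₀
    have dN := differentiableAt_normal (b := b) h hu
    have hN2 : normal a b X u 2 = 0 := by
      by_contra hne
      have := (differentiableAt_pi.1 dN 2).continuousAt.eventually_ne hne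
      obtain ⟨x, ⟨hx, v, hv⟩, hx'⟩ := (hfr.and_eventually this).exists
      exact hx' (normal_two_eq_zero h hB hab hx hv)
    have hq : ∀ v, shape a b X v u ⬝ᵥ shape a b X v u
        = bcvCurv a b (normal a b X u ⨯₃ tang a b X v u)
          ⬝ᵥ (normal a b X u ⨯₃ tang a b X v u) := by
      intro v
      by_contra hne
      have c1 : ContinuousAt (fun x => shape a b X v x ⬝ᵥ shape a b X v x) u :=
        (((contDiffOn_shape (b := b) h v).dotProduct (contDiffOn_shape h v)).differentiableAt_of_isOpen
          h.isOpen hu).continuousAt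
      have c3 : ContDiffOn ℝ ∞ (fun x => normal a b X x ⨯₃ tang a b X v x) O :=
        (contDiffOn_normal h).cross (contDiffOn_tang h v)
      have c4 : ContDiffOn ℝ ∞ (fun x => bcvCurv a b (normal a b X x ⨯₃ tang a b X v x)) O := by
        have := contDiffOn_pi.1 c3
        rw [contDiffOn_pi]
        intro i
        fin_cases i
        · exact contDiffOn_const.mul (this 0)
        · exact contDiffOn_const.mul (this 1)
        · exact contDiffOn_const.mul (this 2)
      have c2 := ((c4.dotProduct c3).differentiableAt_of_isOpen h.isOpen hu).continuousAt
      have hev : ∀ᶠ x in nhds u, shape a b X v x ⬝ᵥ shape a b X v x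
          - bcvCurv a b (normal a b X x ⨯₃ tang a b X v x)
            ⬝ᵥ (normal a b X x ⨯₃ tang a b X v x) ≠ 0 :=
        (c1.sub c2).eventually_ne (sub_ne_zero.2 hne)
      obtain ⟨x, ⟨hx, w, hw⟩, hx'⟩ := (hfr.and_eventually hev).exists
      exact hx' (sub_eq_zero.2 (shape_dot_shape h hB hx hw v))
    have hNN := normal_dot_self (b := b) h hu
    -- For the horizontal tangent vector `ξ` the limit equation reads `|Aξ|² = 4a > 0`, so `u` is
    -- not totally geodesic after all.
    obtain ⟨v, hv⟩ := exists_tang_eq (b := b) h hu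
      (H := ![normal a b X u 1, -normal a b X u 0, 0])
      (by simp [dotProduct, Fin.sum_univ_three]; ring)
    have h1 := hq v
    apply hf
    apply exists_sff_ne_zero_of_shape_ne_zero h hu (v := v)
    intro h0
    rw [h0, hv] at h1
    simp only [dotProduct, Fin.sum_univ_three, hN2] at hNN
    rw [hb] at hNN
    simp [bcvCurv, cross_apply, dotProduct, Fin.sum_univ_three, hb, ha.ne'] at h1
    linarith

end Patch

namespace MetricField

theorem acceleration_congr {g : MetricField} {γ γ' : ℝ → Coord3} {t : ℝ} (h : γ =ᶠ[nhds t] γ') :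
    g.acceleration γ t = g.acceleration γ' t := by
  have h1 : deriv γ =ᶠ[nhds t] deriv γ' := h.deriv
  ext k
  simp only [acceleration, covDeriv, h1.deriv_eq, h1.eq_of_nhds, h.eq_of_nhds]

end MetricField

/-! ### From patches to immersed surfaces through charts. -/

section Chart

open MetricField

variable {M : Type*} [TopologicalSpace M] [ChartedSpace (EuclideanSpace ℝ (Fin 2)) M]
  {a b : ℝ} {φ : M → Coord3}

/-- An immersion in the chart at `m₀`. -/
def chartPatch (φ : M → Coord3) (m₀ : M) (u : EuclideanSpace ℝ (Fin 2)) : Coord3 :=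
  φ ((chartAt (EuclideanSpace ℝ (Fin 2)) m₀).symm u)

variable [IsManifold (𝓡 2) ∞ M]

theorem mdifferentiableAt_chart (m₀ : M) {m : M}
    (hm : m ∈ (chartAt (EuclideanSpace ℝ (Fin 2)) m₀).source) :
    MDifferentiableAt (𝓡 2) 𝓘(ℝ, EuclideanSpace ℝ (Fin 2))
      (chartAt (EuclideanSpace ℝ (Fin 2)) m₀) m :=
  ((contMDiffOn_chart (n := ∞)).contMDiffAt
    ((chartAt (EuclideanSpace ℝ (Fin 2)) m₀).open_source.mem_nhds hm)).mdifferentiableAt (by simp)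

theorem mdifferentiableAt_chart_symm (m₀ : M) {u : EuclideanSpace ℝ (Fin 2)}
    (hu : u ∈ (chartAt (EuclideanSpace ℝ (Fin 2)) m₀).target) :
    MDifferentiableAt 𝓘(ℝ, EuclideanSpace ℝ (Fin 2)) (𝓡 2)
      (chartAt (EuclideanSpace ℝ (Fin 2)) m₀).symm u :=
  ((contMDiffOn_chart_symm (n := ∞)).contMDiffAt
    ((chartAt (EuclideanSpace ℝ (Fin 2)) m₀).open_target.mem_nhds hu)).mdifferentiableAt (by simp)

theorem contDiffOn_chartPatch (hφ : IsImmersion (bcvDomain a) φ) (m₀ : M) :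
    ContDiffOn ℝ ∞ (chartPatch φ m₀) (chartAt (EuclideanSpace ℝ (Fin 2)) m₀).target :=
  (hφ.1.comp_contMDiffOn
    (contMDiffOn_chart_symm (I := 𝓡 2) (x := m₀) (n := ∞))).contDiffOn

theorem fderiv_chartPatch (hφ : IsImmersion (bcvDomain a) φ) (m₀ : M)
    {u : EuclideanSpace ℝ (Fin 2)} (hu : u ∈ (chartAt (EuclideanSpace ℝ (Fin 2)) m₀).target)
    (w : EuclideanSpace ℝ (Fin 2)) :
    fderiv ℝ (chartPatch φ m₀) u w
      = mfderiv (𝓡 2) 𝓘(ℝ, Coord3) φ ((chartAt (EuclideanSpace ℝ (Fin 2)) m₀).symm u)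
        (mfderiv 𝓘(ℝ, EuclideanSpace ℝ (Fin 2)) (𝓡 2)
          (chartAt (EuclideanSpace ℝ (Fin 2)) m₀).symm u w) := by
  rw [← mfderiv_eq_fderiv]
  exact mfderiv_comp_apply u (hφ.1.mdifferentiableAt (by simp)) (mdifferentiableAt_chart_symm m₀ hu) w

theorem mfderiv_eq_fderiv_chartPatch (hφ : IsImmersion (bcvDomain a) φ) (m₀ : M) {m : M}
    (hm : m ∈ (chartAt (EuclideanSpace ℝ (Fin 2)) m₀).source) (v : TangentSpace (𝓡 2) m) :
    mfderiv (𝓡 2) 𝓘(ℝ, Coord3) φ m v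
      = fderiv ℝ (chartPatch φ m₀) (chartAt (EuclideanSpace ℝ (Fin 2)) m₀ m)
        (mfderiv (𝓡 2) 𝓘(ℝ, EuclideanSpace ℝ (Fin 2))
          (chartAt (EuclideanSpace ℝ (Fin 2)) m₀) m v) := by
  have hu := (chartAt (EuclideanSpace ℝ (Fin 2)) m₀).map_source hm
  have he : φ =ᶠ[nhds m] chartPatch φ m₀ ∘ chartAt (EuclideanSpace ℝ (Fin 2)) m₀ := by
    filter_upwards [(chartAt (EuclideanSpace ℝ (Fin 2)) m₀).open_source.mem_nhds hm] with x hx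
    simp [chartPatch, (chartAt (EuclideanSpace ℝ (Fin 2)) m₀).left_inv hx]
  have hd : MDifferentiableAt 𝓘(ℝ, EuclideanSpace ℝ (Fin 2)) 𝓘(ℝ, Coord3) (chartPatch φ m₀)
      (chartAt (EuclideanSpace ℝ (Fin 2)) m₀ m) :=
    ((contDiffOn_chartPatch hφ m₀).differentiableAt_of_isOpen
      (chartAt (EuclideanSpace ℝ (Fin 2)) m₀).open_target hu).mdifferentiableAt
  have h1 := (hd.hasMFDerivAt.comp m (mdifferentiableAt_chart m₀ hm).hasMFDerivAt).congr_of_eventuallyEq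
    he
  rw [mfderiv_eq_fderiv] at h1
  exact congrArg (fun L : TangentSpace (𝓡 2) m →L[ℝ] Coord3 => L v) h1.mfderiv

theorem mfderiv_chart_symm_injective (m₀ : M)
    {u : EuclideanSpace ℝ (Fin 2)} (hu : u ∈ (chartAt (EuclideanSpace ℝ (Fin 2)) m₀).target) :
    Function.Injective (mfderiv 𝓘(ℝ, EuclideanSpace ℝ (Fin 2)) (𝓡 2)
          (chartAt (EuclideanSpace ℝ (Fin 2)) m₀).symm u) := by
  have he : chartAt (EuclideanSpace ℝ (Fin 2)) m₀ ∘ (chartAt (EuclideanSpace ℝ (Fin 2)) m₀).symm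
      =ᶠ[nhds u] id := by
    filter_upwards [(chartAt (EuclideanSpace ℝ (Fin 2)) m₀).open_target.mem_nhds hu] with x hx
    exact (chartAt (EuclideanSpace ℝ (Fin 2)) m₀).right_inv hx
  have hs := (chartAt (EuclideanSpace ℝ (Fin 2)) m₀).map_target hu
  have h1 : ∀ w, mfderiv (𝓡 2) 𝓘(ℝ, EuclideanSpace ℝ (Fin 2))
      (chartAt (EuclideanSpace ℝ (Fin 2)) m₀) ((chartAt (EuclideanSpace ℝ (Fin 2)) m₀).symm u)
      (mfderiv 𝓘(ℝ, EuclideanSpace ℝ (Fin 2)) (𝓡 2)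
          (chartAt (EuclideanSpace ℝ (Fin 2)) m₀).symm u w) = w := by
    intro w
    rw [← mfderiv_comp_apply u (mdifferentiableAt_chart m₀ hs) (mdifferentiableAt_chart_symm m₀ hu),
      he.mfderiv_eq, mfderiv_id]
    rfl
  intro w w' hw
  rw [← h1 w, hw, h1 w']

theorem isPatch_chartPatch (hφ : IsImmersion (bcvDomain a) φ) (m₀ : M) :
    IsPatch a (chartPatch φ m₀) (chartAt (EuclideanSpace ℝ (Fin 2)) m₀).target where
  isOpen := (chartAt (EuclideanSpace ℝ (Fin 2)) m₀).open_target
  contDiffOn := contDiffOn_chartPatch hφ m₀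
  mem := fun _ _ => hφ.2.1 _
  inj := fun u hu w w' hw => by
    rw [fderiv_chartPatch hφ m₀ hu, fderiv_chartPatch hφ m₀ hu] at hw
    exact mfderiv_chart_symm_injective m₀ hu (hφ.2.2 _ hw)

open Patch

/-- Geodesics of a chart are geodesics of the surface. -/
theorem isSurfaceGeodesic_of_isGeodesic (hφ : IsImmersion (bcvDomain a) φ) (m₀ : M) {I : Set ℝ}
    {c : ℝ → EuclideanSpace ℝ (Fin 2)}
    (hc : IsGeodesic a b (chartPatch φ m₀) (chartAt (EuclideanSpace ℝ (Fin 2)) m₀).target I c) :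
    (bcvMetric a b).IsSurfaceGeodesic φ I
      ((chartAt (EuclideanSpace ℝ (Fin 2)) m₀).symm ∘ c) := by
  have h := isPatch_chartPatch hφ m₀
  refine ⟨?_, fun t ht => ?_⟩
  · exact (contMDiffOn_chart_symm (I := 𝓡 2) (x := m₀) (n := ∞)).comp
      hc.contDiffOn.contMDiffOn hc.mem
  · have hcomp : φ ∘ ((chartAt (EuclideanSpace ℝ (Fin 2)) m₀).symm ∘ c) = chartPatch φ m₀ ∘ c := rfl
    have hcomp' : φ (((chartAt (EuclideanSpace ℝ (Fin 2)) m₀).symm ∘ c) t)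
      = (chartPatch φ m₀ ∘ c) t := rfl
    have hu := hc.mem t ht
    rw [hcomp, hcomp']
    constructor
    · rw [bcvMetric_inner]
      have := hc.frameVel_eq h ht
      rw [frameVel] at this
      rw [this, hc.unit t ht]
    · intro v
      have key : ∀ w : Coord3, (∃ z, w = fderiv ℝ (chartPatch φ m₀) (c t) z) →
          (bcvMetric a b).inner ((chartPatch φ m₀ ∘ c) t)
            ((bcvMetric a b).acceleration (chartPatch φ m₀ ∘ c) t) w = 0 := by
        rintro w ⟨z, rfl⟩
        rw [bcvMetric_inner, bcvFrame_acceleration hc.isOpen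
          (IsPatch.contDiffOn_comp h hc.contDiffOn hc.mem) (fun s hs => h.mem _ (hc.mem s hs)) ht,
          IsGeodesic.acceleration h hc ht, smul_dotProduct]
        have h2 := normal_dot_tang (a := a) (b := b) (X := chartPatch φ m₀) z (c t)
        rw [tang] at h2
        rw [Function.comp_apply, h2, smul_zero]
      apply key
      have hs := (chartAt (EuclideanSpace ℝ (Fin 2)) m₀).map_target hu
      have h1 := mfderiv_eq_fderiv_chartPatch hφ m₀ hs v
      rw [(chartAt (EuclideanSpace ℝ (Fin 2)) m₀).right_inv hu] at h1
      exact ⟨_, h1⟩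

/-- The acceleration of a geodesic of the surface in a chart. -/
theorem IsSurfaceGeodesic.frame_acceleration (hφ : IsImmersion (bcvDomain a) φ) (m₀ : M)
    {I : Set ℝ} {c : ℝ → M} (hI : IsOpen I) (hc : (bcvMetric a b).IsSurfaceGeodesic φ I c) {t : ℝ}
    (ht : t ∈ I) (hm : c t ∈ (chartAt (EuclideanSpace ℝ (Fin 2)) m₀).source) :
    ∃ v, bcvFrame a b (φ (c t)) ((bcvMetric a b).acceleration (φ ∘ c) t)
      = sff a b (chartPatch φ m₀) v v (chartAt (EuclideanSpace ℝ (Fin 2)) m₀ (c t))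
        • normal a b (chartPatch φ m₀) (chartAt (EuclideanSpace ℝ (Fin 2)) m₀ (c t)) := by
  have h := isPatch_chartPatch hφ m₀
  set ψ := chartAt (EuclideanSpace ℝ (Fin 2)) m₀ with hψ
  set J := I ∩ c ⁻¹' ψ.source with hJ
  have hJo : IsOpen J := hc.1.continuousOn.isOpen_inter_preimage hI ψ.open_source
  have htJ : t ∈ J := ⟨ht, hm⟩
  set d : ℝ → EuclideanSpace ℝ (Fin 2) := fun s => ψ (c s) with hd
  have hds : ContDiffOn ℝ ∞ d J :=
    ((contMDiffOn_chart (I := 𝓡 2) (x := m₀) (n := ∞)).comp (hc.1.mono Set.inter_subset_left)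
      (fun s hs => hs.2)).contDiffOn
  have hdm : ∀ s ∈ J, d s ∈ ψ.target := fun s hs => ψ.map_source hs.2
  have hev : φ ∘ c =ᶠ[nhds t] chartPatch φ m₀ ∘ d := by
    filter_upwards [hJo.mem_nhds htJ] with s hs
    simp only [Function.comp, chartPatch, hd]
    rw [← hψ, ψ.left_inv hs.2]
  have hp : φ (c t) = (chartPatch φ m₀ ∘ d) t := hev.eq_of_nhds
  have hu := hdm t htJ
  refine ⟨deriv d t, ?_⟩
  have hacc : bcvFrame a b (φ (c t)) ((bcvMetric a b).acceleration (φ ∘ c) t)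
      = tang a b (chartPatch φ m₀) (deriv (deriv d) t
          + gam a b (chartPatch φ m₀) (deriv d t) (deriv d t) (d t)) (d t)
        + sff a b (chartPatch φ m₀) (deriv d t) (deriv d t) (d t)
          • normal a b (chartPatch φ m₀) (d t) := by
    rw [acceleration_congr hev, hp, bcvFrame_acceleration hJo (IsPatch.contDiffOn_comp h hds hdm)
      (fun s hs => h.mem _ (hdm s hs)) htJ, frameDeriv_frameVel h hJo hds hdm htJ]
  rw [hacc]
  -- The defect `z` in the geodesic equation is a tangent direction. Testing the orthogonality
  -- condition with `dX(z)` gives `|dX(z)|² = 0`.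
  set z := deriv (deriv d) t + gam a b (chartPatch φ m₀) (deriv d t) (deriv d t) (d t) with hz
  suffices hz0 : tang a b (chartPatch φ m₀) z (d t) = 0 by rw [hz0, zero_add]
  have hct : ψ.symm (d t) = c t := ψ.left_inv hm
  have h3 : ∃ v : TangentSpace (𝓡 2) (c t), mfderiv (𝓡 2) 𝓘(ℝ, Coord3) φ (c t) v
      = fderiv ℝ (chartPatch φ m₀) (d t) z := by
    rw [← hct]
    exact ⟨_, (fderiv_chartPatch hφ m₀ hu z).symm⟩
  obtain ⟨v, hv⟩ := h3
  have key : ∀ w : Coord3, w = fderiv ℝ (chartPatch φ m₀) (d t) z →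
      (bcvMetric a b).inner (φ (c t)) ((bcvMetric a b).acceleration (φ ∘ c) t) w = 0 →
      tang a b (chartPatch φ m₀) z (d t) ⬝ᵥ tang a b (chartPatch φ m₀) z (d t) = 0 := by
    rintro w rfl h1
    have h2 : bcvFrame a b (φ (c t)) (fderiv ℝ (chartPatch φ m₀) (d t) z)
        = tang a b (chartPatch φ m₀) z (d t) := by rw [hp]; rfl
    rw [bcvMetric_inner, hacc, h2, add_dotProduct, smul_dotProduct, normal_dot_tang, smul_zero,
      add_zero] at h1
    exact h1
  exact dotProduct_self_eq_zero.1 (key _ hv ((hc.2 t ht).2 v))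

theorem biharmonic_chartPatch (hφ : IsImmersion (bcvDomain a) φ)
    (hB : (bcvMetric a b).TotallyBiharmonic φ) (m₀ : M) :
    Biharmonic a b (chartPatch φ m₀) (chartAt (EuclideanSpace ℝ (Fin 2)) m₀).target :=
  fun ε _ hc => hB (Set.Ioo (-ε) ε) _ isOpen_Ioo Set.ordConnected_Ioo
    (isSurfaceGeodesic_of_isGeodesic hφ m₀ hc)

/-- The value of the acceleration of some geodesic with given unit velocity in a chart. -/
theorem exists_surfaceGeodesic (hφ : IsImmersion (bcvDomain a) φ) (m₀ : M) {m : M}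
    (hm : m ∈ (chartAt (EuclideanSpace ℝ (Fin 2)) m₀).source) {v : EuclideanSpace ℝ (Fin 2)}
    (hv : tang a b (chartPatch φ m₀) v (chartAt (EuclideanSpace ℝ (Fin 2)) m₀ m)
      ⬝ᵥ tang a b (chartPatch φ m₀) v (chartAt (EuclideanSpace ℝ (Fin 2)) m₀ m) = 1) :
    ∃ (I : Set ℝ) (c : ℝ → M), IsOpen I ∧ I.OrdConnected ∧
      (bcvMetric a b).IsSurfaceGeodesic φ I c ∧ (0 : ℝ) ∈ I ∧ c 0 = m ∧
      bcvFrame a b (φ (c 0)) ((bcvMetric a b).acceleration (φ ∘ c) 0)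
        = sff a b (chartPatch φ m₀) v v (chartAt (EuclideanSpace ℝ (Fin 2)) m₀ m)
          • normal a b (chartPatch φ m₀) (chartAt (EuclideanSpace ℝ (Fin 2)) m₀ m) := by
  have h := isPatch_chartPatch hφ m₀
  obtain ⟨c, ε, hε, hc, hc0, hc1⟩ := exists_isGeodesic h
    ((chartAt (EuclideanSpace ℝ (Fin 2)) m₀).map_source hm) hv
  have h0 : (0 : ℝ) ∈ Set.Ioo (-ε) ε := ⟨by linarith, hε⟩
  refine ⟨Set.Ioo (-ε) ε, _, isOpen_Ioo, Set.ordConnected_Ioo,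
    isSurfaceGeodesic_of_isGeodesic hφ m₀ hc, h0, ?_, ?_⟩
  · simp [hc0, (chartAt (EuclideanSpace ℝ (Fin 2)) m₀).left_inv hm]
  · have := IsGeodesic.acceleration h hc h0
    rw [← bcvFrame_acceleration hc.isOpen
        (IsPatch.contDiffOn_comp h hc.contDiffOn hc.mem) (fun s hs => h.mem _ (hc.mem s hs)) h0,
        hc0, hc1] at this
    exact this

/-- All geodesics through `m` have zero acceleration at `m`. -/
def FlatAt (a b : ℝ) (φ : M → Coord3) (m : M) : Prop :=
  ∀ (I : Set ℝ) (c : ℝ → M), IsOpen I → I.OrdConnected → (bcvMetric a b).IsSurfaceGeodesic φ I c →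
    ∀ t ∈ I, c t = m → (bcvMetric a b).acceleration (φ ∘ c) t = 0

/-- Unit speed geodesics start in every direction, and their acceleration is `II(v, v) N`. So the
left side, which mentions no chart, can be tested in any chart around `m`. -/
theorem flatAt_iff (hφ : IsImmersion (bcvDomain a) φ) (m₀ : M) {m : M}
    (hm : m ∈ (chartAt (EuclideanSpace ℝ (Fin 2)) m₀).source) :
    FlatAt a b φ m ↔ ∀ v, sff a b (chartPatch φ m₀) v v
      (chartAt (EuclideanSpace ℝ (Fin 2)) m₀ m) = 0 := by
  have h := isPatch_chartPatch hφ m₀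
  have hu := (chartAt (EuclideanSpace ℝ (Fin 2)) m₀).map_source hm
  constructor
  · intro hf v
    by_cases hv0 : v = 0
    · simp [hv0, sff, tang_zero]
    obtain ⟨r, hr, w, hw, rfl⟩ := exists_unit (b := b) h hu hv0
    obtain ⟨I, c, hI, hI', hc, h0, hc0, hacc⟩ := exists_surfaceGeodesic hφ m₀ hm hw
    rw [hf I c hI hI' hc 0 h0 hc0, (bcvFrame_eq_zero (ne_of_gt (hφ.2.1 _))).2 rfl] at hacc
    have h1 := congrArg (fun x => x ⬝ᵥ normal a b (chartPatch φ m₀)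
      (chartAt (EuclideanSpace ℝ (Fin 2)) m₀ m)) hacc
    simp only [zero_dotProduct, smul_dotProduct, normal_dot_self h hu] at h1
    rw [sff_smul]
    simp at h1
    rw [← h1, mul_zero]
  · rintro hs I c hI hI' hc t ht rfl
    obtain ⟨v, hv⟩ := IsSurfaceGeodesic.frame_acceleration hφ m₀ hI hc ht hm
    rw [hs, zero_smul, bcvFrame_eq_zero (ne_of_gt (hφ.2.1 _))] at hv
    exact hv

theorem isClopen_setOf_flatAt (hφ : IsImmersion (bcvDomain a) φ)
    (hB : (bcvMetric a b).TotallyBiharmonic φ) (hab : 4 * a ≠ b ^ 2) :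
    IsClopen {m | FlatAt a b φ m} := by
  have key : ∀ m₀ : M, (∀ᶠ m in nhds m₀, FlatAt a b φ m) ∨ ∀ᶠ m in nhds m₀, ¬ FlatAt a b φ m := by
    intro m₀
    have hs := mem_chart_source (EuclideanSpace ℝ (Fin 2)) m₀
    have hcont := (chartAt (EuclideanSpace ℝ (Fin 2)) m₀).continuousAt hs
    have hsrc := (chartAt (EuclideanSpace ℝ (Fin 2)) m₀).open_source.mem_nhds hs
    rcases eventually_sff_eq_zero_or (isPatch_chartPatch hφ m₀) (biharmonic_chartPatch hφ hB m₀) hab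
      ((chartAt (EuclideanSpace ℝ (Fin 2)) m₀).map_source hs) with h | h
    · left
      filter_upwards [hcont.eventually h, hsrc] with m hm hm'
      exact (flatAt_iff hφ m₀ hm').2 hm.2
    · right
      filter_upwards [hcont.eventually h, hsrc] with m hm hm'
      rw [flatAt_iff hφ m₀ hm']
      push Not
      exact hm.2
  constructor
  · rw [← isOpen_compl_iff, isOpen_iff_mem_nhds]
    intro m hm
    rcases key m with h | h
    · exact absurd h.self_of_nhds hm
    · exact h
  · rw [isOpen_iff_mem_nhds]
    intro m hm
    rcases key m with h | h
    · exact h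
    · exact absurd hm h.self_of_nhds

end Chart

/-! ### The isometry with the punctured sphere times a line. -/

/-- Inverse stereographic projection onto the sphere of curvature `4a`, with scale adapted to the
conformal factor `λₐ`. -/
def sphereMap (a : ℝ) (p : Coord3) : EuclideanSpace ℝ (Fin 3) :=
  !₂[p 0 / bcvLambda a p, p 1 / bcvLambda a p, 1 / (√a * bcvLambda a p) - 1 / (2 * √a)]

/-- The image in `ℝ³` of the horizontal part of a frame vector. -/
def sphereFrame (a : ℝ) (p w : Coord3) : EuclideanSpace ℝ (Fin 3) :=
  !₂[w 0 - p 0 * (2 * a * (p 0 * w 0 + p 1 * w 1) / bcvLambda a p),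
    w 1 - p 1 * (2 * a * (p 0 * w 0 + p 1 * w 1) / bcvLambda a p),
    -(2 * a * (p 0 * w 0 + p 1 * w 1) / bcvLambda a p) / √a]

/-- The isometry of `N(a,0)` onto the product of a punctured sphere and a line. -/
def sphereLineMap (a : ℝ) (p : Coord3) : EuclideanSpace ℝ (Fin 3) × ℝ := (sphereMap a p, p 2)

theorem bcvLambda_pos {a : ℝ} (ha : 0 < a) (p : Coord3) : 0 < bcvLambda a p := by
  unfold bcvLambda; positivity

theorem bcvDomain_eq_univ {a : ℝ} (ha : 0 < a) : bcvDomain a = Set.univ :=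
  Set.eq_univ_of_forall fun p => bcvLambda_pos ha p

theorem contDiff_sphereMap {a : ℝ} (ha : 0 < a) : ContDiff ℝ ∞ (sphereMap a) := by
  have hl : ContDiff ℝ ∞ (bcvLambda a) := by unfold bcvLambda; fun_prop
  have hs : 0 < √a := Real.sqrt_pos.2 ha
  rw [contDiff_euclidean]
  intro i
  fin_cases i
  · exact (contDiff_apply ℝ ℝ (0 : Fin 3)).div hl fun p => (bcvLambda_pos ha p).ne'
  · exact (contDiff_apply ℝ ℝ (1 : Fin 3)).div hl fun p => (bcvLambda_pos ha p).ne'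
  · exact (contDiff_const.div (contDiff_const.mul hl)
      fun p => (mul_pos hs (bcvLambda_pos ha p)).ne').sub contDiff_const

theorem contDiff_sphereLineMap {a : ℝ} (ha : 0 < a) : ContDiff ℝ ∞ (sphereLineMap a) :=
  (contDiff_sphereMap ha).prodMk (contDiff_apply ℝ ℝ (2 : Fin 3))

theorem hasDerivAt_euclidean_line {f : ℝ → EuclideanSpace ℝ (Fin 3)} {f' : EuclideanSpace ℝ (Fin 3)}
    {t : ℝ} (h : ∀ i, HasDerivAt (fun s => f s i) (f' i) t) : HasDerivAt f f' t := by
  rw [hasDerivAt_iff_hasFDerivAt, ← hasFDerivWithinAt_univ, hasFDerivWithinAt_euclidean]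
  intro i
  refine (h i).hasFDerivAt.hasFDerivWithinAt.congr_fderiv ?_
  ext
  simp

theorem fderiv_sphereMap {a : ℝ} (ha : 0 < a) (p u : Coord3) :
    fderiv ℝ (sphereMap a) p u = sphereFrame a p (bcvFrame a 0 p u) := by
  have hs : 0 < √a := Real.sqrt_pos.2 ha
  have hd : DifferentiableAt ℝ (sphereMap a) p :=
    (contDiff_sphereMap ha).differentiable (by simp) p
  rw [← hd.lineDeriv_eq_fderiv]
  have hl := (bcvLambda_pos ha p).ne'
  have hl0 : bcvLambda a (p + (0 : ℝ) • u) ≠ 0 := (bcvLambda_pos ha _).ne'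
  have hp : ∀ i, HasDerivAt (fun t : ℝ => (p + t • u) i) (u i) 0 := fun i => by
    simpa using ((hasDerivAt_id (0 : ℝ)).mul_const (u i)).const_add (p i)
  have hL : HasDerivAt (fun t : ℝ => bcvLambda a (p + t • u)) (2 * a * (p 0 * u 0 + p 1 * u 1)) 0 := by
    refine ((((hp 0).pow 2).add ((hp 1).pow 2)).const_mul a).const_add 1 |>.congr_deriv ?_
    simp
    ring
  apply HasDerivAt.deriv
  apply hasDerivAt_euclidean_line
  intro i
  fin_cases i
  · refine ((hp 0).div hL hl0).congr_deriv ?_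
    simp [sphereFrame, bcvFrame]
    field_simp
  · refine ((hp 1).div hL hl0).congr_deriv ?_
    simp [sphereFrame, bcvFrame]
    field_simp
  · refine (((hasDerivAt_const (0 : ℝ) (1 : ℝ)).div (hL.const_mul (√a))
      (mul_ne_zero hs.ne' hl0)).sub_const (1 / (2 * √a))).congr_deriv ?_
    simp [sphereFrame, bcvFrame]
    field_simp

theorem fderiv_sphereLineMap {a : ℝ} (ha : 0 < a) (p u : Coord3) :
    fderiv ℝ (sphereLineMap a) p u = (sphereFrame a p (bcvFrame a 0 p u), u 2) := by
  have h1 : HasFDerivAt (sphereMap a) (fderiv ℝ (sphereMap a) p) p :=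
    ((contDiff_sphereMap ha).differentiable (by simp) p).hasFDerivAt
  have h2 : HasFDerivAt (fun q : Coord3 => q 2) (ContinuousLinearMap.proj (R := ℝ) 2) p :=
    hasFDerivAt_apply 2 p
  have h3 : HasFDerivAt (sphereLineMap a) _ p := h1.prodMk h2
  rw [h3.fderiv]
  simp [fderiv_sphereMap ha]

theorem inner_eq_sum_three (v w : EuclideanSpace ℝ (Fin 3)) :
    inner ℝ v w = v 0 * w 0 + v 1 * w 1 + v 2 * w 2 := by
  simp only [PiLp.inner_apply, Fin.sum_univ_three, RCLike.inner_apply, conj_trivial]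
  ring

/-- Inverse stereographic projection is conformal with factor `1/λ`, so the horizontal frame goes to
an orthonormal pair in `ℝ³`. -/
theorem inner_sphereFrame {a : ℝ} (ha : 0 < a) (p v w : Coord3) :
    inner ℝ (sphereFrame a p v) (sphereFrame a p w) = v 0 * w 0 + v 1 * w 1 := by
  have hs : 0 < √a := Real.sqrt_pos.2 ha
  have hl := (bcvLambda_pos ha p).ne'
  have hsq : √a ^ 2 = a := Real.sq_sqrt ha.le
  simp only [inner_eq_sum_three, sphereFrame]
  simp
  field_simp
  rw [hsq]
  unfold bcvLambda
  ring

theorem inner_sphereMap_sphereFrame {a : ℝ} (ha : 0 < a) (p w : Coord3) :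
    inner ℝ (sphereMap a p) (sphereFrame a p w) = 0 := by
  have hs : 0 < √a := Real.sqrt_pos.2 ha
  have hl := (bcvLambda_pos ha p).ne'
  have hsq : √a ^ 2 = a := Real.sq_sqrt ha.le
  simp only [inner_eq_sum_three, sphereFrame, sphereMap]
  simp
  field_simp
  rw [hsq]
  unfold bcvLambda
  ring

theorem inner_sphereMap_self {a : ℝ} (ha : 0 < a) (p : Coord3) :
    inner ℝ (sphereMap a p) (sphereMap a p) = 1 / (4 * a) := by
  have hs : 0 < √a := Real.sqrt_pos.2 ha
  have hl := (bcvLambda_pos ha p).ne'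
  have hsq : √a ^ 2 = a := Real.sq_sqrt ha.le
  simp only [inner_eq_sum_three, sphereMap]
  simp
  field_simp
  rw [hsq]
  unfold bcvLambda
  ring

theorem one_div_sqrt_four_mul {a : ℝ} : 1 / √(4 * a) = 1 / (2 * √a) := by
  rw [Real.sqrt_mul (by norm_num), show (4 : ℝ) = 2 ^ 2 by norm_num, Real.sqrt_sq (by norm_num)]

theorem mem_sphere_iff_sum {r : ℝ} (hr : 0 ≤ r) (q : EuclideanSpace ℝ (Fin 3)) :
    q ∈ Metric.sphere (0 : EuclideanSpace ℝ (Fin 3)) r ↔ q 0 ^ 2 + q 1 ^ 2 + q 2 ^ 2 = r ^ 2 := by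
  rw [mem_sphere_zero_iff_norm, ← sq_eq_sq₀ (norm_nonneg _) hr, EuclideanSpace.real_norm_sq_eq,
    Fin.sum_univ_three]

theorem isIsometryOntoSphereTimesLine_sphereLineMap {a : ℝ} (ha : 0 < a) :
    IsIsometryOntoSphereTimesLine a 0 (4 * a) (sphereLineMap a) := by
  have hs : 0 < √a := Real.sqrt_pos.2 ha
  have hsq : √a ^ 2 = a := Real.sq_sqrt ha.le
  have hr' : (0 : ℝ) ≤ 1 / (2 * √a) := by positivity
  -- The missing pole is the limit of the projection as `λ → ∞`.
  refine ⟨(contDiff_sphereLineMap ha).contDiffOn, ?_, ⟨!₂[0, 0, -(1 / (2 * √a))], ?_, ?_⟩, ?_⟩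
  · intro p _ q _ h
    have hp := bcvLambda_pos ha p
    have hq := bcvLambda_pos ha q
    obtain ⟨h1, h2⟩ := Prod.mk.inj h
    have e0 : p 0 / bcvLambda a p = q 0 / bcvLambda a q := congrArg (fun z => z 0) h1
    have e1 : p 1 / bcvLambda a p = q 1 / bcvLambda a q := congrArg (fun z => z 1) h1
    have e2 : 1 / (√a * bcvLambda a p) - 1 / (2 * √a) = 1 / (√a * bcvLambda a q) - 1 / (2 * √a) :=
      congrArg (fun z => z 2) h1
    have e3 : bcvLambda a p = bcvLambda a q := by
      field_simp at e2
      linarith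
    rw [e3] at e0 e1
    ext i
    fin_cases i
    · simpa [hq.ne'] using (div_left_inj' hq.ne').1 e0
    · simpa [hq.ne'] using (div_left_inj' hq.ne').1 e1
    · exact h2
  · rw [one_div_sqrt_four_mul, mem_sphere_iff_sum hr']
    simp
  · rw [bcvDomain_eq_univ ha, Set.image_univ]
    ext ⟨q, z⟩
    simp only [Set.mem_range, Set.mem_prod, Set.mem_univ, and_true, Set.mem_sdiff,
      Set.mem_singleton_iff, one_div_sqrt_four_mul, mem_sphere_iff_sum hr']
    constructor
    · rintro ⟨p, hp⟩
      obtain ⟨rfl, -⟩ := Prod.mk.inj hp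
      constructor
      · have h1 := inner_sphereMap_self ha p
        rw [inner_eq_sum_three] at h1
        rw [div_pow, mul_pow, hsq]
        linarith
      · intro h
        have e2 : 1 / (√a * bcvLambda a p) - 1 / (2 * √a) = -(1 / (2 * √a)) :=
          congrArg (fun z => z 2) h
        have := mul_pos hs (bcvLambda_pos ha p)
        have : 0 < 1 / (√a * bcvLambda a p) := by positivity
        linarith
    · rintro ⟨hq, hne⟩
      rw [div_pow, mul_pow, hsq] at hq
      have hd : q 2 + 1 / (2 * √a) ≠ 0 := by
        intro h0
        apply hne
        have h2 : q 2 = -(1 / (2 * √a)) := by linarith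
        have h3 : q 2 ^ 2 = 1 ^ 2 / (2 ^ 2 * a) := by
          rw [h2, neg_sq, div_pow, mul_pow, hsq]
        have h4 : q 0 = 0 := by nlinarith [sq_nonneg (q 0), sq_nonneg (q 1)]
        have h5 : q 1 = 0 := by nlinarith [sq_nonneg (q 0), sq_nonneg (q 1)]
        ext i
        fin_cases i
        · simpa using h4
        · simpa using h5
        · simpa using h2
      -- The third coordinate of the sphere map determines `λ`. This `μ` is the value that `λ` must
      -- take at the preimage, whose horizontal coordinates are then `μ q₀` and `μ q₁`.
      set μ := 1 / (√a * (q 2 + 1 / (2 * √a))) with hμ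
      have hμ0 : μ ≠ 0 := by rw [hμ]; positivity
      have hq2 : 1 / (√a * μ) = q 2 + 1 / (2 * √a) := by
        rw [hμ]
        field_simp
      have hlam : bcvLambda a ![μ * q 0, μ * q 1, z] = μ := by
        have h01 : q 0 ^ 2 + q 1 ^ 2 = 1 / (a * μ) - 1 / (a * μ ^ 2) := by
          have e : q 2 = 1 / (√a * μ) - 1 / (2 * √a) := by linarith
          rw [e] at hq
          have : (1 / (√a * μ) - 1 / (2 * √a)) ^ 2
              = 1 / (a * μ ^ 2) - 1 / (a * μ) + 1 ^ 2 / (2 ^ 2 * a) := by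
            field_simp
            rw [hsq]
            ring
          linarith
        simp only [bcvLambda]
        have : 1 + a * (μ ^ 2 * (q 0 ^ 2 + q 1 ^ 2)) = μ := by
          rw [h01]
          field_simp
          ring
        refine Eq.trans ?_ this
        simp only [Matrix.cons_val_zero, Matrix.cons_val_one]
        ring
      refine ⟨![μ * q 0, μ * q 1, z], ?_⟩
      rw [sphereLineMap, sphereMap, hlam]
      refine Prod.ext ?_ rfl
      ext i
      fin_cases i
      · simp [hμ0]
      · simp [hμ0]
      · simp only [hq2]
        simp
  · intro p _ u v
    rw [fderiv_sphereLineMap ha, fderiv_sphereLineMap ha, bcvForm_eq_dotProduct,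
      inner_sphereFrame ha]
    simp [dotProduct, Fin.sum_univ_three, bcvFrame]

/-! ### The axis of a circle and its constancy along the surface. -/

/-- Up to scale, the axis of the circle through the point `p` of the sphere with the curvature of
the circles of radius `1 / √(2ρ)`, bending in the direction `n`. -/
def circleAxis (a : ℝ) (p n : Coord3) : EuclideanSpace ℝ (Fin 3) :=
  sphereFrame a p n + (2 * √a) • sphereMap a p

/-- The hypotheses say that the horizontal curve has velocity `T = τ (n₁, -n₀)` in the frame and
that the covariant derivative of `n` is `-2√a T`. As `n` is orthogonal to `T`, the sphere adds no
normal term to the derivative of `n` in `ℝ³`, and `-2√a T` cancels against the derivative of `2√a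
q`. -/
theorem hasDerivAt_circleAxis {a : ℝ} (ha : 0 < a) {x n : ℝ → Coord3} {x' n' : Coord3} {t τ : ℝ}
    (hx : HasDerivAt x x' t) (hn : HasDerivAt n n' t)
    (hx0 : x' 0 = bcvLambda a (x t) * (τ * n t 1)) (hx1 : x' 1 = -(bcvLambda a (x t) * (τ * n t 0)))
    (hn0 : n' 0 = (-(2 * √a * τ) + 2 * a * τ * (x t 0 * n t 0 + x t 1 * n t 1)) * n t 1)
    (hn1 : n' 1 = -((-(2 * √a * τ) + 2 * a * τ * (x t 0 * n t 0 + x t 1 * n t 1)) * n t 0)) :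
    HasDerivAt (fun s => circleAxis a (x s) (n s)) 0 t := by
  have hs : 0 < √a := Real.sqrt_pos.2 ha
  have hsq : √a ^ 2 = a := Real.sq_sqrt ha.le
  have hl := (bcvLambda_pos ha (x t)).ne'
  have dx := fun i => hasDerivAt_pi.1 hx i
  have dn := fun i => hasDerivAt_pi.1 hn i
  have dl : HasDerivAt (fun s => bcvLambda a (x s))
      (2 * a * bcvLambda a (x t) * τ * (x t 0 * n t 1 - x t 1 * n t 0)) t := by
    refine ((((dx 0).pow 2).add ((dx 1).pow 2)).const_mul a).const_add 1 |>.congr_deriv ?_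
    rw [hx0, hx1]
    simp
    ring
  have dL : HasDerivAt
      (fun s => 2 * a * (x s 0 * n s 0 + x s 1 * n s 1) / bcvLambda a (x s))
      (-(4 * a * √a * τ * (x t 0 * n t 1 - x t 1 * n t 0) / bcvLambda a (x t))) t := by
    refine (((((dx 0).mul (dn 0)).add ((dx 1).mul (dn 1))).const_mul (2 * a)).div dl hl).congr_deriv ?_
    rw [hx0, hx1, hn0, hn1]
    simp
    field_simp
    ring
  apply hasDerivAt_euclidean_line
  intro i
  fin_cases i
  · refine (((dn 0).sub ((dx 0).mul dL)).add (((dx 0).div dl hl).const_mul (2 * √a))).congr_deriv ?_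
    rw [hx0, hn0]
    simp
    field_simp
    ring
  · refine (((dn 1).sub ((dx 1).mul dL)).add (((dx 1).div dl hl).const_mul (2 * √a))).congr_deriv ?_
    rw [hx1, hn1]
    simp
    field_simp
    ring
  · refine ((dL.neg.div_const √a).add ((((hasDerivAt_const t (1 : ℝ)).div (dl.const_mul (√a))
      (mul_ne_zero hs.ne' hl)).sub_const (1 / (2 * √a))).const_mul (2 * √a))).congr_deriv ?_
    simp
    field_simp
    ring

theorem contDiff_circleAxis {a : ℝ} (ha : 0 < a) :
    ContDiff ℝ ∞ fun q : Coord3 × Coord3 => circleAxis a q.1 q.2 := by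
  have h1 : ∀ i : Fin 3, ContDiff ℝ ∞ fun q : Coord3 × Coord3 => q.1 i := fun i => by fun_prop
  have h2 : ∀ i : Fin 3, ContDiff ℝ ∞ fun q : Coord3 × Coord3 => q.2 i := fun i => by fun_prop
  have hl : ContDiff ℝ ∞ fun q : Coord3 × Coord3 => bcvLambda a q.1 := by
    unfold bcvLambda; fun_prop
  have hL : ContDiff ℝ ∞ fun q : Coord3 × Coord3 =>
      2 * a * (q.1 0 * q.2 0 + q.1 1 * q.2 1) / bcvLambda a q.1 :=
    ContDiff.div (by fun_prop) hl fun q => (bcvLambda_pos ha q.1).ne'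
  have hF : ContDiff ℝ ∞ fun q : Coord3 × Coord3 => sphereFrame a q.1 q.2 := by
    rw [contDiff_euclidean]
    intro i
    fin_cases i
    · exact (h2 0).sub ((h1 0).mul hL)
    · exact (h2 1).sub ((h1 1).mul hL)
    · exact hL.neg.div_const _
  exact hF.add (((contDiff_sphereMap ha).comp contDiff_fst).const_smul (2 * √a))

/-- The two summands are orthogonal, of squared lengths `1` and `4a · 1/(4a)`. -/
theorem inner_circleAxis_self {a : ℝ} (ha : 0 < a) (p : Coord3) {n : Coord3}
    (hn : n 0 * n 0 + n 1 * n 1 = 1) :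
    inner ℝ (circleAxis a p n) (circleAxis a p n) = 2 := by
  have hsq : √a * √a = a := Real.mul_self_sqrt ha.le
  simp only [circleAxis, inner_add_left, inner_add_right, inner_smul_left, inner_smul_right,
    inner_sphereFrame ha, inner_sphereMap_sphereFrame ha, inner_sphereMap_self ha, hn,
    real_inner_comm (sphereMap a p) (sphereFrame a p n)]
  simp
  field_simp
  linarith

theorem inner_sphereMap_circleAxis {a : ℝ} (ha : 0 < a) (p n : Coord3) :
    inner ℝ (sphereMap a p) (circleAxis a p n) = 1 / (2 * √a) := by
  have hs : 0 < √a := Real.sqrt_pos.2 ha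
  have hsq : √a * √a = a := Real.mul_self_sqrt ha.le
  simp only [circleAxis, inner_add_right, inner_smul_right, inner_sphereMap_sphereFrame ha,
    inner_sphereMap_self ha]
  field_simp
  linarith

/-- The plane section of the sphere of curvature `4a` with the points `q` for which
`⟨q, w⟩ = 1 / (2√a)`, where `⟨w, w⟩ = 2`. -/
theorem exists_isCircle {a : ℝ} (ha : 0 < a) {w : EuclideanSpace ℝ (Fin 3)} (hw : inner ℝ w w = (2 : ℝ)) :
    ∃ C ⊆ Metric.sphere (0 : EuclideanSpace ℝ (Fin 3)) (1 / √(4 * a)),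
      IsCircle C (1 / √(2 * (4 * a))) ∧
      ∀ q, inner ℝ q q = 1 / (4 * a) → inner ℝ q w = 1 / (2 * √a) → q ∈ C := by
  have hs : 0 < √a := Real.sqrt_pos.2 ha
  have hsq : √a ^ 2 = a := Real.sq_sqrt ha.le
  have h2 : (0 : ℝ) < √2 := by positivity
  have h2sq : √2 ^ 2 = (2 : ℝ) := Real.sq_sqrt (by norm_num)
  have hr : (0 : ℝ) < 1 / √(2 * (4 * a)) := by positivity
  have hr2 : (1 / √(2 * (4 * a))) ^ 2 = 1 / (8 * a) := by
    rw [div_pow, Real.sq_sqrt (by positivity)]; ring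
  have hR2 : (1 / √(4 * a)) ^ 2 = 1 / (4 * a) := by
    rw [div_pow, Real.sq_sqrt (by positivity)]; ring
  -- The centre is the point of the line through `w` in the plane `⟨q, w⟩ = 1/(2√a)`, because `⟨w,
  -- w⟩ = 2`. Its squared norm is `1/(8a)`, which leaves `1/(4a) - 1/(8a) = 1/(8a)` for the squared
  -- radius.
  set o := (1 / (4 * √a)) • w with ho
  set v := (1 / √2) • w with hv
  have hnorm : ∀ q : EuclideanSpace ℝ (Fin 3),
      ‖q - o‖ ^ 2 = inner ℝ q q - 1 / (2 * √a) * inner ℝ q w + 1 / (8 * a) := by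
    intro q
    rw [← real_inner_self_eq_norm_sq, ho]
    simp only [inner_sub_left, inner_sub_right, inner_smul_left, inner_smul_right, hw,
      real_inner_comm q w]
    simp
    field_simp
    linear_combination (-32) * hsq
  have hin : ∀ q : EuclideanSpace ℝ (Fin 3),
      inner ℝ (q - o) v = 1 / √2 * (inner ℝ q w - 1 / (2 * √a)) := by
    intro q
    rw [ho, hv]
    simp only [inner_sub_left, inner_smul_left, inner_smul_right, hw]
    simp
    field_simp
    ring
  refine ⟨{q | ‖q - o‖ = 1 / √(2 * (4 * a)) ∧ inner ℝ (q - o) v = 0}, ?_, ⟨hr, o, v, ?_, rfl⟩, ?_⟩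
  · rintro q ⟨hq1, hq2⟩
    have e1 : inner ℝ q w = 1 / (2 * √a) := by
      rw [hin] at hq2
      have := (mul_eq_zero.1 hq2).resolve_left (by positivity)
      linarith
    have e2 := hnorm q
    rw [hq1, hr2, e1] at e2
    have e3 : 1 / (2 * √a) * (1 / (2 * √a)) = 1 / (4 * a) := by
      field_simp
      rw [hsq]
      ring
    rw [e3] at e2
    rw [mem_sphere_zero_iff_norm, ← sq_eq_sq₀ (norm_nonneg _) (by positivity), hR2,
      ← real_inner_self_eq_norm_sq]
    linarith
  · rw [← sq_eq_sq₀ (norm_nonneg _) (by norm_num), ← real_inner_self_eq_norm_sq, hv]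
    simp only [inner_smul_left, inner_smul_right, hw]
    simp
    field_simp
    linarith
  · intro q hq1 hq2
    constructor
    · rw [← sq_eq_sq₀ (norm_nonneg _) hr.le, hr2, hnorm, hq1, hq2]
      field_simp
      rw [hsq]
      ring
    · rw [hin, hq2, sub_self, mul_zero]

namespace Patch

open MetricField

variable {a : ℝ} {X : EuclideanSpace ℝ (Fin 2) → Coord3} {O : Set (EuclideanSpace ℝ (Fin 2))}

/-- The sign `ε` replaces `N` by the normal with respect to which the curvature is `+2√a`. Moving in
direction `v` advances the horizontal projection by `τ = ⟨T, ξ⟩` along `ξ = N × E₃`; a vertical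
direction has `τ = 0`, so all directions follow from `hasDerivAt_circleAxis`. -/
theorem fderiv_circleAxis (h : IsPatch a X O) (ha : 0 < a) {u : EuclideanSpace ℝ (Fin 2)}
    (hu : u ∈ O) (hN2 : normal a 0 X u 2 = 0) {ε κ : ℝ} (hε : ε * ε = 1) (hκ : ε * κ = 2 * √a)
    (hshape : ∀ v, shape a 0 X v u
        = (κ * (tang a 0 X v u ⬝ᵥ ![normal a 0 X u 1, -normal a 0 X u 0, 0]))
          • ![normal a 0 X u 1, -normal a 0 X u 0, 0]) :
    fderiv ℝ (fun x => circleAxis a (X x) (ε • normal a 0 X x)) u = 0 := by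
  have hl := bcvLambda_pos ha (X u)
  have dX := h.contDiffOn.differentiableAt_of_isOpen h.isOpen hu
  have dN := differentiableAt_normal (b := 0) h hu
  have dW : DifferentiableAt ℝ (fun x => circleAxis a (X x) (ε • normal a 0 X x)) u :=
    DifferentiableAt.comp (g := fun q : Coord3 × Coord3 => circleAxis a q.1 q.2) u
      ((contDiff_circleAxis ha).differentiable (by simp) _) (dX.prodMk (dN.const_smul ε))
  have hNN := normal_dot_self (b := 0) h hu
  simp only [dotProduct, Fin.sum_univ_three, hN2] at hNN
  ext1 v
  rw [← dW.lineDeriv_eq_fderiv]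
  apply HasDerivAt.deriv
  set N := normal a 0 X u with hN
  set T := tang a 0 X v u with hT
  set τ := T ⬝ᵥ ![N 1, -N 0, 0] with hτ
  have hTN : N 0 * T 0 + N 1 * T 1 = 0 := by
    have := normal_dot_tang (a := a) (b := 0) (X := X) v u
    simpa [dotProduct, Fin.sum_univ_three, ← hN, ← hT, hN2] using this
  have hτ' : τ = T 0 * N 1 - T 1 * N 0 := by
    rw [hτ]; simp [dotProduct, Fin.sum_univ_three]; ring
  have hT0 : T 0 = τ * N 1 := by
    rw [hτ']; linear_combination (-T 0) * hNN + N 0 * hTN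
  have hT1 : T 1 = -(τ * N 0) := by
    rw [hτ']; linear_combination (-T 1) * hNN + N 1 * hTN
  have hX0 : fderiv ℝ X u v 0 = bcvLambda a (X u) * T 0 := by
    rw [hT, tang, bcvFrame]; simp; field_simp
  have hX1 : fderiv ℝ X u v 1 = bcvLambda a (X u) * T 1 := by
    rw [hT, tang, bcvFrame]; simp; field_simp
  have hdN : ∀ i, fderiv ℝ (normal a 0 X) u v i
      = -(κ * τ * ![N 1, -N 0, 0] i) - (bcvConn a 0 (X u) T ⨯₃ N) i := by
    intro i
    have h1 := congrFun (hshape v) i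
    rw [shape, cov, ← hT, ← hN] at h1
    simp only [Pi.neg_apply, Pi.add_apply, Pi.smul_apply, smul_eq_mul] at h1
    rw [← hτ] at h1
    linarith
  have dx : HasDerivAt (fun t : ℝ => X (u + t • v)) (fderiv ℝ X u v) 0 := dX.hasFDerivAt.hasLineDerivAt v
  have dn : HasDerivAt (fun t : ℝ => ε • normal a 0 X (u + t • v))
      (ε • fderiv ℝ (normal a 0 X) u v) 0 :=
    HasDerivAt.const_smul ε (dN.hasFDerivAt.hasLineDerivAt v)
  refine hasDerivAt_circleAxis (τ := ε * τ) ha dx dn ?_ ?_ ?_ ?_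
  · simp only [zero_smul, add_zero, ← hN, hX0, hT0, Pi.smul_apply, smul_eq_mul]
    linear_combination (-bcvLambda a (X u) * τ * N 1) * hε
  · simp only [zero_smul, add_zero, ← hN, hX1, hT1, Pi.smul_apply, smul_eq_mul]
    linear_combination (bcvLambda a (X u) * τ * N 0) * hε
  · simp only [zero_smul, add_zero, ← hN, Pi.smul_apply, smul_eq_mul, hdN, cross_apply, bcvConn]
    simp [hN2, hT0, hT1, ← hκ]
    linear_combination (κ * τ * N 1 * ε - 2 * a * τ * ε * N 1 * (X u 0 * N 0 + X u 1 * N 1)) * hε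
  · simp only [zero_smul, add_zero, ← hN, Pi.smul_apply, smul_eq_mul, hdN, cross_apply, bcvConn]
    simp [hN2, hT0, hT1, ← hκ]
    linear_combination (-κ * τ * N 0 * ε + 2 * a * τ * ε * N 0 * (X u 0 * N 0 + X u 1 * N 1)) * hε

/-- The circle axis is locally constant along a biharmonic patch that is not totally geodesic. -/
theorem eventually_circleAxis_eq (h : IsPatch a X O) (hB : Biharmonic a 0 X O) (ha : 0 < a)
    {u v₀ : EuclideanSpace ℝ (Fin 2)} (hu : u ∈ O) (hv₀ : sff a 0 X v₀ v₀ u ≠ 0) :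
    ∃ ε : ℝ, ε * ε = 1 ∧ ∀ᶠ x in nhds u, x ∈ O ∧ normal a 0 X x 2 = 0 ∧
      (∀ v, 0 ≤ ε * sff a 0 X v v x) ∧ (∃ v, sff a 0 X v v x ≠ 0) ∧
      circleAxis a (X x) (ε • normal a 0 X x) = circleAxis a (X u) (ε • normal a 0 X u) := by
  have hs : 0 < √a := Real.sqrt_pos.2 ha
  have hab : 4 * a ≠ (0 : ℝ) ^ 2 := by
    have : 0 < 4 * a := by positivity
    simpa using ha.ne'
  -- `ε` is the sign of `II(v₀, v₀)`. It stays valid on a neighbourhood, where it fixes the root `εκ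
  -- = 2√a` of `κ² = 4a`.
  obtain ⟨ε, hε, hpos⟩ : ∃ ε : ℝ, ε * ε = 1 ∧ 0 < ε * sff a 0 X v₀ v₀ u := by
    rcases lt_or_gt_of_ne hv₀ with hlt | hgt
    · exact ⟨-1, by norm_num, by linarith⟩
    · exact ⟨1, by norm_num, by linarith⟩
  have hcont : ContinuousAt (sff a 0 X v₀ v₀) u :=
    ((contDiffOn_sff h v₀ v₀).differentiableAt_of_isOpen h.isOpen hu).continuousAt
  have hev : ∀ᶠ x in nhds u, x ∈ O ∧ 0 < ε * sff a 0 X v₀ v₀ x :=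
    Filter.Eventually.and (h.isOpen.mem_nhds hu)
      (Filter.Tendsto.eventually_const_lt hpos (hcont.const_mul ε))
  have key : ∀ x ∈ O, 0 < ε * sff a 0 X v₀ v₀ x → normal a 0 X x 2 = 0 ∧
      (∀ v, 0 ≤ ε * sff a 0 X v v x) ∧
      fderiv ℝ (fun x => circleAxis a (X x) (ε • normal a 0 X x)) x = 0 := by
    intro x hx hpx
    have hne : sff a 0 X v₀ v₀ x ≠ 0 := fun h0 => by simp [h0] at hpx
    obtain ⟨-, -, hN2, κ, hκ, hshape⟩ := biharmonic_structure h hB hab hx hne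
    have hsff : ∀ v, sff a 0 X v v x
        = κ * (tang a 0 X v x ⬝ᵥ ![normal a 0 X x 1, -normal a 0 X x 0, 0]) ^ 2 := by
      intro v
      rw [sff, hshape v, smul_dotProduct, smul_eq_mul, dotProduct_comm _ (tang a 0 X v x)]
      ring
    have hεκ : 0 < ε * κ := by
      rw [hsff, ← mul_assoc] at hpx
      exact pos_of_mul_pos_left hpx (sq_nonneg _)
    have hεκ' : ε * κ = 2 * √a := by
      rw [← sq_eq_sq₀ hεκ.le (by positivity), mul_pow, mul_pow, Real.sq_sqrt ha.le, hκ]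
      linear_combination (4 * a) * hε
    refine ⟨hN2, fun v => ?_, fderiv_circleAxis h ha hx hN2 hε hεκ' hshape⟩
    rw [hsff, ← mul_assoc]
    positivity
  -- A ball is connected, so a vanishing derivative gives constancy on it.
  obtain ⟨δ, hδ, hball⟩ := Metric.eventually_nhds_iff_ball.1 hev
  refine ⟨ε, hε, ?_⟩
  filter_upwards [Metric.ball_mem_nhds u hδ] with x hx
  obtain ⟨hxO, hpx⟩ := hball x hx
  obtain ⟨h1, h2, -⟩ := key x hxO hpx
  refine ⟨hxO, h1, h2, ⟨v₀, fun h0 => by simp [h0] at hpx⟩, ?_⟩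
  refine Metric.isOpen_ball.is_const_of_fderiv_eq_zero (𝕜 := ℝ) (convex_ball u δ).isPreconnected
    (f := fun x => circleAxis a (X x) (ε • normal a 0 X x)) (fun y hy => ?_) (fun y hy => ?_) hx
    (Metric.mem_ball_self hδ)
  · have hyO := (hball y hy).1
    exact (DifferentiableAt.comp (g := fun q : Coord3 × Coord3 => circleAxis a q.1 q.2) y
      ((contDiff_circleAxis ha).differentiable (by simp) _)
      ((h.contDiffOn.differentiableAt_of_isOpen h.isOpen hyO).prodMk
        ((differentiableAt_normal h hyO).const_smul ε))).differentiableWithinAt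
  · exact (key y (hball y hy).1 (hball y hy).2).2.2

end Patch

/-! ### Globalization and the classification theorem. -/

section Classification

open MetricField Patch

/-- Normalizing an acceleration `s n` leaves `n` with the sign of `s`, and that sign is `ε`. -/
theorem inv_sqrt_smul_smul {n : Coord3} {ε s : ℝ} (hn : n ⬝ᵥ n = 1) (hε : ε * ε = 1)
    (hs : 0 < ε * s) : (√((s • n) ⬝ᵥ (s • n)))⁻¹ • s • n = ε • n := by
  have h1 : (s • n) ⬝ᵥ (s • n) = (ε * s) ^ 2 := by
    simp only [smul_dotProduct, dotProduct_smul, smul_eq_mul, hn]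
    linear_combination (-s ^ 2) * hε
  rw [h1, Real.sqrt_sq hs.le, smul_smul]
  congr 1
  rw [inv_mul_eq_iff_eq_mul₀ hs.ne']
  linear_combination (-s) * hε

variable {M : Type*} [TopologicalSpace M] [ChartedSpace (EuclideanSpace ℝ (Fin 2)) M]
  {a b : ℝ} {φ : M → Coord3}

/-- `w` is the circle axis determined by the acceleration of some geodesic through `m`. -/
def IsAxisAt (a : ℝ) (φ : M → Coord3) (m : M) (w : EuclideanSpace ℝ (Fin 3)) : Prop :=
  ∃ (I : Set ℝ) (c : ℝ → M) (t : ℝ) (A : Coord3), IsOpen I ∧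
    (bcvMetric a 0).IsSurfaceGeodesic φ I c ∧ t ∈ I ∧ c t = m ∧
    A = bcvFrame a 0 (φ (c t)) ((bcvMetric a 0).acceleration (φ ∘ c) t) ∧ A ≠ 0 ∧
    w = circleAxis a (φ m) ((√(A ⬝ᵥ A))⁻¹ • A)

variable [IsManifold (𝓡 2) ∞ M]

theorem exists_sff_ne_zero_of_not_flatAt (hφ : IsImmersion (bcvDomain a) φ) {m : M}
    (hm : ¬ FlatAt a b φ m) : ∃ v, sff a b (chartPatch φ m) v v
      (chartAt (EuclideanSpace ℝ (Fin 2)) m m) ≠ 0 := by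
  rw [flatAt_iff hφ m (mem_chart_source _ m)] at hm
  push Not at hm
  exact hm

/-- All non-zero accelerations at a point are multiples of the normal with one common sign, as `II`
is semidefinite of rank one. So every such geodesic yields the same axis, the locally constant
vector computed in the chart. Both directions matter: uniqueness lets local axes be compared, and
existence says that there is something to compare. -/
theorem eventually_isAxisAt_iff (ha : 0 < a) (hφ : IsImmersion (bcvDomain a) φ)
    (hB : (bcvMetric a 0).TotallyBiharmonic φ) {m₀ : M} (hm₀ : ¬ FlatAt a 0 φ m₀) :
    ∃ w₀ : EuclideanSpace ℝ (Fin 3), inner ℝ w₀ w₀ = (2 : ℝ) ∧ ∀ᶠ m in nhds m₀,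
      inner ℝ (sphereMap a (φ m)) w₀ = 1 / (2 * √a) ∧ ∀ w, IsAxisAt a φ m w ↔ w = w₀ := by
  obtain ⟨v₀, hv₀⟩ := exists_sff_ne_zero_of_not_flatAt hφ hm₀
  have h := isPatch_chartPatch hφ m₀
  have hsrc := mem_chart_source (EuclideanSpace ℝ (Fin 2)) m₀
  have hu := (chartAt (EuclideanSpace ℝ (Fin 2)) m₀).map_source hsrc
  obtain ⟨ε, hε, hev⟩ := eventually_circleAxis_eq h (biharmonic_chartPatch hφ hB m₀) ha hu hv₀
  have hφX : ∀ m ∈ (chartAt (EuclideanSpace ℝ (Fin 2)) m₀).source,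
      chartPatch φ m₀ (chartAt (EuclideanSpace ℝ (Fin 2)) m₀ m) = φ m := fun m hm => by
    rw [chartPatch, (chartAt (EuclideanSpace ℝ (Fin 2)) m₀).left_inv hm]
  refine ⟨_, inner_circleAxis_self ha
    (chartPatch φ m₀ (chartAt (EuclideanSpace ℝ (Fin 2)) m₀ m₀)) (n := ε • normal a 0 (chartPatch φ m₀)
    (chartAt (EuclideanSpace ℝ (Fin 2)) m₀ m₀)) ?_, ?_⟩
  · have h1 := normal_dot_self (b := 0) h hu
    have h2 := hev.self_of_nhds.2.1
    simp only [dotProduct, Fin.sum_univ_three, h2] at h1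
    simp only [Pi.smul_apply, smul_eq_mul]
    linear_combination ε * ε * h1 + hε
  · have hcont := (chartAt (EuclideanSpace ℝ (Fin 2)) m₀).continuousAt hsrc
    filter_upwards [hcont.eventually hev,
      (chartAt (EuclideanSpace ℝ (Fin 2)) m₀).open_source.mem_nhds hsrc] with m hm hms
    obtain ⟨hmO, -, hsgn, ⟨v₁, hv₁⟩, hax⟩ := hm
    have hNN := normal_dot_self (b := 0) h hmO
    rw [← hax, hφX m hms]
    refine ⟨inner_sphereMap_circleAxis ha _ _, fun w => ⟨?_, ?_⟩⟩
    · rintro ⟨I, c, t, A, hI, hc, ht, rfl, hA, hA0, rfl⟩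
      obtain ⟨v, hv⟩ := IsSurfaceGeodesic.frame_acceleration hφ m₀ hI hc ht hms
      rw [← hA] at hv
      have hne : sff a 0 (chartPatch φ m₀) v v (chartAt (EuclideanSpace ℝ (Fin 2)) m₀ (c t)) ≠ 0 := by
        intro h0
        rw [h0, zero_smul] at hv
        exact hA0 hv
      have hε0 : ε ≠ 0 := by rintro rfl; simp at hε
      rw [hv, inv_sqrt_smul_smul hNN hε (lt_of_le_of_ne (hsgn v) (mul_ne_zero hε0 hne).symm)]
    · rintro rfl
      have hv0 : v₁ ≠ 0 := by
        rintro rfl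
        simp [sff, tang_zero] at hv₁
      obtain ⟨r, hr, v, hv, rfl⟩ := exists_unit (b := 0) h hmO hv0
      obtain ⟨I, c, hI, -, hc, h0, hc0, hacc⟩ := exists_surfaceGeodesic hφ m₀ hms hv
      have hne : sff a 0 (chartPatch φ m₀) v v (chartAt (EuclideanSpace ℝ (Fin 2)) m₀ m) ≠ 0 := by
        intro h0
        rw [sff_smul, h0, mul_zero] at hv₁
        exact hv₁ rfl
      have hε0 : ε ≠ 0 := by rintro rfl; simp at hε
      refine ⟨I, c, 0, _, hI, hc, h0, hc0, rfl, ?_, ?_⟩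
      · rw [hacc]
        intro h1
        have := congrArg (fun x => x ⬝ᵥ normal a 0 (chartPatch φ m₀)
          (chartAt (EuclideanSpace ℝ (Fin 2)) m₀ m)) h1
        simp only [zero_dotProduct, smul_dotProduct, hNN, smul_eq_mul, mul_one] at this
        exact hne this
      · rw [hacc, inv_sqrt_smul_smul hNN hε (lt_of_le_of_ne (hsgn v) (mul_ne_zero hε0 hne).symm)]

/-- A nowhere totally geodesic, totally biharmonic surface lies over a circle of the sphere. -/
theorem exists_circle_of_forall_not_flatAt [ConnectedSpace M] (ha : 0 < a)
    (hφ : IsImmersion (bcvDomain a) φ) (hB : (bcvMetric a 0).TotallyBiharmonic φ)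
    (hflat : ∀ m, ¬ FlatAt a 0 φ m) :
    ∃ C ⊆ Metric.sphere (0 : EuclideanSpace ℝ (Fin 3)) (1 / √(4 * a)),
      IsCircle C (1 / √(2 * (4 * a))) ∧ ∀ m, sphereMap a (φ m) ∈ C := by
  choose w hw hev using fun m => eventually_isAxisAt_iff ha hφ hB (hflat m)
  have hloc : IsLocallyConstant w := by
    rw [IsLocallyConstant.iff_eventually_eq]
    intro m₀
    -- The vector `w m` is an axis at `m` by its own neighbourhood; the uniqueness in the
    -- neighbourhood of `m₀` identifies it with `w m₀`.
    filter_upwards [hev m₀] with m hm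
    exact (hm.2 _).1 (((hev m).self_of_nhds.2 _).2 rfl)
  obtain ⟨m₁⟩ := (inferInstance : Nonempty M)
  obtain ⟨C, hCs, hC, hmem⟩ := exists_isCircle ha (hw m₁)
  refine ⟨C, hCs, hC, fun m => hmem _ (inner_sphereMap_self ha _) ?_⟩
  rw [hloc.apply_eq_of_preconnectedSpace m₁ m]
  exact (hev m).self_of_nhds.1

theorem totallyGeodesic_or_exists_circle [ConnectedSpace M] (hab : 4 * a ≠ b ^ 2)
    (hφ : IsImmersion (bcvDomain a) φ) (hB : (bcvMetric a b).TotallyBiharmonic φ) :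
    (bcvMetric a b).TotallyGeodesic φ ∨ (0 < a ∧ b = 0 ∧
      ∃ F, IsIsometryOntoSphereTimesLine a b (4 * a) F ∧
        ∃ C ⊆ Metric.sphere (0 : EuclideanSpace ℝ (Fin 3)) (1 / √(4 * a)),
          IsCircle C (1 / √(2 * (4 * a))) ∧ ∀ m, F (φ m) ∈ C ×ˢ (Set.univ : Set ℝ)) := by
  rcases isClopen_iff.1 (isClopen_setOf_flatAt hφ hB hab) with h0 | h1
  · right
    have hflat : ∀ m, ¬ FlatAt a b φ m := fun m hm => by
      have : m ∈ {m | FlatAt a b φ m} := hm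
      rw [h0] at this
      exact this
    obtain ⟨m₁⟩ := (inferInstance : Nonempty M)
    -- A single point that is not totally geodesic already forces `b = 0` and `a > 0`.
    obtain ⟨v₀, hv₀⟩ := exists_sff_ne_zero_of_not_flatAt hφ (hflat m₁)
    obtain ⟨rfl, ha, -⟩ := biharmonic_structure (isPatch_chartPatch hφ m₁)
      (biharmonic_chartPatch hφ hB m₁) hab
      ((chartAt (EuclideanSpace ℝ (Fin 2)) m₁).map_source (mem_chart_source _ m₁)) hv₀
    obtain ⟨C, hCs, hC, hmem⟩ := exists_circle_of_forall_not_flatAt ha hφ hB hflat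
    exact ⟨ha, rfl, sphereLineMap a, isIsometryOntoSphereTimesLine_sphereLineMap ha, C, hCs, hC,
      fun m => ⟨hmem m, trivial⟩⟩
  · left
    intro I c hI hI' hc t ht
    have : c t ∈ {m | FlatAt a b φ m} := by rw [h1]; trivial
    exact this I c hI hI' hc t ht rfl

end Classification

/-! ### Surfaces parametrized by the whole plane. -/

section ModelSurface

open MetricField Patch

variable {a b : ℝ} {X : EuclideanSpace ℝ (Fin 2) → Coord3}

theorem isImmersion_of_isPatch_univ (h : IsPatch a X Set.univ) : IsImmersion (bcvDomain a) X := by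
  refine ⟨(contDiffOn_univ.1 h.contDiffOn).contMDiff, fun q => h.mem q trivial, fun q => ?_⟩
  rw [mfderiv_eq_fderiv]
  exact h.inj q trivial

theorem isGeodesic_of_isSurfaceGeodesic (h : IsPatch a X Set.univ) {I : Set ℝ}
    {c : ℝ → EuclideanSpace ℝ (Fin 2)} (hI : IsOpen I)
    (hc : (bcvMetric a b).IsSurfaceGeodesic X I c) : IsGeodesic a b X Set.univ I c := by
  have hcd : ContDiffOn ℝ ∞ c I := hc.1.contDiffOn
  have hm : ∀ t ∈ I, c t ∈ Set.univ := fun _ _ => trivial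
  have hv : ∀ t ∈ I, bcvFrame a b (X (c t)) (deriv (X ∘ c) t) = tang a b X (deriv c t) (c t) :=
    fun t ht => frameVel_comp h (hcd.differentiableAt_of_isOpen hI ht) trivial
  refine ⟨hI, hcd, hm, fun t ht => ?_, fun t ht => ?_⟩
  · have := (hc.2 t ht).1
    rwa [bcvMetric_inner, hv t ht] at this
  · set z : EuclideanSpace ℝ (Fin 2) := deriv (deriv c) t + gam a b X (deriv c t) (deriv c t) (c t) with hz
    have h1 : (bcvMetric a b).inner (X (c t)) ((bcvMetric a b).acceleration (X ∘ c) t)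
        (fderiv ℝ X (c t) z) = 0 := by
      have := (hc.2 t ht).2 z
      rw [mfderiv_eq_fderiv] at this
      exact this
    have h2 := bcvFrame_acceleration (b := b) hI (IsPatch.contDiffOn_comp h hcd hm)
      (fun s hs => h.mem _ (hm s hs)) ht
    rw [frameDeriv_frameVel h hI hcd hm ht, ← hz] at h2
    have h3 : bcvFrame a b (X (c t)) (fderiv ℝ X (c t) z) = tang a b X z (c t) := rfl
    rw [Function.comp_apply] at h2
    rw [bcvMetric_inner, h3, h2, add_dotProduct, smul_dotProduct, normal_dot_tang, smul_zero, add_zero] at h1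
    exact eq_neg_of_add_eq_zero_left
      (tang_eq_zero (b := b) h (Set.mem_univ (c t)) (dotProduct_self_eq_zero.1 h1))

theorem isSurfaceGeodesic_of_isGeodesic_univ (h : IsPatch a X Set.univ) {I : Set ℝ}
    {c : ℝ → EuclideanSpace ℝ (Fin 2)} (hc : IsGeodesic a b X Set.univ I c) :
    (bcvMetric a b).IsSurfaceGeodesic X I c :=
  -- The chart of the model plane at any point is the identity, so the chart expression unfolds to
  -- `X`; the base point `0` is arbitrary.
  isSurfaceGeodesic_of_isGeodesic (b := b) (isImmersion_of_isPatch_univ h) 0 hc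

end ModelSurface

/-! ### Geometry and bitension of Hopf cylinders. -/

section HopfCylinder

open MetricField Patch

variable {a r : ℝ}

/-- The parameter angle of a rotational Hopf cylinder. -/
def hopfAngle (a r : ℝ) (q : EuclideanSpace ℝ (Fin 2)) : ℝ := (1 + a * r ^ 2) / r * q 0

/-- The geodesic curvature of the base circle of a rotational Hopf cylinder. -/
def hopfCurv (a r : ℝ) : ℝ := -((1 - a * r ^ 2) / r)

theorem bcvLambda_hopfCylinder (q : EuclideanSpace ℝ (Fin 2)) :
    bcvLambda a (hopfCylinder a r q) = 1 + a * r ^ 2 := by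
  simp only [bcvLambda, hopfCylinder, Matrix.cons_val_zero, Matrix.cons_val_one]
  linear_combination a * r ^ 2 * Real.sin_sq_add_cos_sq ((1 + a * r ^ 2) / r * q 0)

theorem hasFDerivAt_hopfAngle (q : EuclideanSpace ℝ (Fin 2)) :
    HasFDerivAt (hopfAngle a r)
      (((1 + a * r ^ 2) / r) • (EuclideanSpace.proj 0 : EuclideanSpace ℝ (Fin 2) →L[ℝ] ℝ)) q :=
  (EuclideanSpace.proj (𝕜 := ℝ) (0 : Fin 2)).hasFDerivAt.const_mul _

theorem contDiff_hopfCylinder : ContDiff ℝ ∞ (hopfCylinder a r) := by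
  have h : ∀ i, ContDiff ℝ ∞ fun q : EuclideanSpace ℝ (Fin 2) => q i := fun i =>
    (EuclideanSpace.proj (𝕜 := ℝ) i).contDiff
  have hθ : ContDiff ℝ ∞ fun q : EuclideanSpace ℝ (Fin 2) => (1 + a * r ^ 2) / r * q 0 :=
    contDiff_const.mul (h 0)
  rw [contDiff_pi]
  intro i
  fin_cases i
  · exact contDiff_const.mul hθ.sin
  · exact (contDiff_const.mul hθ.cos).neg
  · exact h 1

theorem fderiv_cons_three {f₀ f₁ f₂ : EuclideanSpace ℝ (Fin 2) → ℝ}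
    {f₀' f₁' f₂' : EuclideanSpace ℝ (Fin 2) →L[ℝ] ℝ} {q : EuclideanSpace ℝ (Fin 2)}
    (h₀ : HasFDerivAt f₀ f₀' q) (h₁ : HasFDerivAt f₁ f₁' q) (h₂ : HasFDerivAt f₂ f₂' q)
    (v : EuclideanSpace ℝ (Fin 2)) :
    fderiv ℝ (fun q => (![f₀ q, f₁ q, f₂ q] : Coord3)) q v = ![f₀' v, f₁' v, f₂' v] := by
  have h : HasFDerivAt (fun q => (![f₀ q, f₁ q, f₂ q] : Coord3))
      (ContinuousLinearMap.pi ![f₀', f₁', f₂']) q := by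
    rw [hasFDerivAt_pi']
    intro i
    fin_cases i
    · exact h₀
    · exact h₁
    · exact h₂
  rw [h.fderiv]
  ext i
  fin_cases i <;> rfl

/-- The derivative of a field that rotates with the parameter angle. -/
theorem fderiv_rotating (x y z : ℝ) (q v : EuclideanSpace ℝ (Fin 2)) :
    fderiv ℝ (fun q => (![x * Real.cos (hopfAngle a r q) + y * Real.sin (hopfAngle a r q),
      x * Real.sin (hopfAngle a r q) - y * Real.cos (hopfAngle a r q), z] : Coord3)) q v
      = ((1 + a * r ^ 2) / r * v 0) • ![y * Real.cos (hopfAngle a r q) - x * Real.sin (hopfAngle a r q),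
        y * Real.sin (hopfAngle a r q) + x * Real.cos (hopfAngle a r q), 0] := by
  have hc := (hasFDerivAt_hopfAngle (a := a) (r := r) q).cos
  have hs := (hasFDerivAt_hopfAngle (a := a) (r := r) q).sin
  refine (fderiv_cons_three ((hc.const_mul x).add (hs.const_mul y))
    ((hs.const_mul x).sub (hc.const_mul y)) (hasFDerivAt_const z q) v).trans ?_
  ext i
  fin_cases i <;> simp <;> ring

theorem fderiv_hopfCylinder (hr : r ≠ 0) (q v : EuclideanSpace ℝ (Fin 2)) :
    fderiv ℝ (hopfCylinder a r) q v
      = ![(1 + a * r ^ 2) * v 0 * Real.cos (hopfAngle a r q),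
        (1 + a * r ^ 2) * v 0 * Real.sin (hopfAngle a r q), v 1] := by
  have hc := (hasFDerivAt_hopfAngle (a := a) (r := r) q).cos
  have hs := (hasFDerivAt_hopfAngle (a := a) (r := r) q).sin
  refine (fderiv_cons_three (hs.const_mul r) (hc.const_mul r).neg
    (EuclideanSpace.proj (𝕜 := ℝ) (1 : Fin 2)).hasFDerivAt v).trans ?_
  ext i
  fin_cases i
  · simp; field_simp
  · simp; field_simp
  · simp

theorem tang_hopfCylinder (ha : 0 < a) (hr : r ≠ 0) (v q : EuclideanSpace ℝ (Fin 2)) :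
    tang a 0 (hopfCylinder a r) v q
      = ![v 0 * Real.cos (hopfAngle a r q), v 0 * Real.sin (hopfAngle a r q), v 1] := by
  have hl : 1 + a * r ^ 2 ≠ 0 := by positivity
  rw [tang, fderiv_hopfCylinder hr, bcvFrame, bcvLambda_hopfCylinder]
  ext i
  fin_cases i
  · simp; field_simp
  · simp; field_simp
  · simp

theorem isPatch_hopfCylinder (ha : 0 < a) (hr : r ≠ 0) :
    IsPatch a (hopfCylinder a r) Set.univ where
  isOpen := isOpen_univ
  contDiffOn := contDiff_hopfCylinder.contDiffOn
  mem := fun _ _ => bcvLambda_pos ha _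
  inj := fun q _ => by
    have hl : 1 + a * r ^ 2 ≠ 0 := by positivity
    rw [injective_iff_map_eq_zero]
    intro v hv
    rw [fderiv_hopfCylinder hr] at hv
    have h0 := congrFun hv 0
    have h1 := congrFun hv 1
    have h2 := congrFun hv 2
    simp at h0 h1 h2
    have hcs := Real.sin_sq_add_cos_sq (hopfAngle a r q)
    have h3 : v 0 = 0 := by
      by_contra hv0
      have hc := (h0.resolve_left (not_or.2 ⟨hl, hv0⟩))
      have hs := (h1.resolve_left (not_or.2 ⟨hl, hv0⟩))
      rw [hc, hs] at hcs
      norm_num at hcs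
    ext i
    fin_cases i
    · simpa using h3
    · simpa using h2

theorem normal_hopfCylinder (ha : 0 < a) (hr : r ≠ 0) (q : EuclideanSpace ℝ (Fin 2)) :
    normal a 0 (hopfCylinder a r) q
      = ![Real.sin (hopfAngle a r q), -Real.cos (hopfAngle a r q), 0] := by
  have hcs := Real.sin_sq_add_cos_sq (hopfAngle a r q)
  have h1 : rawNormal a 0 (hopfCylinder a r) q
      = ![Real.sin (hopfAngle a r q), -Real.cos (hopfAngle a r q), 0] := by
    rw [rawNormal, tang_hopfCylinder ha hr, tang_hopfCylinder ha hr]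
    ext i
    fin_cases i <;> simp [cross_apply]
  have h2 : rawNormal a 0 (hopfCylinder a r) q ⬝ᵥ rawNormal a 0 (hopfCylinder a r) q = 1 := by
    rw [h1]
    simp [dotProduct, Fin.sum_univ_three]
    linarith
  rw [normal, h2, h1]
  simp

/-- The covariant derivative of a field that rotates with the parameter angle. -/
theorem cov_rotating (ha : 0 < a) (hr : r ≠ 0) (x y z : ℝ) (v q : EuclideanSpace ℝ (Fin 2)) :
    cov a 0 (hopfCylinder a r) v
      (fun q => (![x * Real.cos (hopfAngle a r q) + y * Real.sin (hopfAngle a r q),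
        x * Real.sin (hopfAngle a r q) - y * Real.cos (hopfAngle a r q), z] : Coord3)) q
      = (-hopfCurv a r * v 0) •
        ![y * Real.cos (hopfAngle a r q) - x * Real.sin (hopfAngle a r q),
        y * Real.sin (hopfAngle a r q) + x * Real.cos (hopfAngle a r q), 0] := by
  have hcs := Real.sin_sq_add_cos_sq (hopfAngle a r q)
  -- The coordinate rotation rate `(1 + ar²)/r` and the connection rate `-2ar` add up to `(1 -
  -- ar²)/r = -k`.
  have hconn : bcvConn a 0 (hopfCylinder a r q) (tang a 0 (hopfCylinder a r) v q)
      = ![0, 0, -(2 * a * r * v 0)] := by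
    rw [tang_hopfCylinder ha hr, bcvConn]
    ext i
    fin_cases i
    · simp
    · simp
    · have h0 : hopfCylinder a r q 0 = r * Real.sin (hopfAngle a r q) := rfl
      have h1 : hopfCylinder a r q 1 = -(r * Real.cos (hopfAngle a r q)) := rfl
      simp only [h0, h1]
      simp
      linear_combination (-(2 * a * r * v 0)) * hcs
  rw [cov, fderiv_rotating, hconn, hopfCurv]
  ext i
  fin_cases i
  · simp [cross_apply]; field_simp; ring
  · simp [cross_apply]; field_simp; ring
  · simp [cross_apply]

theorem shape_hopfCylinder (ha : 0 < a) (hr : r ≠ 0) (v q : EuclideanSpace ℝ (Fin 2)) :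
    shape a 0 (hopfCylinder a r) v q
      = ![hopfCurv a r * v 0 * Real.cos (hopfAngle a r q),
        hopfCurv a r * v 0 * Real.sin (hopfAngle a r q), 0] := by
  have hN : normal a 0 (hopfCylinder a r) = fun q =>
      ![0 * Real.cos (hopfAngle a r q) + 1 * Real.sin (hopfAngle a r q),
        0 * Real.sin (hopfAngle a r q) - 1 * Real.cos (hopfAngle a r q), 0] := by
    ext1 q
    rw [normal_hopfCylinder ha hr]
    simp
  rw [shape, hN, cov_rotating ha hr]
  ext i
  fin_cases i <;> simp

theorem sff_hopfCylinder (ha : 0 < a) (hr : r ≠ 0) (v w q : EuclideanSpace ℝ (Fin 2)) :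
    sff a 0 (hopfCylinder a r) v w q = hopfCurv a r * v 0 * w 0 := by
  have hcs := Real.sin_sq_add_cos_sq (hopfAngle a r q)
  rw [sff, shape_hopfCylinder ha hr, tang_hopfCylinder ha hr]
  simp [dotProduct, Fin.sum_univ_three]
  linear_combination (hopfCurv a r * v 0 * w 0) * hcs

/-- The derivatives of the coordinate tangent fields are multiples of the normal. So the cylinder is
flat in these parameters and its geodesics are affine. -/
theorem gam_hopfCylinder (ha : 0 < a) (hr : r ≠ 0) (v w q : EuclideanSpace ℝ (Fin 2)) :
    gam a 0 (hopfCylinder a r) v w q = 0 := by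
  have hT : tang a 0 (hopfCylinder a r) w = fun q =>
      ![w 0 * Real.cos (hopfAngle a r q) + 0 * Real.sin (hopfAngle a r q),
        w 0 * Real.sin (hopfAngle a r q) - 0 * Real.cos (hopfAngle a r q), w 1] := by
    ext1 q
    rw [tang_hopfCylinder ha hr]
    simp
  rw [gam, hT, cov_rotating ha hr, proj, tang_hopfCylinder ha hr, tang_hopfCylinder ha hr]
  simp [dotProduct, Fin.sum_univ_three]
  ring_nf
  simp

theorem cov_shape_hopfCylinder (ha : 0 < a) (hr : r ≠ 0) (v q : EuclideanSpace ℝ (Fin 2)) :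
    cov a 0 (hopfCylinder a r) v (shape a 0 (hopfCylinder a r) v) q
      = (hopfCurv a r ^ 2 * v 0 ^ 2) • normal a 0 (hopfCylinder a r) q := by
  have hS : shape a 0 (hopfCylinder a r) v = fun q =>
      ![hopfCurv a r * v 0 * Real.cos (hopfAngle a r q) + 0 * Real.sin (hopfAngle a r q),
        hopfCurv a r * v 0 * Real.sin (hopfAngle a r q) - 0 * Real.cos (hopfAngle a r q), 0] := by
    ext1 q
    rw [shape_hopfCylinder ha hr]
    simp
  rw [hS, cov_rotating ha hr, normal_hopfCylinder ha hr]
  ext i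
  fin_cases i
  · simp; ring
  · simp; ring
  · simp

/-- As `s'` is constant along a geodesic, the normal curvature `k s'²` is constant too. What remains
is `-k s'²` times `∇_T(AT) + G(N × T) × T`, and the two terms contribute `k² s'² N` and `-4a s'² N`.
-/
theorem bitension_hopfCylinder (ha : 0 < a) (hr : r ≠ 0) {I : Set ℝ}
    {c : ℝ → EuclideanSpace ℝ (Fin 2)} (hc : IsGeodesic a 0 (hopfCylinder a r) Set.univ I c) {t : ℝ}
    (ht : t ∈ I) :
    bcvFrame a 0 (hopfCylinder a r (c t)) ((bcvMetric a 0).bitension (hopfCylinder a r ∘ c) t)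
      = -(hopfCurv a r * (hopfCurv a r ^ 2 - 4 * a) * deriv c t 0 ^ 4)
        • normal a 0 (hopfCylinder a r) (c t) := by
  have h := isPatch_hopfCylinder ha hr
  have hcs := Real.sin_sq_add_cos_sq (hopfAngle a r (c t))
  have hcurv : IsGeodesic.curv a 0 (hopfCylinder a r) c = fun s => hopfCurv a r * deriv c s 0 * deriv c s 0 := by
    ext1 s
    exact sff_hopfCylinder ha hr _ _ _
  have hk : ∀ s ∈ I, HasDerivAt (fun s => deriv c s 0) 0 s := fun s hs => by
    have h1 : HasDerivAt (deriv c) (deriv (deriv c) s) s :=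
      ((contDiffOn_deriv hc.isOpen hc.contDiffOn).differentiableAt_of_isOpen hc.isOpen hs).hasDerivAt
    have h2 := (EuclideanSpace.proj (𝕜 := ℝ) (0 : Fin 2)).hasFDerivAt.comp_hasDerivAt s h1
    rw [hc.eqn s hs, gam_hopfCylinder ha hr] at h2
    refine h2.congr_deriv ?_
    simp
  have hd : ∀ s ∈ I, deriv (IsGeodesic.curv a 0 (hopfCylinder a r) c) s = 0 := fun s hs => by
    rw [hcurv]
    refine (((hk s hs).const_mul _).mul (hk s hs)).deriv.trans ?_
    simp
  have hd2 : deriv (deriv (IsGeodesic.curv a 0 (hopfCylinder a r) c)) t = 0 := by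
    have : deriv (IsGeodesic.curv a 0 (hopfCylinder a r) c) =ᶠ[nhds t] fun _ => 0 := by
      filter_upwards [hc.isOpen.mem_nhds ht] with s hs using hd s hs
    rw [this.deriv_eq]
    simp
  rw [IsGeodesic.bitension_eq h hc ht, hd2, hd t ht, IsGeodesic.frameDeriv_shape h hc ht,
    gam_hopfCylinder ha hr, cov_shape_hopfCylinder ha hr, hcurv, shape_hopfCylinder ha hr,
    shape_hopfCylinder ha hr, tang_hopfCylinder ha hr, normal_hopfCylinder ha hr]
  ext i
  fin_cases i
  · simp [bcvCurv, cross_apply]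
    linear_combination (-4 * a * hopfCurv a r * deriv c t 0 ^ 4 * Real.sin (hopfAngle a r (c t))) * hcs
  · simp [bcvCurv, cross_apply]
    linear_combination (-4 * a * hopfCurv a r * deriv c t 0 ^ 4 * Real.cos (hopfAngle a r (c t))) * hcs
  · simp [bcvCurv, cross_apply]

end HopfCylinder

/-! ### The two biharmonic radii and their congruence. -/

section HopfTheorem

open MetricField Patch

variable {a r : ℝ}

theorem acceleration_hopfCylinder (ha : 0 < a) (hr : r ≠ 0) {I : Set ℝ}
    {c : ℝ → EuclideanSpace ℝ (Fin 2)} (hI : IsOpen I) (hc : ContDiffOn ℝ ∞ c I) {t : ℝ} (ht : t ∈ I)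
    (h0 : deriv (deriv c) t = 0) :
    bcvFrame a 0 (hopfCylinder a r (c t)) ((bcvMetric a 0).acceleration (hopfCylinder a r ∘ c) t)
      = (hopfCurv a r * deriv c t 0 ^ 2) • normal a 0 (hopfCylinder a r) (c t) := by
  have h := isPatch_hopfCylinder ha hr
  have hm : ∀ s ∈ I, c s ∈ Set.univ := fun _ _ => trivial
  have h1 := bcvFrame_acceleration (b := 0) hI (IsPatch.contDiffOn_comp h hc hm)
    (fun s hs => h.mem _ (hm s hs)) ht
  rw [frameDeriv_frameVel h hI hc hm ht, h0, gam_hopfCylinder ha hr, add_zero, tang_zero, zero_add,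
    sff_hopfCylinder ha hr] at h1
  rw [← Function.comp_apply (f := hopfCylinder a r), h1]
  congr 1
  ring

theorem deriv_smul_line (q v : EuclideanSpace ℝ (Fin 2)) :
    deriv (fun t : ℝ => q + t • v) = fun _ => v := by
  ext1 t
  refine HasDerivAt.deriv ?_
  simpa using ((hasDerivAt_id t).smul_const v).const_add q

/-- This base circle has `s' = 1`, so as a single test curve it decides the converse directions for
both the acceleration and the bitension. -/
theorem isGeodesic_hopfCylinder_circle (ha : 0 < a) (hr : r ≠ 0) :
    IsGeodesic a 0 (hopfCylinder a r) Set.univ Set.univ (fun t => 0 + t • e 0) where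
  isOpen := isOpen_univ
  contDiffOn := (contDiff_const.add (contDiff_id.smul contDiff_const)).contDiffOn
  mem := fun _ _ => trivial
  unit := fun t _ => by
    rw [deriv_smul_line, tang_hopfCylinder ha hr]
    simp [dotProduct, Fin.sum_univ_three]
    linarith [Real.sin_sq_add_cos_sq (hopfAngle a r (t • e 0))]
  eqn := fun t _ => by
    rw [gam_hopfCylinder ha hr, deriv_smul_line]
    simp

theorem normal_hopfCylinder_ne_zero (ha : 0 < a) (hr : r ≠ 0) (q : EuclideanSpace ℝ (Fin 2)) :
    normal a 0 (hopfCylinder a r) q ≠ 0 := fun h0 => by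
  have := normal_dot_self (b := 0) (isPatch_hopfCylinder ha hr) (Set.mem_univ q)
  rw [h0] at this
  simp at this

theorem totallyGeodesic_hopfCylinder_iff (ha : 0 < a) (hr : r ≠ 0) :
    (bcvMetric a 0).TotallyGeodesic (hopfCylinder a r) ↔ hopfCurv a r = 0 := by
  have h := isPatch_hopfCylinder ha hr
  constructor
  · intro hT
    have hc := isGeodesic_hopfCylinder_circle ha hr
    have h1 := acceleration_hopfCylinder ha hr hc.isOpen hc.contDiffOn (Set.mem_univ 0)
      (by rw [deriv_smul_line]; simp)
    rw [hT _ _ hc.isOpen Set.ordConnected_univ (isSurfaceGeodesic_of_isGeodesic_univ h hc) 0 trivial,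
      (bcvFrame_eq_zero (bcvLambda_pos ha _).ne').2 rfl, deriv_smul_line] at h1
    simpa using (smul_eq_zero.1 h1.symm).resolve_right (normal_hopfCylinder_ne_zero ha hr _)
  · intro hk I c hI _ hc t ht
    have hg := isGeodesic_of_isSurfaceGeodesic h hI hc
    have h1 := acceleration_hopfCylinder ha hr hI hg.contDiffOn ht
      (by rw [hg.eqn t ht, gam_hopfCylinder ha hr, neg_zero])
    rw [hk, zero_mul, zero_smul] at h1
    exact (bcvFrame_eq_zero (bcvLambda_pos ha _).ne').1 h1

theorem totallyBiharmonic_hopfCylinder_iff (ha : 0 < a) (hr : r ≠ 0) :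
    (bcvMetric a 0).TotallyBiharmonic (hopfCylinder a r)
      ↔ hopfCurv a r = 0 ∨ hopfCurv a r ^ 2 = 4 * a := by
  have h := isPatch_hopfCylinder ha hr
  constructor
  · intro hT
    have hc := isGeodesic_hopfCylinder_circle ha hr
    have h1 := bitension_hopfCylinder ha hr hc (Set.mem_univ 0)
    rw [hT _ _ hc.isOpen Set.ordConnected_univ (isSurfaceGeodesic_of_isGeodesic_univ h hc) 0 trivial,
      (bcvFrame_eq_zero (bcvLambda_pos ha _).ne').2 rfl, deriv_smul_line] at h1
    have h2 := (smul_eq_zero.1 h1.symm).resolve_right (normal_hopfCylinder_ne_zero ha hr _)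
    simpa [sub_eq_zero] using h2
  · intro hk I c hI _ hc t ht
    have h1 := bitension_hopfCylinder ha hr (isGeodesic_of_isSurfaceGeodesic h hI hc) ht
    have h2 : hopfCurv a r * (hopfCurv a r ^ 2 - 4 * a) = 0 := by
      rcases hk with hk | hk <;> simp [hk]
    rw [h2, zero_mul, neg_zero, zero_smul] at h1
    exact (bcvFrame_eq_zero (bcvLambda_pos ha _).ne').1 h1

/-- The equation `(1 - ar²)² = 4ar²` is `(ar²)² - 6ar² + 1 = 0`, with roots `3 ± 2√2`. -/
theorem hopfCurv_sq_eq_iff (ha : 0 < a) (hr : 0 < r) :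
    hopfCurv a r ^ 2 = 4 * a ↔ r ^ 2 = (3 + 2 * √2) / a ∨ r ^ 2 = (3 - 2 * √2) / a := by
  have h2 : √2 ^ 2 = (2 : ℝ) := Real.sq_sqrt (by norm_num)
  have key : hopfCurv a r ^ 2 = 4 * a
      ↔ (r ^ 2 * a - (3 + 2 * √2)) * (r ^ 2 * a - (3 - 2 * √2)) = 0 := by
    rw [hopfCurv, neg_sq, div_pow, div_eq_iff (by positivity)]
    constructor <;> intro h3
    · linear_combination h3 - 4 * h2
    · linear_combination h3 + 4 * h2
  rw [key, mul_eq_zero, sub_eq_zero, sub_eq_zero, eq_div_iff ha.ne', eq_div_iff ha.ne']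

theorem hopfCylinder_biharmonic_iff (ha : 0 < a) (hr : 0 < r) :
    (bcvMetric a 0).TotallyBiharmonic (hopfCylinder a r) ∧
        ¬ (bcvMetric a 0).TotallyGeodesic (hopfCylinder a r) ↔
      r ^ 2 = (3 + 2 * √2) / a ∨ r ^ 2 = (3 - 2 * √2) / a := by
  rw [totallyBiharmonic_hopfCylinder_iff ha hr.ne', totallyGeodesic_hopfCylinder_iff ha hr.ne',
    ← hopfCurv_sq_eq_iff ha hr]
  constructor
  · rintro ⟨h1, h2⟩
    exact h1.resolve_left h2
  · intro h1
    refine ⟨Or.inr h1, fun h2 => ?_⟩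
    rw [h2] at h1
    norm_num at h1
    exact ha.ne' h1

theorem bcvFrame_hopfNormal (ha : 0 < a) (hr : r ≠ 0) (q : EuclideanSpace ℝ (Fin 2)) :
    bcvFrame a 0 (hopfCylinder a r q) (hopfNormal a r q) = normal a 0 (hopfCylinder a r) q := by
  have hl : 1 + a * r ^ 2 ≠ 0 := by positivity
  rw [normal_hopfCylinder ha hr, bcvFrame, bcvLambda_hopfCylinder]
  ext i
  fin_cases i
  · simp [hopfNormal, hopfAngle, hl]
  · simp [hopfNormal, hopfAngle]; field_simp
  · simp [hopfNormal]

theorem isUnitNormal_hopfNormal (ha : 0 < a) (hr : r ≠ 0) :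
    (bcvMetric a 0).IsUnitNormal (hopfCylinder a r) (hopfNormal a r) := by
  intro q
  simp only [bcvMetric_inner, bcvFrame_hopfNormal ha hr]
  refine ⟨normal_dot_self (isPatch_hopfCylinder ha hr) (Set.mem_univ q), fun v => ?_⟩
  rw [dotProduct_comm]
  exact normal_dot_tang v q

theorem firstForm_hopfCylinder (ha : 0 < a) (hr : r ≠ 0) (q v : EuclideanSpace ℝ (Fin 2)) :
    (bcvMetric a 0).firstForm (hopfCylinder a r) q v = v 0 ^ 2 + v 1 ^ 2 := by
  have h1 : bcvFrame a 0 (hopfCylinder a r q) (fderiv ℝ (hopfCylinder a r) q v)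
    = tang a 0 (hopfCylinder a r) v q := rfl
  rw [firstForm, bcvMetric_inner, h1, tang_hopfCylinder ha hr]
  simp [dotProduct, Fin.sum_univ_three]
  linear_combination v 0 ^ 2 * Real.sin_sq_add_cos_sq (hopfAngle a r q)

theorem secondForm_hopfCylinder (ha : 0 < a) (hr : r ≠ 0) (q v : EuclideanSpace ℝ (Fin 2)) :
    (bcvMetric a 0).secondForm (hopfCylinder a r) (hopfNormal a r) q v = hopfCurv a r * v 0 ^ 2 := by
  have h1 := acceleration_hopfCylinder ha hr (c := fun t => q + t • v) isOpen_univ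
    (contDiff_const.add (contDiff_id.smul contDiff_const)).contDiffOn (Set.mem_univ 0)
    (by rw [deriv_smul_line]; simp)
  simp only [deriv_smul_line, zero_smul, add_zero] at h1
  rw [secondForm, bcvMetric_inner, bcvFrame_hopfNormal ha hr]
  refine (congrArg (fun x => x ⬝ᵥ normal a 0 (hopfCylinder a r) q) h1).trans ?_
  simp only [smul_dotProduct, normal_dot_self (isPatch_hopfCylinder ha hr) (Set.mem_univ q),
    smul_eq_mul, mul_one]

/-- The reflection of `ℝ³` in the plane `z = 0`. -/
def reflectThird : EuclideanSpace ℝ (Fin 3) ≃ₗᵢ[ℝ] EuclideanSpace ℝ (Fin 3) :=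
  LinearIsometryEquiv.piLpCongrRight 2 fun i =>
    if i = 2 then LinearIsometryEquiv.neg ℝ else LinearIsometryEquiv.refl ℝ ℝ

theorem reflectThird_apply (q : EuclideanSpace ℝ (Fin 3)) :
    reflectThird q = !₂[q 0, q 1, -q 2] := by
  ext i
  fin_cases i <;> simp [reflectThird]

/-- `r' = 1/(ar)` is the inversion in the circle of radius `1/√a`, the preimage of the equator. The
identities say that it keeps the angular speed and the distance from the axis in `ℝ³`, and reverses
the height and the curvature. -/
theorem hopfCylinder_inversion {r' : ℝ} (ha : 0 < a) (hr : 0 < r) (hr' : 0 < r')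
    (h : a * r * r' = 1) :
    (1 + a * r' ^ 2) / r' = (1 + a * r ^ 2) / r ∧ r' / (1 + a * r' ^ 2) = r / (1 + a * r ^ 2) ∧
      1 / (1 + a * r' ^ 2) = 1 - 1 / (1 + a * r ^ 2) ∧ hopfCurv a r' = -hopfCurv a r := by
  obtain rfl : r' = 1 / (a * r) := by field_simp; linarith
  have hl : 1 + a * r ^ 2 ≠ 0 := by positivity
  have h1 : (1 + a * (1 / (a * r)) ^ 2) / (1 / (a * r)) = (1 + a * r ^ 2) / r := by
    field_simp; ring
  refine ⟨h1, ?_, ?_, ?_⟩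
  · rw [← inv_div, h1, inv_div]
  · have : 1 + a * (1 / (a * r)) ^ 2 = (1 + a * r ^ 2) / (a * r ^ 2) := by field_simp; ring
    rw [this]
    field_simp
    ring
  · rw [hopfCurv, hopfCurv]
    field_simp
    ring

theorem reflectThird_sphereLineMap {r' : ℝ} (ha : 0 < a) (hr : 0 < r) (hr' : 0 < r')
    (h : a * r * r' = 1) (q : EuclideanSpace ℝ (Fin 2)) :
    Prod.map reflectThird id (sphereLineMap a (hopfCylinder a r q))
      = sphereLineMap a (hopfCylinder a r' q) := by
  have hs : 0 < √a := Real.sqrt_pos.2 ha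
  obtain ⟨h1, h2, h3, -⟩ := hopfCylinder_inversion ha hr hr' h
  refine Prod.ext ?_ rfl
  rw [Prod.map_fst]
  simp only [sphereLineMap, reflectThird_apply, sphereMap, bcvLambda_hopfCylinder]
  ext i
  fin_cases i
  · change r * Real.sin ((1 + a * r ^ 2) / r * q 0) / (1 + a * r ^ 2)
      = r' * Real.sin ((1 + a * r' ^ 2) / r' * q 0) / (1 + a * r' ^ 2)
    rw [mul_div_right_comm, mul_div_right_comm, h1, h2]
  · change -(r * Real.cos ((1 + a * r ^ 2) / r * q 0)) / (1 + a * r ^ 2)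
      = -(r' * Real.cos ((1 + a * r' ^ 2) / r' * q 0)) / (1 + a * r' ^ 2)
    rw [neg_div, neg_div, mul_div_right_comm, mul_div_right_comm, h1, h2]
  · change -(1 / (√a * (1 + a * r ^ 2)) - 1 / (2 * √a)) = 1 / (√a * (1 + a * r' ^ 2)) - 1 / (2 * √a)
    have e : ∀ x : ℝ, 1 / (√a * x) = 1 / √a * (1 / x) := fun x => by rw [one_div_mul_one_div]
    rw [e, e (1 + a * r' ^ 2), h3]
    field_simp
    ring

theorem reflectThird_fderiv_sphereLineMap {r' : ℝ} (ha : 0 < a) (hr : 0 < r) (hr' : 0 < r')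
    (h : a * r * r' = 1) (q : EuclideanSpace ℝ (Fin 2)) :
    Prod.map reflectThird id (fderiv ℝ (sphereLineMap a) (hopfCylinder a r q) (hopfNormal a r q))
      = -fderiv ℝ (sphereLineMap a) (hopfCylinder a r' q) (hopfNormal a r' q) := by
  obtain ⟨h1, h2, -, h4⟩ := hopfCylinder_inversion ha hr hr' h
  have hθ : hopfAngle a r' q = hopfAngle a r q := by rw [hopfAngle, hopfAngle, h1]
  -- Written through `k` and `s/(1 + as²)`, the image of the normal shows its behaviour under
  -- inversion: the first two components carry `k` and change sign, the third does not. Reflecting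
  -- the third component therefore gives the opposite vector.
  have key : ∀ s : ℝ, 0 < s → fderiv ℝ (sphereLineMap a) (hopfCylinder a s q) (hopfNormal a s q)
      = (!₂[-(hopfCurv a s * (s / (1 + a * s ^ 2))) * Real.sin (hopfAngle a s q),
          hopfCurv a s * (s / (1 + a * s ^ 2)) * Real.cos (hopfAngle a s q),
          -(2 * a * (s / (1 + a * s ^ 2))) / √a], 0) := by
    intro s hs
    have hl : 1 + a * s ^ 2 ≠ 0 := by positivity
    have hcs := Real.sin_sq_add_cos_sq (hopfAngle a s q)
    have e0 : hopfCylinder a s q 0 = s * Real.sin (hopfAngle a s q) := rfl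
    have e1 : hopfCylinder a s q 1 = -(s * Real.cos (hopfAngle a s q)) := rfl
    have e2 : hopfCylinder a s q 0 * Real.sin (hopfAngle a s q)
        + hopfCylinder a s q 1 * -Real.cos (hopfAngle a s q) = s := by
      rw [e0, e1]
      linear_combination s * hcs
    rw [fderiv_sphereLineMap ha, bcvFrame_hopfNormal ha hs.ne', normal_hopfCylinder ha hs.ne']
    refine Prod.ext ?_ rfl
    simp only [sphereFrame, bcvLambda_hopfCylinder, Matrix.cons_val_zero, Matrix.cons_val_one, e2]
    rw [e0, e1, hopfCurv]
    ext i
    fin_cases i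
    · simp; field_simp; ring
    · simp; field_simp; ring
    · simp; ring
  rw [key r hr, key r' hr', hθ, h2, h4]
  refine Prod.ext ?_ (by simp)
  rw [Prod.map_fst, reflectThird_apply]
  ext i
  fin_cases i <;> simp

end HopfTheorem

/-! ### The main theorem. -/

theorem theorem4 (a b ρ : ℝ) (hρ : ρ = 4 * a) (hab : ρ ≠ b ^ 2) :
    -- classification
    (∀ (M : Type*) [TopologicalSpace M] [ChartedSpace (EuclideanSpace ℝ (Fin 2)) M]
        [IsManifold (𝓡 2) ∞ M] [ConnectedSpace M] (φ : M → Coord3),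
      MetricField.IsImmersion (bcvDomain a) φ →
      (bcvMetric a b).TotallyBiharmonic φ →
        (bcvMetric a b).TotallyGeodesic φ ∨
        (0 < a ∧ b = 0 ∧
          ∃ F, IsIsometryOntoSphereTimesLine a b ρ F ∧
            ∃ C ⊆ Metric.sphere (0 : EuclideanSpace ℝ (Fin 3)) (1 / √ρ),
              IsCircle C (1 / √(2 * ρ)) ∧ ∀ m, F (φ m) ∈ C ×ˢ (Set.univ : Set ℝ))) ∧
    -- the two radii
    (0 < a → b = 0 →
      (∀ r : ℝ, 0 < r →
        MetricField.IsImmersion (bcvDomain a) (hopfCylinder a r) ∧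
        ((bcvMetric a b).TotallyBiharmonic (hopfCylinder a r) ∧
            ¬ (bcvMetric a b).TotallyGeodesic (hopfCylinder a r) ↔
          r ^ 2 = (3 + 2 * √2) / a ∨ r ^ 2 = (3 - 2 * √2) / a)) ∧
      ∀ r₁ r₂ : ℝ, 0 < r₁ → 0 < r₂ → r₁ ^ 2 = (3 + 2 * √2) / a → r₂ ^ 2 = (3 - 2 * √2) / a →
        -- congruent in the product, by a congruence that reverses the outer normals
        (∃ F, IsIsometryOntoSphereTimesLine a b ρ F ∧
          ∃ A : EuclideanSpace ℝ (Fin 3) ≃ₗᵢ[ℝ] EuclideanSpace ℝ (Fin 3), ∀ q,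
            Prod.map A id (F (hopfCylinder a r₁ q)) = F (hopfCylinder a r₂ q) ∧
            Prod.map A id (fderiv ℝ F (hopfCylinder a r₁ q) (hopfNormal a r₁ q))
              = -fderiv ℝ F (hopfCylinder a r₂ q) (hopfNormal a r₂ q)) ∧
        -- equal first, opposite second fundamental forms
        (bcvMetric a b).IsUnitNormal (hopfCylinder a r₁) (hopfNormal a r₁) ∧
        (bcvMetric a b).IsUnitNormal (hopfCylinder a r₂) (hopfNormal a r₂) ∧
        (∀ q v, (bcvMetric a b).firstForm (hopfCylinder a r₁) q v
          = (bcvMetric a b).firstForm (hopfCylinder a r₂) q v) ∧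
        (∀ q v, (bcvMetric a b).secondForm (hopfCylinder a r₁) (hopfNormal a r₁) q v
          = -(bcvMetric a b).secondForm (hopfCylinder a r₂) (hopfNormal a r₂) q v)) := by
  subst hρ
  refine ⟨fun M _ _ _ _ φ hφ hB => totallyGeodesic_or_exists_circle hab hφ hB, ?_⟩
  rintro ha rfl
  refine ⟨fun r hr => ⟨isImmersion_of_isPatch_univ (isPatch_hopfCylinder ha hr.ne'),
    hopfCylinder_biharmonic_iff ha hr⟩, ?_⟩
  intro r₁ r₂ hr₁ hr₂ h₁ h₂
  -- The radii are exchanged by the inversion because `(3 + 2√2)(3 - 2√2) = 1`; positivity allows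
  -- the comparison of squares.
  have h : a * r₁ * r₂ = 1 := by
    have h2 : √2 ^ 2 = (2 : ℝ) := Real.sq_sqrt (by norm_num)
    rw [← sq_eq_sq₀ (by positivity) (by norm_num), mul_pow, mul_pow, h₁, h₂]
    field_simp
    linear_combination (-4) * h2
  obtain ⟨-, -, -, hκ⟩ := hopfCylinder_inversion ha hr₁ hr₂ h
  refine ⟨⟨sphereLineMap a, isIsometryOntoSphereTimesLine_sphereLineMap ha, reflectThird, fun q =>
    ⟨reflectThird_sphereLineMap ha hr₁ hr₂ h q, reflectThird_fderiv_sphereLineMap ha hr₁ hr₂ h q⟩⟩,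
    isUnitNormal_hopfNormal ha hr₁.ne', isUnitNormal_hopfNormal ha hr₂.ne', fun q v => ?_,
    fun q v => ?_⟩
  · rw [firstForm_hopfCylinder ha hr₁.ne', firstForm_hopfCylinder ha hr₂.ne']
  · rw [secondForm_hopfCylinder ha hr₁.ne', secondForm_hopfCylinder ha hr₂.ne', hκ]
    ring
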